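/- **Setting.** Let $n,d,m\in\mathbb N$. *Tableaux.* Let $\hat T$ be a Young tableau whose shape $\lambda$ is a partition of $nd$ with at most $m$ rows, and which contains each of the numbers $1,\dots,n$ exactly $d$ times (no monotonicity is required). Let $\mu_c$ denote the length of its $c$-th column. The column graph $G_{\hat T}$ has vertex set $\{1,\dots,n\}$; two distinct numbers are adjacent iff they occur in a common column of $\hat T$. *The function $f_{\hat T}$.* Let $T$ be any filling of $\lambda$ with the numbers $1,\dots,nd$, each used once, that becomes $\hat T$ when every entry $a$ is replaced by $k(a)=\lceil a/d\rceil$; put $j(a)=a-(k(a)-1)d$. For a symmetric tensor $p=\sum_{i=1}^r \ell_{i,1}\otimes\cdots\otimes\ell_{i,d}\in \mathrm{Sym}^d\mathbb C^m\subseteq\otimes^d\mathbb C^m$ let $$f_{\hat T}(p)=\sum_{\varphi:\{1,\dots,n\}\to\{1,\dots,r\}}\ \prod_{c=1}^{\lambda_1}\det\bigl(\vartheta_\varphi(T(1,c)),\dots,\vartheta_\varphi(T(\mu_c,c))\bigr),\qquad \vartheta_\varphi(a)=\ell_{\varphi(k(a)),\,j(a)},$$ where the determinant of an $m\times\mu_c$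 matrix is that of its top $\mu_c\times\mu_c$ submatrix. The value depends neither on the decomposition of $p$ nor on the choice of $T$. *Branching programs.* A noncommutative algebraic branching program (ncABP) $A$ has nonempty layers $L_0,\dots,L_d$ of vertices with $|L_0|=|L_d|=1$, and edges from $L_{l-1}$ to $L_l$ ($1\le l\le d$) labelled with vectors of $\mathbb C^m$ (absent edges are edges with label $0$). It computes the tensor $\sum_P \ell_1(P)\otimes\cdots\otimes\ell_d(P)$, the sum being over all paths $P$ from $L_0$ to $L_d$ with edge labels $\ell_1(P),\dots,\ell_d(P)$. Its width is $w=\max_l|L_l|$. *Tree decompositions.* A tree decomposition $\mathcal T$ of a graph is a tree whose nodes carry bags (sets of vertices) such that every vertex lies in a bag, both ends of every edge lie in a common bag, and for each vertex the nodes whose bags contain it form a subtree. Its size $|\mathcal T|$ is the number of nodes; its width $\tau$ is the size of the largest bag minus one. *Time.* Time is measured on a random access machine with finitely many arrays of natural numbers and of complex numbers, at unit cost for each addition or truncated subtraction of natural numbers, each field operation on complex numbers, each access to a cell, and each comparison of natural numbers or equality test of complex numbers. Programs may contain complex constants. Cells that hold no part of the input have arbitrary initial contents. **Theorem.** Let $\omega\in\mathbb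 R$ be such that two $k\times k$ complex matrices can be multiplied in time $O(k^\omega)$ for $k\ge 1$. Then there are a program and a polynomial $q$ such that for all $n,d,m$, every $\hat T$ as above, every $p\in\mathrm{Sym}^d\mathbb C^m$, every ncABP $A$ of width $w$ computing $p$, and every tree decomposition $\mathcal T$ of $G_{\hat T}$ of width $\tau$, the program, given $\hat T$, $A$ and $\mathcal T$ as input, computes $f_{\hat T}(p)$ in time at most $$w^{\omega(\tau+1)}\cdot q(n,d,m,|\mathcal T|).$$ -/

import Mathlib

open scoped BigOperators

/-! ### Tensors, noncommutative algebraic branching programs -/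

/-- Tensors of order `d` over `ℂ^m`: `m × ⋯ × m` arrays of complex numbers. -/
abbrev Tensor (d m : ℕ) : Type := (Fin d → Fin m) → ℂ

/-- Symmetric tensors, the elements of `Sym^d ℂ^m`. -/
def Tensor.IsSymmetric {d m : ℕ} (p : Tensor d m) : Prop :=
  ∀ (σ : Equiv.Perm (Fin d)) (I : Fin d → Fin m), p (I ∘ σ) = p I

/-- A noncommutative algebraic branching program with layers `0, …, d`, whose edges are labelled
with vectors of `ℂ^m`.  The layers `0` and `d` consist of the source and of the sink.
An absent edge is an edge with label `0`. -/
structure NcABP (d m : ℕ) where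
  /-- number of vertices of each layer -/
  layerSize : Fin (d + 1) → ℕ
  layerSize_pos : ∀ l, 0 < layerSize l
  source_layer : layerSize 0 = 1
  sink_layer : layerSize (Fin.last d) = 1
  /-- label of the edge from a vertex of layer `l` to a vertex of layer `l + 1` -/
  label : (l : Fin d) → Fin (layerSize l.castSucc) → Fin (layerSize l.succ) → (Fin m → ℂ)

namespace NcABP

variable {d m : ℕ}

/-- The width: the largest number of vertices of a layer. -/
def width (A : NcABP d m) : ℕ := Finset.univ.sup A.layerSize

/-- The source-sink paths: one vertex in each layer. -/
abbrev Path (A : NcABP d m) : Type := (l : Fin (d + 1)) → Fin (A.layerSize l)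

/-- The labels `ℓ_1, …, ℓ_d` of the edges of a path. -/
def pathLabel (A : NcABP d m) (π : A.Path) (l : Fin d) : Fin m → ℂ :=
  A.label l (π l.castSucc) (π l.succ)

/-- The tensor computed by `A`: the sum over all source-sink paths of `ℓ_1 ⊗ ⋯ ⊗ ℓ_d`. -/
noncomputable def tensor (A : NcABP d m) : Tensor d m :=
  fun I => ∑ π : A.Path, ∏ l : Fin d, A.pathLabel π l (I l)

/-- `A` computes the tensor `p`. -/
def Computes (A : NcABP d m) (p : Tensor d m) : Prop := A.tensor = p

end NcABP

/-! ### Young tableaux and the functions `f_T` -/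

/-- The box in row `b` of column `c`. -/
def YoungDiagram.box (μ : YoungDiagram) (c : ℕ) (b : Fin (μ.colLen c)) : μ.cells :=
  ⟨((b : ℕ), c), (YoungDiagram.mem_cells _).2 (YoungDiagram.mem_iff_lt_colLen.2 b.2)⟩

/-- A Young tableau of content `n × d` with at most `m` rows: each of the `n` numbers
(`Fin n` stands for `1, …, n`) occurs in exactly `d` boxes.  No monotonicity is required. -/
structure RectTableau (n d m : ℕ) where
  shape : YoungDiagram
  rows_le : shape.colLen 0 ≤ m
  entry : shape.cells → Fin n
  content : ∀ i, (Finset.univ.filter fun x => entry x = i).card = d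

namespace RectTableau

variable {n d m : ℕ}

theorem colLen_le (T : RectTableau n d m) (c : ℕ) : T.shape.colLen c ≤ m :=
  (T.shape.colLen_anti 0 c (Nat.zero_le c)).trans T.rows_le

/-- The tableaux `S` of content `(nd) × 1` that become `T` when each entry is replaced by the
number of its block.  The pair `(k, j)`, counted from `0`, stands for the entry `k d + j + 1`,
the element number `j` of the block number `k`. -/
abbrev Lift (T : RectTableau n d m) : Type :=
  {S : T.shape.cells ≃ Fin n × Fin d // ∀ x, (S x).1 = T.entry x}

theorem nonempty_lift (T : RectTableau n d m) : Nonempty T.Lift := by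
  have h : ∀ i, Nonempty ({x // T.entry x = i} ≃ Fin d) := fun i =>
    ⟨Fintype.equivFinOfCardEq (by rw [Fintype.card_subtype]; exact T.content i)⟩
  refine ⟨⟨(Equiv.sigmaFiberEquiv T.entry).symm.trans
    ((Equiv.sigmaCongrRight fun i => (h i).some).trans (Equiv.sigmaEquivProd _ _)), ?_⟩⟩
  intro x
  rfl

/-- The product over all columns `c` of the determinants of the top square parts of the matrices
`(ϑ(S(1,c)) ⋯ ϑ(S(μ_c,c)))`, where the vector `v k j` is placed on the entry `(k, j)`. -/
noncomputable def columnDets (T : RectTableau n d m) (S : T.Lift)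
    (v : Fin n → Fin d → Fin m → ℂ) : ℂ :=
  ∏ c : Fin (T.shape.rowLen 0),
    Matrix.det (Matrix.of fun a b : Fin (T.shape.colLen c) =>
      v (S.1 (T.shape.box c b)).1 (S.1 (T.shape.box c b)).2 (Fin.castLE (T.colLen_le c) a))

/-- The sum over all proper placements for a decomposition `p = ∑ i, ℓ i 1 ⊗ ⋯ ⊗ ℓ i d`: each
block `k` chooses a summand `φ k`. -/
noncomputable def placementSum (T : RectTableau n d m) (S : T.Lift) {ι : Type*} [Fintype ι]
    (ℓ : ι → Fin d → Fin m → ℂ) : ℂ :=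
  ∑ φ : Fin n → ι, T.columnDets S fun k j => ℓ (φ k) j

/-- `f_S(p)`, computed from the decomposition `p = ∑ I, p I • e_(I 1) ⊗ ⋯ ⊗ e_(I d)`.
Any other decomposition gives the same value, see `evalLift_eq_placementSum`. -/
noncomputable def evalLift (T : RectTableau n d m) (S : T.Lift) (p : Tensor d m) : ℂ :=
  ∑ φ : Fin n → (Fin d → Fin m),
    (∏ k, p (φ k)) * T.columnDets S fun k j => Pi.single (φ k j) 1

/-- `f_T(p)` for a tableau `T` of content `n × d`: it is `f_S(p)` for any `S` that becomes `T`
under the replacement of entries by blocks.  On symmetric tensors the choice of `S` does not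
matter, see `eval_eq_evalLift`. -/
noncomputable def eval (T : RectTableau n d m) (p : Tensor d m) : ℂ :=
  T.evalLift (Classical.choice T.nonempty_lift) p

/-! #### Well-definedness -/

/-- The boxes, sorted by columns, are in bijection with the entries `(k, j)`. -/
noncomputable def boxEquiv (T : RectTableau n d m) (S : T.Lift) :
    (Σ c : Fin (T.shape.rowLen 0), Fin (T.shape.colLen c)) ≃ Fin n × Fin d :=
  (Equiv.ofBijective (fun x => T.shape.box x.1 x.2) (by
    constructor
    · rintro ⟨c, b⟩ ⟨c', b'⟩ h
      have h1 := congrArg (fun z : T.shape.cells => z.1.1) h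
      have h2 := congrArg (fun z : T.shape.cells => z.1.2) h
      simp only [YoungDiagram.box] at h1 h2
      have h3 : c = c' := Fin.ext h2
      subst h3
      have h4 : b = b' := Fin.ext h1
      rw [h4]
    · rintro ⟨⟨r, c⟩, hx⟩
      have hx' : (r, c) ∈ T.shape := (YoungDiagram.mem_cells _).1 hx
      have h0 : (0, c) ∈ T.shape := T.shape.up_left_mem (Nat.zero_le r) le_rfl hx'
      exact ⟨⟨⟨c, YoungDiagram.mem_iff_lt_rowLen.1 h0⟩,
        ⟨r, YoungDiagram.mem_iff_lt_colLen.1 hx'⟩⟩, rfl⟩)).trans S.1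

/-- The row that the permutations `σ` of the columns assign to the entry `(k, j)`. -/
noncomputable def rowAt (T : RectTableau n d m) (S : T.Lift)
    (σ : (c : Fin (T.shape.rowLen 0)) → Equiv.Perm (Fin (T.shape.colLen c)))
    (k : Fin n) (j : Fin d) : Fin m :=
  Fin.castLE (T.colLen_le _)
    (σ ((T.boxEquiv S).symm (k, j)).1 ((T.boxEquiv S).symm (k, j)).2)

theorem columnDets_eq (T : RectTableau n d m) (S : T.Lift) (v : Fin n → Fin d → Fin m → ℂ) :
    T.columnDets S v = ∑ σ : (c : Fin (T.shape.rowLen 0)) → Equiv.Perm (Fin (T.shape.colLen c)),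
      (∏ c, ((Equiv.Perm.sign (σ c) : ℤ) : ℂ)) * ∏ k, ∏ j, v k j (T.rowAt S σ k j) := by
  unfold columnDets
  simp only [Matrix.det_apply']
  rw [Finset.prod_univ_sum, Fintype.piFinset_univ]
  refine Finset.sum_congr rfl fun σ _ => ?_
  rw [Finset.prod_mul_distrib]
  congr 1
  rw [← Fintype.prod_prod_type' (f := fun k j => v k j (T.rowAt S σ k j)),
    ← Equiv.prod_comp (T.boxEquiv S), Fintype.prod_sigma]
  refine Finset.prod_congr rfl fun c _ => Finset.prod_congr rfl fun b _ => ?_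
  have h : T.rowAt S σ ((T.boxEquiv S) ⟨c, b⟩).1 ((T.boxEquiv S) ⟨c, b⟩).2
      = Fin.castLE (T.colLen_le c) (σ c b) := by
    have e : (T.boxEquiv S).symm (((T.boxEquiv S) ⟨c, b⟩).1, ((T.boxEquiv S) ⟨c, b⟩).2) = ⟨c, b⟩ :=
      (T.boxEquiv S).symm_apply_apply _
    exact congrArg (fun x : (Σ c : Fin (T.shape.rowLen 0), Fin (T.shape.colLen c)) =>
      Fin.castLE (T.colLen_le x.1) (σ x.1 x.2)) e
  rw [h]
  rfl

theorem evalLift_eq_sum (T : RectTableau n d m) (S : T.Lift) (p : Tensor d m) :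
    T.evalLift S p = ∑ σ : (c : Fin (T.shape.rowLen 0)) → Equiv.Perm (Fin (T.shape.colLen c)),
      (∏ c, ((Equiv.Perm.sign (σ c) : ℤ) : ℂ)) * ∏ k, p (T.rowAt S σ k) := by
  unfold evalLift
  simp only [columnDets_eq, Finset.mul_sum]
  rw [Finset.sum_comm]
  refine Finset.sum_congr rfl fun σ _ => ?_
  rw [Finset.sum_eq_single (T.rowAt S σ)]
  · simp [mul_comm]
  · intro φ _ hφ
    obtain ⟨k, hk⟩ := Function.ne_iff.1 hφ
    obtain ⟨j, hj⟩ := Function.ne_iff.1 hk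
    have : ∏ k, ∏ j, (Pi.single (φ k j) (1 : ℂ) : Fin m → ℂ) (T.rowAt S σ k j) = 0 :=
      Finset.prod_eq_zero (Finset.mem_univ k)
        (Finset.prod_eq_zero (Finset.mem_univ j) (Pi.single_eq_of_ne hj.symm _))
    rw [this]
    simp
  · simp

/-- `f_S(p)` is the sum over the proper placements of any decomposition of `p`. -/
theorem evalLift_eq_placementSum (T : RectTableau n d m) (S : T.Lift) {ι : Type*} [Fintype ι]
    (ℓ : ι → Fin d → Fin m → ℂ) (p : Tensor d m) (hp : ∀ I, p I = ∑ i, ∏ j, ℓ i j (I j)) :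
    T.evalLift S p = T.placementSum S ℓ := by
  classical
  rw [evalLift_eq_sum]
  unfold placementSum
  simp only [columnDets_eq]
  rw [Finset.sum_comm]
  refine Finset.sum_congr rfl fun σ _ => ?_
  rw [← Finset.mul_sum]
  congr 1
  simp only [hp]
  rw [Finset.prod_univ_sum, Fintype.piFinset_univ]

/-- On symmetric tensors the value does not depend on the choice of the lift. -/
theorem eval_eq_evalLift (T : RectTableau n d m) (S : T.Lift) (p : Tensor d m)
    (hp : p.IsSymmetric) : T.eval p = T.evalLift S p := by
  unfold eval
  generalize Classical.choice T.nonempty_lift = S'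
  rw [evalLift_eq_sum, evalLift_eq_sum]
  refine Finset.sum_congr rfl fun σ _ => ?_
  congr 1
  refine Finset.prod_congr rfl fun k _ => ?_
  have key : ∀ S₁ S₂ : T.Lift, ∀ j, S₁.1 (S₂.1.symm (k, j)) =
      (k, (S₁.1 (S₂.1.symm (k, j))).2) := by
    intro S₁ S₂ j
    refine Prod.ext ?_ rfl
    rw [S₁.2, ← S₂.2]
    simp
  let ρ : Equiv.Perm (Fin d) :=
    { toFun := fun j => (S.1 (S'.1.symm (k, j))).2
      invFun := fun j => (S'.1 (S.1.symm (k, j))).2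
      left_inv := fun j => by simp [← key]
      right_inv := fun j => by simp [← key] }
  rw [← hp ρ (T.rowAt S σ k)]
  congr 1
  funext j
  have h : (T.boxEquiv S).symm (k, ρ j) = (T.boxEquiv S').symm (k, j) := by
    have h1 : (k, ρ j) = S.1 (S'.1.symm (k, j)) := (key S S' j).symm
    rw [h1]
    simp [boxEquiv]
  exact (congrArg (fun x : (Σ c : Fin (T.shape.rowLen 0), Fin (T.shape.colLen c)) =>
    Fin.castLE (T.colLen_le x.1) (σ x.1 x.2)) h).symm

/-- The column graph: two distinct numbers are adjacent if they occur in a common column. -/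
def columnGraph (T : RectTableau n d m) : SimpleGraph (Fin n) where
  Adj i j := i ≠ j ∧ ∃ x y : T.shape.cells, x.1.2 = y.1.2 ∧ T.entry x = i ∧ T.entry y = j
  symm := ⟨fun _ _ ⟨h, x, y, e, hx, hy⟩ => ⟨h.symm, y, x, e.symm, hy, hx⟩⟩
  loopless := ⟨fun _ h => h.1 rfl⟩

end RectTableau

/-! ### Tree decompositions -/

/-- A tree decomposition of a graph: a tree whose nodes carry bags of vertices. -/
structure TreeDecomposition {V : Type*} (G : SimpleGraph V) where
  /-- the size, that is, the number of nodes (bags) -/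
  size : ℕ
  tree : SimpleGraph (Fin size)
  isTree : tree.IsTree
  bag : Fin size → Finset V
  vertex_covered : ∀ v, ∃ x, v ∈ bag x
  edge_covered : ∀ u v, G.Adj u v → ∃ x, u ∈ bag x ∧ v ∈ bag x
  subtree : ∀ v, (tree.induce {x | v ∈ bag x}).Connected

/-- The width: the size of the largest bag minus one. -/
def TreeDecomposition.width {V : Type*} {G : SimpleGraph V} (D : TreeDecomposition G) : ℤ :=
  ((Finset.univ.sup fun x => (D.bag x).card : ℕ) : ℤ) - 1

/-! ### Random access machines over the complex numbers

The memory consists of arrays of natural numbers and of arrays of complex numbers; a program, which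
is a finite piece of code, uses finitely many of them.  Every arithmetic operation, every access to
an array cell and every test costs one unit.  On natural numbers only addition and (truncated)
subtraction are available, on complex numbers the field operations and the test for equality. -/

/-- The contents of the memory: `nat a i` and `cpx a i` are the contents of cell `i` of array `a`. -/
structure Memory where
  nat : ℕ → ℕ → ℕ
  cpx : ℕ → ℕ → ℂ

/-- Store `x` in cell `i` of the natural array `a`. -/
def Memory.setNat (s : Memory) (a i x : ℕ) : Memory where
  nat := Function.update s.nat a (Function.update (s.nat a) i x)
  cpx := s.cpx

/-- Store `z` in cell `i` of the complex array `a`. -/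
noncomputable def Memory.setCpx (s : Memory) (a i : ℕ) (z : ℂ) : Memory where
  nat := s.nat
  cpx := Function.update s.cpx a (Function.update (s.cpx a) i z)

/-- Expressions with values in the natural numbers. -/
inductive NatExpr where
  | const (c : ℕ)
  | cell (a : ℕ) (i : NatExpr)
  | add (e f : NatExpr)
  | sub (e f : NatExpr)

namespace NatExpr

def val (s : Memory) : NatExpr → ℕ
  | const c => c
  | cell a i => s.nat a (i.val s)
  | add e f => e.val s + f.val s
  | sub e f => e.val s - f.val s

def cost : NatExpr → ℕ
  | const _ => 1
  | cell _ i => i.cost + 1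
  | add e f => e.cost + f.cost + 1
  | sub e f => e.cost + f.cost + 1

end NatExpr

/-- Expressions with values in the complex numbers. -/
inductive CpxExpr where
  | const (z : ℂ)
  | cell (a : ℕ) (i : NatExpr)
  | add (e f : CpxExpr)
  | sub (e f : CpxExpr)
  | mul (e f : CpxExpr)
  | div (e f : CpxExpr)

namespace CpxExpr

noncomputable def val (s : Memory) : CpxExpr → ℂ
  | const z => z
  | cell a i => s.cpx a (i.val s)
  | add e f => e.val s + f.val s
  | sub e f => e.val s - f.val s
  | mul e f => e.val s * f.val s
  | div e f => e.val s / f.val s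

def cost : CpxExpr → ℕ
  | const _ => 1
  | cell _ i => i.cost + 1
  | add e f => e.cost + f.cost + 1
  | sub e f => e.cost + f.cost + 1
  | mul e f => e.cost + f.cost + 1
  | div e f => e.cost + f.cost + 1

end CpxExpr

/-- Tests: comparisons of natural numbers, and equality of complex numbers. -/
inductive Test where
  | natLt (e f : NatExpr)
  | natEq (e f : NatExpr)
  | cpxEq (e f : CpxExpr)

namespace Test

def Holds (s : Memory) : Test → Prop
  | natLt e f => e.val s < f.val s
  | natEq e f => e.val s = f.val s
  | cpxEq e f => e.val s = f.val s

def cost : Test → ℕ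
  | natLt e f => e.cost + f.cost + 1
  | natEq e f => e.cost + f.cost + 1
  | cpxEq e f => e.cost + f.cost + 1

end Test

/-- Programs. `setNat a i e` and `setCpx a i e` store the value of `e` in cell `i` of array `a`. -/
inductive Program where
  | skip
  | setNat (a : ℕ) (i e : NatExpr)
  | setCpx (a : ℕ) (i : NatExpr) (e : CpxExpr)
  | seq (P Q : Program)
  | branch (b : Test) (P Q : Program)
  | loop (b : Test) (P : Program)

/-- `Runs P s s' t`: started with memory `s`, the program `P` halts with memory `s'` after a run
of cost `t`. -/
inductive Runs : Program → Memory → Memory → ℕ → Prop where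
  | skip (s : Memory) : Runs .skip s s 1
  | setNat (a : ℕ) (i e : NatExpr) (s : Memory) :
      Runs (.setNat a i e) s
        (s.setNat a (i.val s) (e.val s))
        (i.cost + e.cost + 1)
  | setCpx (a : ℕ) (i : NatExpr) (e : CpxExpr) (s : Memory) :
      Runs (.setCpx a i e) s
        (s.setCpx a (i.val s) (e.val s))
        (i.cost + e.cost + 1)
  | seq {P Q : Program} {s s' s'' : Memory} {t t' : ℕ} :
      Runs P s s' t → Runs Q s' s'' t' → Runs (.seq P Q) s s'' (t + t')
  | branch_true {b : Test} {P Q : Program} {s s' : Memory} {t : ℕ} :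
      b.Holds s → Runs P s s' t → Runs (.branch b P Q) s s' (b.cost + t)
  | branch_false {b : Test} {P Q : Program} {s s' : Memory} {t : ℕ} :
      ¬ b.Holds s → Runs Q s s' t → Runs (.branch b P Q) s s' (b.cost + t)
  | loop_true {b : Test} {P : Program} {s s' s'' : Memory} {t t' : ℕ} :
      b.Holds s → Runs P s s' t → Runs (.loop b P) s' s'' t' →
        Runs (.loop b P) s s'' (b.cost + t + t')
  | loop_false {b : Test} {P : Program} {s : Memory} :
      ¬ b.Holds s → Runs (.loop b P) s s b.cost

/-! ### The two computational problems

All cells that do not hold a part of the input may have arbitrary initial contents. -/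

/-- Two `k × k` matrices can be multiplied in time `O(k ^ ω)`.  The input is `k` in cell 0 of
the natural array 0, and the matrices, row by row, in the complex arrays 0 and 1.  The product is
written to the complex array 2. -/
def MatMulInTime (ω : ℝ) : Prop :=
  ∃ (P : Program) (C : ℝ), ∀ (k : ℕ), 1 ≤ k → ∀ (X Y : Matrix (Fin k) (Fin k) ℂ) (s : Memory),
    s.nat 0 0 = k →
    (∀ i j : Fin k, s.cpx 0 (i * k + j) = X i j) →
    (∀ i j : Fin k, s.cpx 1 (i * k + j) = Y i j) →
    ∃ (s' : Memory) (t : ℕ), Runs P s s' t ∧ (t : ℝ) ≤ C * (k : ℝ) ^ ω ∧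
      ∀ i j : Fin k, s'.cpx 2 (i * k + j) = (X * Y) i j

open Classical in
/-- The memory `s` holds a tableau, a branching program and a tree decomposition of the column
graph.  All numbers are counted from `0`. -/
structure HoldsInput {n d m : ℕ} (T : RectTableau n d m) (A : NcABP d m)
    (D : TreeDecomposition T.columnGraph) (s : Memory) : Prop where
  n_eq : s.nat 0 0 = n
  d_eq : s.nat 0 1 = d
  m_eq : s.nat 0 2 = m
  columns_eq : s.nat 0 3 = T.shape.rowLen 0
  size_eq : s.nat 0 4 = D.size
  width_eq : s.nat 0 5 = A.width
  /-- the lengths of the columns -/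
  colLen_eq : ∀ c < T.shape.rowLen 0, s.nat 1 c = T.shape.colLen c
  /-- the entries of the tableau, column by column; each column takes `m` cells -/
  entry_eq : ∀ x : T.shape.cells, s.nat 2 (x.1.2 * m + x.1.1) = T.entry x
  /-- the sizes of the layers of the branching program -/
  layer_eq : ∀ l : Fin (d + 1), s.nat 3 l = A.layerSize l
  /-- the adjacency matrix of the tree -/
  tree_eq : ∀ x y : Fin D.size, s.nat 4 (x * D.size + y) = if D.tree.Adj x y then 1 else 0
  /-- the incidence matrix of the bags -/
  bag_eq : ∀ (x : Fin D.size) (v : Fin n), s.nat 5 (x * n + v) = if v ∈ D.bag x then 1 else 0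
  /-- the coordinates of the labels of the branching program -/
  label_eq : ∀ (l : Fin d) (u : Fin (A.layerSize l.castSucc)) (v : Fin (A.layerSize l.succ))
    (a : Fin m), s.cpx 0 (((l * A.width + u) * A.width + v) * m + a) = A.label l u v a

/-! ### Memory updates -/

/-! Write `w` for the width of the branching program. Expanding the column determinants turns the
value into a signed sum, over one permutation per column, of products of coordinates of `p`, one
coordinate for each number. A coordinate of `p` is in turn an entry of a product of `d` label
matrices. So imagine `n` copies of the branching program, one for each number, and process the
columns one after the other: a column advances the copies of its numbers by one edge each. A state
selects a vertex in every copy, a column acts on states by the matrix `transfer`, whose entries are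
determinants, and the value is the entry of the product of all these matrices at the state of the
sources and the state of the sinks (`eval_eq_segment`). This is true for every order of the columns:
the order only selects a lift of the tableau (`exists_lift`), and symmetry of `p` makes all lifts
equivalent. If a column repeats a number, both sides are zero (`eval_eq_zero`, `transfer_eq_zero`).

These matrices have `w ^ n` rows, and the tree decomposition serves to shrink them. The numbers of a
column form a clique of the column graph, hence lie in one bag
(`TreeDecomposition.exists_subset_bag`). A depth first search through the tree collects the columns;
every node on its stack stores the product of the matrices of a block of columns, but only on states
that are 0 outside of the bag, so that `w ^ |bag|` rows suffice. Two facts justify this. A copy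
whose number does not occur in a block of columns stands still (`segment_eq_zero`), and the name of
its vertex is irrelevant (`segment_submatrix`). A tree edge separates the tree: a number on both
sides of it lies in both of its bags. Hence, when a finished child hands its block to its parent,
numbers outside of the parent's bag are at vertex 0 between the two blocks (`segment_append_apply`),
and numbers of the parent's bag that are missing in the child's bag are not moved by the child's
block (`segment_restrict`).

Every column and every tree edge costs one multiplication of matrices with at most `K = w ^ (τ + 1)`
rows, and the computation of about `K ^ 2` entries, each in polynomial time by Gaussian elimination.
A multiplication has to write `k ^ 2` cells, so `ω ≥ 2` (`MatMulInTime.two_le`), and the total is `K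
^ ω` times a polynomial.

The remaining work is to carry this out on the machine: a calculus of total correctness with time
bounds (`Run`), frame conditions read off from the program text, relocation of the given
multiplication program to arrays it cannot share with others, and mixed radix numbers for the
states. Since natural numbers can only be added and subtracted, all products that occur in addresses
come from tables of multiples. -/

namespace Memory

variable (s : Memory) (a b i j x : ℕ) (z : ℂ)

theorem setNat_nat_ne {a b : ℕ} (h : b ≠ a) : (s.setNat a i x).nat b = s.nat b := by
  simp [setNat, h]

theorem setCpx_cpx_ne {a b : ℕ} (h : b ≠ a) : (s.setCpx a i z).cpx b = s.cpx b := by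
  simp [setCpx, h]

@[simp] theorem setNat_cpx : (s.setNat a i x).cpx = s.cpx := rfl

@[simp] theorem setCpx_nat : (s.setCpx a i z).nat = s.nat := rfl

theorem setNat_nat_apply :
    (s.setNat a i x).nat b j = if b = a ∧ j = i then x else s.nat b j := by
  by_cases h : b = a
  · subst h
    by_cases h' : j = i <;> simp [setNat, h']
  · simp [setNat, h]

theorem setCpx_cpx_apply :
    (s.setCpx a i z).cpx b j = if b = a ∧ j = i then z else s.cpx b j := by
  by_cases h : b = a
  · subst h
    by_cases h' : j = i <;> simp [setCpx, h']
  · simp [setCpx, h]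

@[simp] theorem setNat_nat_self : (s.setNat a i x).nat a i = x := by simp [setNat_nat_apply]

@[simp] theorem setCpx_cpx_self : (s.setCpx a i z).cpx a i = z := by simp [setCpx_cpx_apply]

end Memory

/-! ### Syntactic frame conditions -/

namespace Program

/-- The program contains no assignment to the natural array `a`. -/
def natFree (a : ℕ) : Program → Bool
  | skip => true
  | setNat b _ _ => a != b
  | setCpx _ _ _ => true
  | seq P Q => P.natFree a && Q.natFree a
  | branch _ P Q => P.natFree a && Q.natFree a
  | loop _ P => P.natFree a

/-- The program contains no assignment to the complex array `a`. -/
def cpxFree (a : ℕ) : Program → Bool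
  | skip => true
  | setNat _ _ _ => true
  | setCpx b _ _ => a != b
  | seq P Q => P.cpxFree a && Q.cpxFree a
  | branch _ P Q => P.cpxFree a && Q.cpxFree a
  | loop _ P => P.cpxFree a

/-- The memory `s'` differs from `s` at most in arrays to which `P` contains an assignment. -/
structure Frame (P : Program) (s s' : Memory) : Prop where
  nat : ∀ a, P.natFree a = true → s'.nat a = s.nat a
  cpx : ∀ a, P.cpxFree a = true → s'.cpx a = s.cpx a

theorem Frame.refl (P : Program) (s : Memory) : P.Frame s s := ⟨fun _ _ => rfl, fun _ _ => rfl⟩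

theorem Frame.trans {P : Program} {s s' s'' : Memory} (h : P.Frame s s') (h' : P.Frame s' s'') :
    P.Frame s s'' :=
  ⟨fun a ha => (h'.nat a ha).trans (h.nat a ha), fun a ha => (h'.cpx a ha).trans (h.cpx a ha)⟩

end Program

open Program

/-- Assignments are the only instructions that alter the memory, and each alters only the array it
names. As `natFree` and `cpxFree` are Boolean, `rfl` and `decide` settle which arrays a concrete
program preserves. -/
theorem Runs.frame {P : Program} {s s' : Memory} {t : ℕ} (h : Runs P s s' t) : P.Frame s s' := by
  induction h with
  | skip s => exact .refl _ _
  | setNat a i e s =>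
    exact ⟨fun b hb => s.setNat_nat_ne _ _ (by simpa [natFree] using hb), fun _ _ => rfl⟩
  | setCpx a i e s =>
    exact ⟨fun _ _ => rfl, fun b hb => s.setCpx_cpx_ne _ _ (by simpa [cpxFree] using hb)⟩
  | seq _ _ h1 h2 =>
    refine ⟨fun a ha => ?_, fun a ha => ?_⟩
    · simp only [natFree, Bool.and_eq_true] at ha
      exact (h2.nat a ha.2).trans (h1.nat a ha.1)
    · simp only [cpxFree, Bool.and_eq_true] at ha
      exact (h2.cpx a ha.2).trans (h1.cpx a ha.1)
  | branch_true _ _ h =>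
    refine ⟨fun a ha => ?_, fun a ha => ?_⟩
    · simp only [natFree, Bool.and_eq_true] at ha
      exact h.nat a ha.1
    · simp only [cpxFree, Bool.and_eq_true] at ha
      exact h.cpx a ha.1
  | branch_false _ _ h =>
    refine ⟨fun a ha => ?_, fun a ha => ?_⟩
    · simp only [natFree, Bool.and_eq_true] at ha
      exact h.nat a ha.2
    · simp only [cpxFree, Bool.and_eq_true] at ha
      exact h.cpx a ha.2
  | loop_true _ _ _ h1 h2 =>
    exact ⟨fun a ha => (h2.nat a ha).trans (h1.nat a ha),
      fun a ha => (h2.cpx a ha).trans (h1.cpx a ha)⟩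
  | loop_false _ => exact .refl _ _

/-! ### Total correctness with time bounds -/

/-- Started with memory `s`, the program `P` halts after at most `T` units of time with a memory
that satisfies `Q`. -/
def Run (P : Program) (s : Memory) (T : ℕ) (Q : Memory → Prop) : Prop :=
  ∃ s' t, Runs P s s' t ∧ t ≤ T ∧ Q s'

namespace Run

variable {P P' : Program} {s : Memory} {T T' : ℕ} {Q Q' : Memory → Prop}

theorem mono (h : Run P s T Q) (hT : T ≤ T') (hQ : ∀ s', P.Frame s s' → Q s' → Q' s') :
    Run P s T' Q' := by
  obtain ⟨s', t, hr, ht, hq⟩ := h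
  exact ⟨s', t, hr, ht.trans hT, hQ s' hr.frame hq⟩

theorem mono_time (h : Run P s T Q) (hT : T ≤ T') : Run P s T' Q := h.mono hT fun _ _ h => h

theorem skip (h : Q s) : Run .skip s 1 Q := ⟨s, 1, .skip s, le_rfl, h⟩

theorem seq {R : Memory → Prop} (h : Run P s T R)
    (h' : ∀ s', P.Frame s s' → R s' → Run P' s' T' Q) : Run (.seq P P') s (T + T') Q := by
  obtain ⟨s', t, hr, ht, hR⟩ := h
  obtain ⟨s'', t', hr', ht', hQ⟩ := h' s' hr.frame hR
  exact ⟨s'', t + t', .seq hr hr', by omega, hQ⟩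

/-- A uniform price of 30 for every assignment keeps the time bounds independent of the expressions;
that the true cost is not larger is checked by evaluation. -/
theorem setNat {a : ℕ} {i e : NatExpr} (h : Q (s.setNat a (i.val s) (e.val s)))
    (hc : Nat.ble (i.cost + e.cost) 29 = true := by rfl) : Run (.setNat a i e) s 30 Q :=
  ⟨_, _, .setNat a i e s, by have := Nat.le_of_ble_eq_true hc; omega, h⟩

theorem setCpx {a : ℕ} {i : NatExpr} {e : CpxExpr} (h : Q (s.setCpx a (i.val s) (e.val s)))
    (hc : Nat.ble (i.cost + e.cost) 29 = true := by rfl) : Run (.setCpx a i e) s 30 Q :=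
  ⟨_, _, .setCpx a i e s, by have := Nat.le_of_ble_eq_true hc; omega, h⟩

theorem setNat_seq {a : ℕ} {i e : NatExpr} (h : Run P (s.setNat a (i.val s) (e.val s)) T Q)
    (hc : Nat.ble (i.cost + e.cost) 29 = true := by rfl) :
    Run (.seq (.setNat a i e) P) s (30 + T) Q :=
  (setNat (Q := fun s' => s' = s.setNat a (i.val s) (e.val s)) rfl hc).seq
    fun _ _ h' => by rw [h']; exact h

theorem setCpx_seq {a : ℕ} {i : NatExpr} {e : CpxExpr}
    (h : Run P (s.setCpx a (i.val s) (e.val s)) T Q)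
    (hc : Nat.ble (i.cost + e.cost) 29 = true := by rfl) :
    Run (.seq (.setCpx a i e) P) s (30 + T) Q :=
  (setCpx (Q := fun s' => s' = s.setCpx a (i.val s) (e.val s)) rfl hc).seq
    fun _ _ h' => by rw [h']; exact h

theorem branch {b : Test} (h : b.Holds s → Run P s T Q) (h' : ¬ b.Holds s → Run P' s T Q)
    (hc : Nat.ble b.cost 30 = true := by rfl) : Run (.branch b P P') s (30 + T) Q := by
  have hc := Nat.le_of_ble_eq_true hc
  by_cases hb : b.Holds s
  · obtain ⟨s', t, hr, ht, hq⟩ := h hb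
    exact ⟨s', _, .branch_true hb hr, by omega, hq⟩
  · obtain ⟨s', t, hr, ht, hq⟩ := h' hb
    exact ⟨s', _, .branch_false hb hr, by omega, hq⟩

/-- A loop whose invariant `I k` carries a bound `k` for the number of remaining iterations. -/
theorem loop {b : Test} (I : ℕ → Memory → Prop) (k : ℕ) (h0 : I k s)
    (hI : ∀ k s', I k s' → b.Holds s' ∧ Run P s' T fun s'' =>
      (∃ k' < k, I k' s'') ∨ (¬ b.Holds s'' ∧ Q s''))
    (hc : Nat.ble b.cost 30 = true := by rfl) :
    Run (.loop b P) s ((k + 1) * (T + 60)) Q := by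
  have hc' := Nat.le_of_ble_eq_true hc
  induction k using Nat.strong_induction_on generalizing s with
  | _ k ih =>
    obtain ⟨hb, s', t, hr, ht, hor⟩ := hI k s h0
    rcases hor with ⟨k', hk', hi⟩ | ⟨hn, hq⟩
    · obtain ⟨s'', t', hr', ht', hq⟩ := ih k' hk' hi
      refine ⟨s'', _, .loop_true hb hr hr', ?_, hq⟩
      have : (k' + 1 + 1) * (T + 60) ≤ (k + 1) * (T + 60) := Nat.mul_le_mul_right _ (by omega)
      rw [add_mul] at this
      omega
    · refine ⟨s', _, .loop_true hb hr (.loop_false hn), ?_, hq⟩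
      have : 1 * (T + 60) ≤ (k + 1) * (T + 60) := Nat.mul_le_mul_right _ (by omega)
      omega

end Run

/-! ### Counting loops -/

/-- The register `a`: cell `0` of the natural array `a`. -/
def NatExpr.reg (a : ℕ) : NatExpr := .cell a (.const 0)

@[simp] theorem NatExpr.val_reg (s : Memory) (a : ℕ) : (NatExpr.reg a).val s = s.nat a 0 := rfl

/-- `for i < (cell j of the natural array a) do B`. -/
def Program.forN (i a j : ℕ) (B : Program) : Program :=
  .seq (.setNat i (.const 0) (.const 0))
    (.loop (.natLt (.reg i) (.cell a (.const j)))
      (.seq B (.setNat i (.const 0) (.add (.reg i) (.const 1)))))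

/-- The number of iterations is fixed on entry, because by `hi` the body leaves the counter alone
and by `ha` nothing in the loop overwrites the limit. The invariant for `k + 1` is required after
the counter has been increased. As `M` and `T` are positive, the overhead of the loop disappears in
the factor 200. -/
theorem Run.forN {i a j : ℕ} {B : Program} {s : Memory} {M T : ℕ} {Q : Memory → Prop}
    (Inv : ℕ → Memory → Prop)
    (hM : s.nat a j ≤ M) (hM1 : 1 ≤ M) (hT1 : 1 ≤ T)
    (h0 : Inv 0 (s.setNat i 0 0))
    (hs : ∀ k < s.nat a j, ∀ s', (Program.forN i a j B).Frame s s' → s'.nat i 0 = k → Inv k s' →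
      Run B s' T fun s'' => Inv (k + 1) (s''.setNat i 0 (k + 1)))
    (hQ : ∀ s', (Program.forN i a j B).Frame s s' → Inv (s.nat a j) s' → Q s')
    (hi : B.natFree i = true := by rfl)
    (ha : (Program.forN i a j B).natFree a = true := by rfl) :
    Run (Program.forN i a j B) s (200 * (M * T)) Q := by
  set N := s.nat a j with hN
  have hfr : ∀ s', (Program.forN i a j B).Frame s s' → s'.nat a j = N := fun s' h => by
    rw [h.nat a ha]
  have hf0 : (Program.forN i a j B).Frame s (s.setNat i 0 0) := by
    refine ⟨fun b hb => s.setNat_nat_ne _ _ ?_, fun _ _ => rfl⟩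
    simp only [Program.forN, natFree, Bool.and_eq_true, bne_iff_ne] at hb
    exact hb.1
  have hstep : ∀ k s', Inv k s' ∧ (Program.forN i a j B).Frame s s' ∧ s'.nat i 0 = k ∧ k ≤ N →
      k < N → Run (.seq B (.setNat i (.const 0) (.add (.reg i) (.const 1)))) s' (T + 30)
      fun s'' => Inv (k + 1) s'' ∧ (Program.forN i a j B).Frame s s'' ∧ s''.nat i 0 = k + 1 ∧
        k + 1 ≤ N := by
    rintro k s' ⟨hinv, hf, hik, -⟩ hk
    refine (hs k hk s' hf hik hinv).seq fun s'' hf' hinv' => ?_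
    refine Run.setNat ?_
    have e : (NatExpr.add (.reg i) (.const 1)).val s'' = k + 1 := by
      simp [NatExpr.val, hf'.nat i hi, hik]
    rw [e]
    refine ⟨hinv', hf.trans ⟨fun b hb => ?_, fun b hb => ?_⟩, by simp [NatExpr.val], hk⟩
    · simp only [Program.forN, natFree, Bool.and_eq_true, bne_iff_ne] at hb
      rw [Memory.setNat_nat_ne _ _ _ hb.1, hf'.nat b hb.2.1]
    · simp only [Program.forN, cpxFree, Bool.and_eq_true] at hb
      rw [Memory.setNat_cpx, hf'.cpx b hb.2.1]
  have hN0 : ∀ s' k, (Program.forN i a j B).Frame s s' → s'.nat i 0 = k →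
      ((Test.natLt (.reg i) (.cell a (.const j))).Holds s' ↔ k < N) := by
    intro s' k hf hk
    simp [Test.Holds, NatExpr.val, hk, hfr s' hf]
  have key : Run (Program.forN i a j B) s (30 + (30 + N * (T + 90))) Q := by
    refine Run.setNat_seq ?_
    simp only [NatExpr.val]
    obtain ⟨s1, hs1, hi1, hf1⟩ : ∃ s1, s1 = s.setNat i 0 0 ∧ s1.nat i 0 = 0 ∧
        (Program.forN i a j B).Frame s s1 := ⟨_, rfl, by simp, hf0⟩
    rw [← hs1] at h0 ⊢
    have hgen : ∀ r k s', k + r = N → Inv k s' ∧ (Program.forN i a j B).Frame s s' ∧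
        s'.nat i 0 = k ∧ k ≤ N →
        Run (.loop (.natLt (.reg i) (.cell a (.const j)))
          (.seq B (.setNat i (.const 0) (.add (.reg i) (.const 1))))) s' (30 + r * (T + 90)) Q := by
      intro r
      induction r with
      | zero =>
        rintro k s' hk ⟨hinv, hf, hik, hle⟩
        obtain rfl : k = N := hk
        refine ⟨s', _, .loop_false ?_, ?_, hQ s' hf hinv⟩
        · rw [hN0 s' _ hf hik]; simp
        · simp [Test.cost, NatExpr.cost, NatExpr.reg]
      | succ r ih =>
        rintro k s' hk h
        obtain ⟨s2, t, hr, ht, hq⟩ := hstep k s' h (by omega)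
        obtain ⟨s3, t', hr', ht', hq'⟩ := ih (k + 1) s2 (by omega) hq
        refine ⟨s3, _, .loop_true ((hN0 s' _ h.2.1 h.2.2.1).2 (by omega)) hr hr', ?_, hq'⟩
        have : (Test.natLt (.reg i) (.cell a (.const j))).cost = 5 := rfl
        rw [this, add_mul r 1]
        omega
    exact hgen N 0 s1 (by omega) ⟨h0, hf1, hi1, by omega⟩
  refine key.mono_time ?_
  have h1 : N * T ≤ M * T := Nat.mul_le_mul_right _ hM
  have h2 : N ≤ M * T := hM.trans (Nat.le_mul_of_pos_right _ hT1)
  have h3 : 1 ≤ M * T := Nat.mul_pos hM1 hT1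
  rw [mul_add]
  omega

/-! ### Relocation of arrays -/

def NatExpr.shift (r : ℕ) : NatExpr → NatExpr
  | const c => .const c
  | cell a i => .cell (r + a) (i.shift r)
  | add e f => .add (e.shift r) (f.shift r)
  | sub e f => .sub (e.shift r) (f.shift r)

def CpxExpr.shift (r : ℕ) : CpxExpr → CpxExpr
  | const z => .const z
  | cell a i => .cell (r + a) (i.shift r)
  | add e f => .add (e.shift r) (f.shift r)
  | sub e f => .sub (e.shift r) (f.shift r)
  | mul e f => .mul (e.shift r) (f.shift r)
  | div e f => .div (e.shift r) (f.shift r)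

def Test.shift (r : ℕ) : Test → Test
  | natLt e f => .natLt (e.shift r) (f.shift r)
  | natEq e f => .natEq (e.shift r) (f.shift r)
  | cpxEq e f => .cpxEq (e.shift r) (f.shift r)

/-- The program that uses the arrays `r + a` in place of the arrays `a`. -/
def Program.shift (r : ℕ) : Program → Program
  | skip => .skip
  | setNat a i e => .setNat (r + a) (i.shift r) (e.shift r)
  | setCpx a i e => .setCpx (r + a) (i.shift r) (e.shift r)
  | seq P Q => .seq (P.shift r) (Q.shift r)
  | branch b P Q => .branch (b.shift r) (P.shift r) (Q.shift r)
  | loop b P => .loop (b.shift r) (P.shift r)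

/-- The arrays from number `r` on. -/
def Memory.drop (r : ℕ) (s : Memory) : Memory := ⟨fun a => s.nat (r + a), fun a => s.cpx (r + a)⟩

section shift

variable (r : ℕ) (s : Memory)

@[simp] theorem NatExpr.val_shift (e : NatExpr) : (e.shift r).val s = e.val (s.drop r) := by
  induction e <;> simp_all [NatExpr.shift, NatExpr.val, Memory.drop]

@[simp] theorem NatExpr.cost_shift (e : NatExpr) : (e.shift r).cost = e.cost := by
  induction e <;> simp_all [NatExpr.shift, NatExpr.cost]

@[simp] theorem CpxExpr.val_shift (e : CpxExpr) : (e.shift r).val s = e.val (s.drop r) := by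
  induction e <;> simp_all [CpxExpr.shift, CpxExpr.val]
  rfl

@[simp] theorem CpxExpr.cost_shift (e : CpxExpr) : (e.shift r).cost = e.cost := by
  induction e <;> simp_all [CpxExpr.shift, CpxExpr.cost]

@[simp] theorem Test.holds_shift (b : Test) : (b.shift r).Holds s ↔ b.Holds (s.drop r) := by
  cases b <;> simp [Test.shift, Test.Holds]

@[simp] theorem Test.cost_shift (b : Test) : (b.shift r).cost = b.cost := by
  cases b <;> simp [Test.shift, Test.cost]

theorem Memory.drop_setNat (a i x : ℕ) :
    (s.setNat (r + a) i x).drop r = (s.drop r).setNat a i x := by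
  simp only [Memory.drop, Memory.setNat, Memory.mk.injEq, and_true]
  funext b
  by_cases h : b = a
  · subst h; simp
  · simp [h]

theorem Memory.drop_setCpx (a i : ℕ) (z : ℂ) :
    (s.setCpx (r + a) i z).drop r = (s.drop r).setCpx a i z := by
  simp only [Memory.drop, Memory.setCpx, Memory.mk.injEq, true_and]
  funext b
  by_cases h : b = a
  · subst h; simp
  · simp [h]

end shift

/-- The relocated program sees nothing but the arrays from `r` on, and there it imitates the
original step by step at equal cost. An unknown program can thus be called without danger to the
lower arrays. -/
theorem Runs.shift {r : ℕ} {P : Program} {u u' : Memory} {t : ℕ} (h : Runs P u u' t) :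
    ∀ s : Memory, s.drop r = u → ∃ s', Runs (P.shift r) s s' t ∧ s'.drop r = u' := by
  induction h with
  | skip u => exact fun s hs => ⟨s, .skip s, hs⟩
  | setNat a i e u =>
    rintro s rfl
    have := Runs.setNat (r + a) (i.shift r) (e.shift r) s
    simp only [NatExpr.val_shift, NatExpr.cost_shift] at this
    exact ⟨_, this, by rw [Memory.drop_setNat]⟩
  | setCpx a i e u =>
    rintro s rfl
    have := Runs.setCpx (r + a) (i.shift r) (e.shift r) s
    simp only [NatExpr.val_shift, NatExpr.cost_shift, CpxExpr.val_shift, CpxExpr.cost_shift] at this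
    exact ⟨_, this, by rw [Memory.drop_setCpx]⟩
  | seq _ _ h1 h2 =>
    intro s hs
    obtain ⟨s1, hr1, hs1⟩ := h1 s hs
    obtain ⟨s2, hr2, hs2⟩ := h2 s1 hs1
    exact ⟨s2, .seq hr1 hr2, hs2⟩
  | @branch_true b P Q _ _ t hb _ h =>
    rintro s rfl
    obtain ⟨s1, hr1, hs1⟩ := h s rfl
    have := Runs.branch_true (Q := Q.shift r) ((Test.holds_shift r s b).2 hb) hr1
    rw [Test.cost_shift] at this
    exact ⟨s1, this, hs1⟩
  | @branch_false b P Q _ _ t hb _ h =>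
    rintro s rfl
    obtain ⟨s1, hr1, hs1⟩ := h s rfl
    have := Runs.branch_false (P := P.shift r) (fun h' => hb ((Test.holds_shift r s b).1 h')) hr1
    rw [Test.cost_shift] at this
    exact ⟨s1, this, hs1⟩
  | @loop_true b P _ _ _ t t' hb _ _ h1 h2 =>
    rintro s rfl
    obtain ⟨s1, hr1, hs1⟩ := h1 s rfl
    obtain ⟨s2, hr2, hs2⟩ := h2 s1 hs1
    have := Runs.loop_true ((Test.holds_shift r s b).2 hb) hr1 hr2
    rw [Test.cost_shift] at this
    exact ⟨s2, this, hs2⟩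
  | @loop_false b P _ hb =>
    rintro s rfl
    have := Runs.loop_false (P := P.shift r) (fun h' => hb ((Test.holds_shift r s b).1 h'))
    rw [Test.cost_shift] at this
    exact ⟨s, this, rfl⟩

theorem Program.natFree_shift {a r : ℕ} (h : a < r) (P : Program) :
    (P.shift r).natFree a = true := by
  induction P <;> simp_all [Program.shift, natFree]
  omega

theorem Program.cpxFree_shift {a r : ℕ} (h : a < r) (P : Program) :
    (P.shift r).cpxFree a = true := by
  induction P <;> simp_all [Program.shift, cpxFree]
  omega

/-! ### The exponent of matrix multiplication is at least two -/

/-- A cell changes only through an assignment, which costs at least one unit, so the running time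
bounds the number of changed cells. -/
theorem Runs.exists_finset_cpx {P : Program} {s s' : Memory} {t : ℕ} (h : Runs P s s' t) (a : ℕ) :
    ∃ F : Finset ℕ, F.card ≤ t ∧ ∀ i ∉ F, s'.cpx a i = s.cpx a i := by
  induction h with
  | skip s => exact ⟨∅, by simp, by simp⟩
  | setNat b i e s => exact ⟨∅, by simp, by simp⟩
  | setCpx b i e s =>
    refine ⟨{i.val s}, by simp, fun j hj => ?_⟩
    rw [Memory.setCpx_cpx_apply, if_neg]
    simp at hj
    tauto
  | seq _ _ h1 h2 =>
    obtain ⟨F, hF, h⟩ := h1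
    obtain ⟨G, hG, h'⟩ := h2
    refine ⟨F ∪ G, (Finset.card_union_le _ _).trans (by omega), fun i hi => ?_⟩
    simp only [Finset.mem_union, not_or] at hi
    rw [h' i hi.2, h i hi.1]
  | branch_true _ _ h => obtain ⟨F, hF, h⟩ := h; exact ⟨F, by omega, h⟩
  | branch_false _ _ h => obtain ⟨F, hF, h⟩ := h; exact ⟨F, by omega, h⟩
  | loop_true _ _ _ h1 h2 =>
    obtain ⟨F, hF, h⟩ := h1
    obtain ⟨G, hG, h'⟩ := h2
    refine ⟨F ∪ G, (Finset.card_union_le _ _).trans (by omega), fun i hi => ?_⟩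
    simp only [Finset.mem_union, not_or] at hi
    rw [h' i hi.2, h i hi.1]
  | loop_false _ => exact ⟨∅, by simp, by simp⟩

/-- Multiply two zero matrices while the output array is filled with 1: all `k ^ 2` output cells
must change, whence `k ^ (2 - ω) ≤ C` for all `k ≥ 1`, which is absurd for `ω < 2`. This permits
charging quadratic work on matrices to a multiplication. -/
theorem MatMulInTime.two_le {ω : ℝ} (h : MatMulInTime ω) : 2 ≤ ω := by
  obtain ⟨P, C, h⟩ := h
  have key : ∀ k : ℕ, 1 ≤ k → (k : ℝ) ^ (2 - ω) ≤ C := by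
    intro k hk
    obtain ⟨s', t, hr, ht, hP⟩ := h k hk 0 0
      ⟨fun _ _ => k, fun a _ => if a = 2 then 1 else 0⟩ rfl (by simp) (by simp)
    obtain ⟨F, hF, hF'⟩ := hr.exists_finset_cpx 2
    have hk2 : k * k ≤ t := by
      refine le_trans ?_ hF
      rw [← Finset.card_range (k * k)]
      refine Finset.card_le_card fun i hi => ?_
      by_contra hiF
      have h1 := hF' i hiF
      have hi := Finset.mem_range.1 hi
      have h2 := hP ⟨i / k, Nat.div_lt_of_lt_mul hi⟩ ⟨i % k, Nat.mod_lt _ hk⟩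
      simp only [Nat.div_add_mod', h1] at h2
      simp at h2
    have hk0 : (0 : ℝ) < k := by exact_mod_cast hk
    rw [Real.rpow_sub hk0, div_le_iff₀ (Real.rpow_pos_of_pos hk0 _)]
    refine le_trans ?_ ht
    rw [show (2 : ℝ) = (2 : ℕ) by norm_num, Real.rpow_natCast]
    exact_mod_cast (by rw [sq]; exact hk2)
  by_contra hω
  have h1 : Filter.Tendsto (fun k : ℕ => (k : ℝ) ^ (2 - ω)) Filter.atTop Filter.atTop :=
    (tendsto_rpow_atTop (by linarith)).comp tendsto_natCast_atTop_atTop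
  obtain ⟨k, hk, hk1⟩ := ((h1.eventually_gt_atTop C).and (Filter.eventually_ge_atTop 1)).exists
  exact absurd (key k hk1) (not_le.2 hk)

/-! ### Mixed radix numbers -/

open Classical in
/-- The place values of the positions `v`, where the positions in `B` have base `w` and the other
positions are empty. -/
noncomputable def placeValue (B : ℕ → Prop) (w : ℕ) : ℕ → ℕ
  | 0 => 1
  | v + 1 => if B v then placeValue B w v * w else placeValue B w v

/-- The digit of `i` at position `v`, for place values `P`. -/
def digit (P : ℕ → ℕ) (v i : ℕ) : ℕ := i % P (v + 1) / P v

/-- Sequences of place values. -/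
structure PlaceValues (P : ℕ → ℕ) : Prop where
  zero : P 0 = 1
  pos : ∀ v, 0 < P v
  dvd : ∀ v, P v ∣ P (v + 1)

theorem placeValues_placeValue (B : ℕ → Prop) {w : ℕ} (hw : 0 < w) :
    PlaceValues (placeValue B w) where
  zero := rfl
  pos v := by
    induction v with
    | zero => simp [placeValue]
    | succ v ih => rw [placeValue]; split_ifs <;> positivity
  dvd v := by rw [placeValue]; split_ifs <;> simp

theorem placeValue_eq_pow (B : ℕ → Prop) [DecidablePred B] (w n : ℕ) :
    placeValue B w n = w ^ ((Finset.range n).filter B).card := by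
  induction n with
  | zero => simp [placeValue]
  | succ n ih =>
    rw [placeValue, Finset.range_add_one, Finset.filter_insert]
    split_ifs
    · rw [Finset.card_insert_of_notMem (by simp), pow_succ, ih]
    · rw [ih]

namespace PlaceValues

variable {P : ℕ → ℕ} (hP : PlaceValues P)
include hP

theorem dvd_of_le {u v : ℕ} (h : u ≤ v) : P u ∣ P v := by
  induction v, h using Nat.le_induction with
  | base => exact dvd_rfl
  | succ v _ ih => exact ih.trans (hP.dvd v)

theorem le_of_le {u v : ℕ} (h : u ≤ v) : P u ≤ P v := Nat.le_of_dvd (hP.pos v) (hP.dvd_of_le h)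

theorem digit_lt (v i : ℕ) : digit P v i < P (v + 1) / P v := by
  rw [digit, Nat.div_lt_iff_lt_mul (hP.pos v), Nat.div_mul_cancel (hP.dvd v)]
  exact Nat.mod_lt _ (hP.pos _)

theorem sum_digit (n i : ℕ) : ∑ v ∈ Finset.range n, digit P v i * P v = i % P n := by
  induction n with
  | zero => simp [hP.zero, Nat.mod_one]
  | succ n ih =>
    rw [Finset.sum_range_succ, ih, ← Nat.mod_mod_of_dvd i (hP.dvd n), digit, add_comm]
    exact Nat.div_add_mod' _ _

theorem sum_lt {σ : ℕ → ℕ} {n : ℕ} (h : ∀ v < n, σ v < P (v + 1) / P v) :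
    ∑ v ∈ Finset.range n, σ v * P v < P n := by
  induction n with
  | zero => simp [hP.zero]
  | succ n ih =>
    rw [Finset.sum_range_succ]
    have h1 := ih fun v hv => h v (by omega)
    have h2 : (σ n + 1) * P n ≤ P (n + 1) / P n * P n := Nat.mul_le_mul_right _ (h n (by omega))
    rw [Nat.div_mul_cancel (hP.dvd n), add_mul] at h2
    omega

theorem digit_sum {σ : ℕ → ℕ} {n : ℕ} (h : ∀ v < n, σ v < P (v + 1) / P v) {v : ℕ} (hv : v < n) :
    digit P v (∑ u ∈ Finset.range n, σ u * P u) = σ v := by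
  -- The terms from `k` on are multiples of `P k`, and the others add up to less than `P k`, so
  -- reduction modulo `P k` truncates the sum.
  have key : ∀ k, k ≤ n → (∑ u ∈ Finset.range n, σ u * P u) % P k
      = ∑ u ∈ Finset.range k, σ u * P u := by
    intro k hk
    obtain ⟨r, rfl⟩ := Nat.exists_eq_add_of_le hk
    obtain ⟨c, hc⟩ : P k ∣ ∑ x ∈ Finset.range r, σ (k + x) * P (k + x) :=
      Finset.dvd_sum fun i _ => Dvd.dvd.mul_left (hP.dvd_of_le (by omega)) _
    rw [Finset.sum_range_add, hc, Nat.add_mul_mod_self_left,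
      Nat.mod_eq_of_lt (hP.sum_lt fun v hv => h v (by omega))]
  rw [digit, key (v + 1) hv, Finset.sum_range_succ, add_comm, mul_comm,
    Nat.mul_add_div (hP.pos v), Nat.div_eq_of_lt (hP.sum_lt fun u hu => h u (by omega)), add_zero]

/-- Deleting the positions outside of `B` leaves a valid mixed radix number with zeros there, and
such representations are unique. Comparing two numbers then decides whether two states agree on `B`.
-/
theorem sum_digit_eq {n i j : ℕ} {B : ℕ → Prop} [DecidablePred B] :
    (∑ v ∈ Finset.range n, digit P v i * (if B v then P v else 0) =
      ∑ v ∈ Finset.range n, digit P v j * (if B v then P v else 0)) ↔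
    ∀ v < n, B v → digit P v i = digit P v j := by
  constructor
  · intro h v hv hB
    have hlt : ∀ i, ∀ v < n, (if B v then digit P v i else 0) < P (v + 1) / P v := by
      intro i v _
      split_ifs
      · exact hP.digit_lt v i
      · exact Nat.div_pos (hP.le_of_le (Nat.le_succ v)) (hP.pos v)
    have h1 := hP.digit_sum (hlt i) hv
    have h2 := hP.digit_sum (hlt j) hv
    simp only [hB, if_true] at h1 h2
    rw [← h1, ← h2]
    congr 1
    simpa [mul_ite, ite_mul] using h
  · intro h
    refine Finset.sum_congr rfl fun v hv => ?_
    split_ifs with hB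
    · rw [h v (Finset.mem_range.1 hv) hB]
    · simp

/-- Together with the two lemmas that follow, this is the recursion for tables of digits: below `P
(v + 1)`, a step by `P v` keeps the lower digits and raises digit `v` by one. No division is needed
to fill a table. -/
theorem digit_add {u v j : ℕ} (h : u < v) : digit P u (P v + j) = digit P u j := by
  obtain ⟨c, hc⟩ := hP.dvd_of_le (show u + 1 ≤ v from h)
  rw [digit, digit, hc, Nat.mul_add_mod]

theorem digit_add_self {v j : ℕ} (h : P v + j < P (v + 1)) :
    digit P v (P v + j) = digit P v j + 1 := by
  rw [digit, digit, Nat.mod_eq_of_lt h, Nat.mod_eq_of_lt (by omega),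
    Nat.add_div_left _ (hP.pos v)]

theorem digit_of_lt {v i : ℕ} (h : i < P v) : digit P v i = 0 := by
  rw [digit, Nat.mod_eq_of_lt (h.trans_le (hP.le_of_le (Nat.le_succ v))), Nat.div_eq_of_lt h]

end PlaceValues

theorem digit_placeValue_lt {B : ℕ → Prop} {w : ℕ} (hw : 0 < w) (v i : ℕ) :
    digit (placeValue B w) v i < w := by
  have h := (placeValues_placeValue B hw).digit_lt v i
  have hpos := (placeValues_placeValue B hw).pos v
  rw [placeValue] at h
  split_ifs at h
  · rwa [Nat.mul_div_cancel_left _ hpos] at h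
  · rw [Nat.div_self hpos] at h
    omega

theorem digit_placeValue_of_not {B : ℕ → Prop} {w v : ℕ} (hw : 0 < w) (hv : ¬ B v) (i : ℕ) :
    digit (placeValue B w) v i = 0 := by
  have h := (placeValues_placeValue B hw).digit_lt v i
  have hpos := (placeValues_placeValue B hw).pos v
  rw [placeValue, if_neg hv, Nat.div_self hpos] at h
  omega

/-! ### Basic programs -/

/-- Writes the multiples `0, x, 2 x, …` of the number `x` in cell `stJ` of array `stA` to the array
`out`; their number is in cell `lenJ` of array `lenA`.  The next multiple is left in the
register `p`. -/
def mulTable (out p lenA lenJ stA stJ : ℕ) : Program :=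
  .seq (.setNat p (.const 0) (.const 0))
    (.forN 20 lenA lenJ
      (.seq (.setNat out (.reg 20) (.reg p))
        (.setNat p (.const 0) (.add (.reg p) (.cell stA (.const stJ))))))

theorem mulTable_run {out p lenA lenJ stA stJ : ℕ} {s : Memory} {M : ℕ} (hM : s.nat lenA lenJ ≤ M)
    (hM1 : 1 ≤ M) (h : [20, lenA, stA, p].all (fun a => a != out) = true := by rfl)
    (h' : [20, lenA, stA].all (fun a => a != p) = true := by rfl)
    (h'' : [lenA, stA].all (fun a => a != 20) = true := by rfl) :
    Run (mulTable out p lenA lenJ stA stJ) s (13000 * M) fun s' =>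
      (∀ i < s.nat lenA lenJ, s'.nat out i = i * s.nat stA stJ) ∧
      s'.nat p 0 = s.nat lenA lenJ * s.nat stA stJ := by
  simp only [List.all_cons, List.all_nil, Bool.and_true, Bool.and_eq_true, bne_iff_ne] at h h' h''
  obtain ⟨h1, h2, h3, h4⟩ := h
  obtain ⟨h5, h6, h7⟩ := h'
  obtain ⟨h8, h9⟩ := h''
  set s0 := s.setNat p 0 0 with hs0
  have e0 : s0.nat lenA = s.nat lenA := Memory.setNat_nat_ne _ _ _ h6
  have e1 : s0.nat stA = s.nat stA := Memory.setNat_nat_ne _ _ _ h7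
  have key : Run (mulTable out p lenA lenJ stA stJ) s (30 + 200 * (M * (30 + 30))) fun s' =>
      (∀ i < s.nat lenA lenJ, s'.nat out i = i * s.nat stA stJ) ∧
      s'.nat p 0 = s.nat lenA lenJ * s.nat stA stJ := by
    refine Run.setNat_seq ?_
    refine Run.forN (fun k s' => (∀ i < k, s'.nat out i = i * s.nat stA stJ) ∧
      s'.nat p 0 = k * s.nat stA stJ) (s := s0) (by rw [e0]; exact hM) hM1 (by norm_num) ?_ ?_ ?_
      ?_ ?_
    · refine ⟨by simp, ?_⟩
      rw [Memory.setNat_nat_ne _ _ _ h5.symm, hs0]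
      simp
    · rintro k hk s' hf hk' ⟨hi1, hi2⟩
      have e2 : s'.nat stA = s.nat stA := by
        rw [hf.nat stA, e1]
        simp [Program.forN, natFree, h3, h7, h9]
      refine Run.setNat_seq ?_
      refine Run.setNat ?_
      refine ⟨fun i hi => ?_, ?_⟩
      · simp only [Memory.setNat_nat_apply, NatExpr.val, NatExpr.val_reg, hk', hi2, h4,
          Ne.symm h1, Ne.symm h4]
        by_cases hik : i = k
        · subst hik; simp
        · simp [hik, hi1 i (by omega)]
      · simp [Memory.setNat_nat_apply, NatExpr.val, hk', hi2, h4, Ne.symm h5, h3, e2]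
        ring
    · rintro s' hf ⟨hi1, hi2⟩
      rw [e0] at hi1 hi2
      exact ⟨hi1, hi2⟩
    · simp [natFree, h1, h5]
    · simp [Program.forN, natFree, h2, h6, h8]
  exact key.mono_time (by omega)

/-- Fills the first cells of the natural array `a` with the constant `c`. -/
def fillNat (a lenA lenJ c : ℕ) : Program :=
  .forN 20 lenA lenJ (.setNat a (.reg 20) (.const c))

theorem fillNat_run {a lenA lenJ c : ℕ} {s : Memory} {M : ℕ} (hM : s.nat lenA lenJ ≤ M)
    (hM1 : 1 ≤ M) (h : [20, lenA].all (fun b => b != a) = true := by rfl)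
    (h' : lenA ≠ 20 := by decide) :
    Run (fillNat a lenA lenJ c) s (6000 * M) fun s' => ∀ i < s.nat lenA lenJ, s'.nat a i = c := by
  simp only [List.all_cons, List.all_nil, Bool.and_true, Bool.and_eq_true, bne_iff_ne] at h
  obtain ⟨h1, h2⟩ := h
  have key : Run (fillNat a lenA lenJ c) s (200 * (M * 30)) fun s' =>
      ∀ i < s.nat lenA lenJ, s'.nat a i = c := by
    refine Run.forN (fun k s' => ∀ i < k, s'.nat a i = c) hM hM1 (by norm_num) (by simp) ?_
      (fun _ _ h => h) ?_ ?_
    · intro k hk s' hf hk' hi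
      refine Run.setNat fun i hik => ?_
      simp only [Memory.setNat_nat_apply, NatExpr.val, NatExpr.val_reg, hk', Ne.symm h1]
      by_cases hik' : i = k
      · simp [hik']
      · simp [hik', hi i (by omega)]
    · simp [natFree, h1]
    · simp [Program.forN, natFree, h2, h']
  exact key.mono_time (by omega)

/-- Writes the place values of the positions `v` with flag `1` in cell `fb + v` of array `5`
to the array `out`. -/
def placeTable (out fb : ℕ) : Program :=
  .seq (.setNat out (.const 0) (.const 1))
    (.forN 21 0 0
      (.seq (.setNat 22 (.const 0) (.const 0))
        (.seq
          (.branch (.natEq (.cell 5 (.add (.reg fb) (.reg 21))) (.const 1))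
            (.forN 20 0 5
              (.setNat 22 (.const 0) (.add (.reg 22) (.cell out (.reg 21)))))
            (.setNat 22 (.const 0) (.cell out (.reg 21))))
          (.setNat out (.add (.reg 21) (.const 1)) (.reg 22)))))

theorem placeTable_run {out fb : ℕ} {s : Memory} {R K : ℕ} (hR : s.nat 0 0 ≤ R) (hR1 : 1 ≤ R)
    (hK : s.nat 0 5 ≤ K) (hK1 : 1 ≤ K)
    (h : [0, 5, 20, 21, 22, fb].all (fun a => a != out) = true := by rfl)
    (h' : [0, 5, 20, 21, 22].all (fun a => a != fb) = true := by rfl) :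
    Run (placeTable out fb) s (2000000 * (R * K)) fun s' => ∀ v ≤ s.nat 0 0,
      s'.nat out v = placeValue (fun v => s.nat 5 (s.nat fb 0 + v) = 1) (s.nat 0 5) v := by
  simp only [List.all_cons, List.all_nil, Bool.and_true, Bool.and_eq_true, bne_iff_ne] at h h'
  obtain ⟨h0, h5, h20, h21, h22, hfb⟩ := h
  obtain ⟨g0, g5, g20, g21, g22⟩ := h'
  set B : ℕ → Prop := fun v => s.nat 5 (s.nat fb 0 + v) = 1 with hB
  set w := s.nat 0 5 with hw
  have key : Run (placeTable out fb) s
      (30 + 200 * (R * (30 + ((30 + 200 * (K * 30)) + 30)))) fun s' => ∀ v ≤ s.nat 0 0,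
      s'.nat out v = placeValue B w v := by
    refine Run.setNat_seq ?_
    simp only [NatExpr.val]
    obtain ⟨s0, hs0⟩ : ∃ s0, s0 = s.setNat out 0 1 := ⟨_, rfl⟩
    rw [← hs0]
    have e0 : ∀ a, a ≠ out → s0.nat a = s.nat a := fun a ha => by
      rw [hs0]; exact Memory.setNat_nat_ne _ _ _ ha
    refine Run.forN (fun k s' => ∀ v ≤ k, s'.nat out v = placeValue B w v)
      (s := s0) (by rw [e0 _ h0]; exact hR) hR1 (by omega) ?_ ?_ ?_ ?_ ?_
    · intro v hv
      obtain rfl : v = 0 := by omega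
      rw [Memory.setNat_nat_ne _ _ _ h21.symm, hs0]
      simp [placeValue]
    · rintro k hk s' hf hk' hi
      have e2 : ∀ a, a ≠ out → a ≠ 20 → a ≠ 21 → a ≠ 22 → s'.nat a = s.nat a :=
        fun a ha h1 h2 h3 => by
          rw [hf.nat a, e0 a ha]
          simp [Program.forN, natFree, ha, h1, h2, h3]
      refine Run.setNat_seq ?_
      simp only [NatExpr.val]
      obtain ⟨s1, hs1⟩ : ∃ s1, s1 = s'.setNat 22 0 0 := ⟨_, rfl⟩
      rw [← hs1]
      have f1 : ∀ a, a ≠ 22 → s1.nat a = s'.nat a := fun a ha => by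
        rw [hs1]; exact Memory.setNat_nat_ne _ _ _ ha
      have e3 : s1.nat fb = s.nat fb := by
        rw [f1 _ g22.symm, e2 _ hfb g20.symm g21.symm g22.symm]
      have e4 : s1.nat 5 = s.nat 5 := by
        rw [f1 _ (by decide), e2 _ h5 (by decide) (by decide) (by decide)]
      have e5 : s1.nat 0 = s.nat 0 := by
        rw [f1 _ (by decide), e2 _ h0 (by decide) (by decide) (by decide)]
      have e6 : s1.nat 21 0 = k := by rw [f1 _ (by decide), hk']
      have e7 : s1.nat out = s'.nat out := f1 _ h22.symm
      refine Run.seq (R := fun s2 => s2.nat 22 0 = placeValue B w (k + 1)) ?_ ?_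
      · refine Run.branch ?_ ?_
        · intro hb
          have hb : B k := by simpa [Test.Holds, NatExpr.val, e3, e4, e6, hB] using hb
          -- Multiplication by `w` is carried out as `w` additions, within the bound `K`.
          refine Run.forN (fun j s2 => s2.nat 22 0 = j * placeValue B w k) (by rw [e5]; exact hK)
            hK1 (by norm_num) ?_ ?_ ?_ ?_ ?_
          · simp [hs1, Memory.setNat_nat_apply]
          · intro j hj s2 hf2 hj2 hi2
            refine Run.setNat ?_
            have e8 : s2.nat out = s'.nat out := by
              rw [hf2.nat _, e7]
              simp [Program.forN, natFree, h22.symm, h20.symm]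
            have e9 : s2.nat 21 0 = k := by rw [hf2.nat 21 rfl, e6]
            simp [Memory.setNat_nat_apply, NatExpr.val, e8, e9, hi2, hi k le_rfl]
            ring
          · intro s2 _ hi2
            rw [hi2, e5, placeValue, if_pos hb, mul_comm]
          · rfl
          · rfl
        · intro hb
          have hb : ¬ B k := by simpa [Test.Holds, NatExpr.val, e3, e4, e6, hB] using hb
          refine Run.mono_time (T := 30) (Run.setNat ?_) (by omega)
          simp [NatExpr.val, e7, e6, placeValue, hb, hi k le_rfl]
      · intro s2 hf2 hs2
        refine Run.setNat ?_
        intro v hv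
        have e8 : s2.nat out = s'.nat out := by
          rw [hf2.nat _, e7]
          simp [Program.forN, natFree, h22.symm, h20.symm]
        have e9 : s2.nat 21 0 = k := by rw [hf2.nat 21 rfl, e6]
        simp only [Memory.setNat_nat_apply, NatExpr.val, NatExpr.val_reg, e9, h21.symm, hs2]
        by_cases hvk : v = k + 1
        · subst hvk; simp
        · simp [hvk, e8, hi v (by omega)]
    · intro s' _ hi
      rw [e0 _ h0] at hi
      exact hi
    · simp [Program.forN, natFree, h21]
    · simp [Program.forN, natFree, h0]
  refine key.mono_time ?_
  have := Nat.mul_pos hR1 hK1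
  nlinarith

/-- Writes the weighted digit sums `∑ v, digit v i * wt v` of all `i`, for the place values in
array `pv` and the weights in array `wt`, to the array `out`, from the cell in register `ob` on. -/
def weightTable (pv wt out ob : ℕ) : Program :=
  .seq (.setNat out (.reg ob) (.const 0))
    (.forN 21 0 0
      (.seq
        (.setNat 22 (.const 0)
          (.sub (.cell pv (.add (.reg 21) (.const 1))) (.cell pv (.reg 21))))
        (.forN 20 22 0
          (.setNat out (.add (.add (.reg ob) (.cell pv (.reg 21))) (.reg 20))
            (.add (.cell out (.add (.reg ob) (.reg 20))) (.cell wt (.reg 21)))))))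

/-- After the positions below `k` the entries with index below `P k` are final. The entries from `P
k` up to `P (k + 1)` arise from those `P k` places earlier by adding the weight of `k`, one addition
per entry. At an empty position the two place values coincide and nothing is written. -/
theorem weightTable_run {pv wt out ob : ℕ} {s : Memory} {R K : ℕ} {P : ℕ → ℕ} (hP : PlaceValues P)
    (hPs : ∀ v ≤ s.nat 0 0, s.nat pv v = P v)
    (hR : s.nat 0 0 ≤ R) (hR1 : 1 ≤ R) (hK : P (s.nat 0 0) ≤ K)
    (h : [0, 20, 21, 22, pv, wt, ob].all (fun a => a != out) = true := by rfl)
    (h' : [pv, wt, ob].all (fun a => a != 20 && a != 21 && a != 22) = true := by rfl) :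
    Run (weightTable pv wt out ob) s (2000000 * (R * K)) fun s' =>
      (∀ i < P (s.nat 0 0), s'.nat out (s.nat ob 0 + i) =
        ∑ v ∈ Finset.range (s.nat 0 0), digit P v i * s.nat wt v) ∧
      ∀ i < s.nat ob 0, s'.nat out i = s.nat out i := by
  simp only [List.all_cons, List.all_nil, Bool.and_true, Bool.and_eq_true, bne_iff_ne] at h h'
  obtain ⟨h0, h20, h21, h22, hpv, hwt, hob⟩ := h
  obtain ⟨⟨⟨g0, g1⟩, g2⟩, ⟨⟨g3, g4⟩, g5⟩, ⟨g6, g7⟩, g8⟩ := h'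
  have hK1 : 1 ≤ K := (hP.pos _).trans_le hK
  set n := s.nat 0 0 with hn
  set o := s.nat ob 0 with ho
  have key : Run (weightTable pv wt out ob) s
      (30 + 200 * (R * (30 + 200 * (K * 30)))) fun s' => (∀ i < P n, s'.nat out (o + i) =
        ∑ v ∈ Finset.range n, digit P v i * s.nat wt v) ∧ ∀ i < o, s'.nat out i = s.nat out i := by
    refine Run.setNat_seq ?_
    simp only [NatExpr.val, NatExpr.val_reg]
    obtain ⟨s0, hs0⟩ : ∃ s0, s0 = s.setNat out o 0 := ⟨_, rfl⟩
    rw [← hs0]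
    have e0 : ∀ a, a ≠ out → s0.nat a = s.nat a := fun a ha => by
      rw [hs0]; exact Memory.setNat_nat_ne _ _ _ ha
    refine Run.forN (fun k s' => (∀ i < P k, s'.nat out (o + i) =
        ∑ v ∈ Finset.range k, digit P v i * s.nat wt v) ∧ ∀ i < o, s'.nat out i = s.nat out i)
      (s := s0) (by rw [e0 _ h0]; exact hR) hR1 (by omega) ?_ ?_ ?_ ?_ ?_
    · refine ⟨fun i hi => ?_, fun i hi => ?_⟩
      · rw [hP.zero] at hi
        obtain rfl : i = 0 := by omega
        rw [Memory.setNat_nat_ne _ _ _ h21.symm, hs0]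
        simp
      · rw [Memory.setNat_nat_ne _ _ _ h21.symm, hs0, Memory.setNat_nat_apply,
          if_neg (by omega)]
    · rintro k hk s' hf hk' ⟨hi, hi'⟩
      have hkn : k < n := by rw [e0 _ h0] at hk; exact hk
      have e2 : ∀ a, a ≠ out → a ≠ 20 → a ≠ 21 → a ≠ 22 → s'.nat a = s.nat a :=
        fun a ha h1 h2 h3 => by
          rw [hf.nat a, e0 a ha]
          simp [Program.forN, natFree, ha, h1, h2, h3]
      refine Run.setNat_seq ?_
      simp only [NatExpr.val, NatExpr.val_reg, e2 _ hpv g0 g1 g2, hk', hPs k hkn.le,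
        hPs (k + 1) hkn]
      obtain ⟨s1, hs1⟩ : ∃ s1, s1 = s'.setNat 22 0 (P (k + 1) - P k) := ⟨_, rfl⟩
      rw [← hs1]
      have f1 : ∀ a, a ≠ out → a ≠ 20 → a ≠ 21 → a ≠ 22 → s1.nat a = s.nat a :=
        fun a ha h1 h2 h3 => by rw [hs1, Memory.setNat_nat_ne _ _ _ h3, e2 a ha h1 h2 h3]
      have e6 : s1.nat 21 0 = k := by rw [hs1, Memory.setNat_nat_ne _ _ _ (by decide), hk']
      have e7 : s1.nat out = s'.nat out := by rw [hs1, Memory.setNat_nat_ne _ _ _ h22.symm]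
      have e8 : s1.nat 22 0 = P (k + 1) - P k := by rw [hs1]; simp
      have hPk := hP.le_of_le (Nat.le_succ k)
      refine Run.forN (fun j s2 => (∀ i < P k + j, s2.nat out (o + i) =
        ∑ v ∈ Finset.range (k + 1), digit P v i * s.nat wt v) ∧
        ∀ i < o, s2.nat out i = s.nat out i) ?_
            hK1 (by norm_num) ?_ ?_ ?_ ?_ ?_
      · rw [e8]
        have := hP.le_of_le (show k + 1 ≤ n from hkn)
        omega
      · rw [Memory.setNat_nat_ne _ _ _ h20.symm, e7]
        refine ⟨fun i hi2 => ?_, hi'⟩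
        rw [hi i hi2, Finset.sum_range_succ, hP.digit_of_lt hi2]
        simp
      · rintro j hj s2 hf2 hj2 ⟨hi2, hi3⟩
        have e9 : ∀ a, a ≠ out → a ≠ 20 → s2.nat a = s1.nat a := fun a ha h1 => by
          rw [hf2.nat a]
          simp [Program.forN, natFree, ha, h1]
        rw [e8] at hj
        refine Run.setNat ?_
        simp only [NatExpr.val, NatExpr.val_reg, e9 _ hob g6, e9 _ hpv g0, e9 _ hwt g3,
          e9 21 h21 (by decide), f1 _ hob g6 g7 g8, f1 _ hpv g0 g1 g2, f1 _ hwt g3 g4 g5, e6, hj2,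
          hPs k hkn.le, ← ho]
        refine ⟨fun i hi4 => ?_, fun i hi4 => ?_⟩
        · simp only [Memory.setNat_nat_apply, h20.symm, false_and, if_false, true_and]
          by_cases hik : i = P k + j
          · subst hik
            rw [if_pos (by omega), hi2 j (by have := hP.pos k; omega), Finset.sum_range_succ,
              Finset.sum_range_succ, hP.digit_add_self (by omega),
              Finset.sum_congr rfl fun v hv => by
                rw [← hP.digit_add (j := j) (Finset.mem_range.1 hv)]]
            ring
          · rw [if_neg (by omega)]
            exact hi2 i (by omega)
        · simp only [Memory.setNat_nat_apply, h20.symm, false_and, if_false, true_and]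
          rw [if_neg (by omega)]
          exact hi3 i hi4
      · rintro s2 _ ⟨hi2, hi3⟩
        have h2 : ∀ i < P (k + 1), s2.nat out (o + i) =
            ∑ v ∈ Finset.range (k + 1), digit P v i * s.nat wt v := fun i hi4 =>
          hi2 i (by rw [e8]; omega)
        have : (s2.setNat 21 0 (k + 1)).nat out = s2.nat out :=
          Memory.setNat_nat_ne _ _ _ h21.symm
        rw [this]
        exact ⟨h2, hi3⟩
      · simp [natFree, h20]
      · simp [Program.forN, natFree, h22]
    · intro s' _ hi
      rw [e0 _ h0] at hi
      exact hi
    · simp [Program.forN, natFree, h21]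
    · simp [Program.forN, natFree, h0]
  refine key.mono_time ?_
  have := Nat.mul_pos hR1 hK1
  nlinarith

/-! ### Determinants -/

/-- The matrix with entries `f a b`, `a, b < μ`, is stored in the complex array `3`, where
row `a` starts in the cell whose number is in cell `a` of the natural array `6`. -/
def HoldsSquare (μ : ℕ) (f : ℕ → ℕ → ℂ) (s : Memory) : Prop :=
  ∀ a < μ, ∀ b < μ, s.cpx 3 (s.nat 6 a + b) = f a b

/-- The determinant of the matrix with entries `f a b`, `a, b < μ`. -/
noncomputable def squareDet (μ : ℕ) (f : ℕ → ℕ → ℂ) : ℂ :=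
  Matrix.det (Matrix.of fun a b : Fin μ => f a b)

/-- Adds `z` times row `j` to row `i`. -/
def addRow (f : ℕ → ℕ → ℂ) (i j : ℕ) (z : ℂ) : ℕ → ℕ → ℂ :=
  Function.update f i fun c => f i c + z * f j c

theorem squareDet_addRow {μ i j : ℕ} (hi : i < μ) (hj : j < μ) (hij : i ≠ j) (f : ℕ → ℕ → ℂ)
    (z : ℂ) : squareDet μ (addRow f i j z) = squareDet μ f := by
  have := Matrix.det_updateRow_add_smul_self (Matrix.of fun a b : Fin μ => f a b)
    (i := ⟨i, hi⟩) (j := ⟨j, hj⟩) (by simpa using hij) z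
  rw [squareDet, squareDet, ← this]
  congr 1
  ext a b
  by_cases h : a = ⟨i, hi⟩
  · subst h
    simp [addRow]
  · have h' : (a : ℕ) ≠ i := fun h' => h (Fin.ext h')
    simp [addRow, h, h', Matrix.updateRow_ne]

theorem squareDet_of_upper {μ : ℕ} {f : ℕ → ℕ → ℂ} (h : ∀ c a, c < a → a < μ → f a c = 0) :
    squareDet μ f = ∏ a ∈ Finset.range μ, f a a := by
  rw [squareDet, Matrix.det_of_isUpperTriangular, Finset.prod_range]
  · rfl
  · intro a b hab
    exact h b a hab a.2

/-- The cell of the entry in the row and the column with numbers in the registers `i` and `j`. -/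
def entryCell (i j : ℕ) : NatExpr := .add (.cell 6 (.reg i)) (.reg j)

/-- Adds a multiple of the row with number in register `j` to the row with number in register
`i`.  The factor is in the complex register `4`. -/
def addRowProgram (i j : ℕ) : Program :=
  .forN 20 23 0 (.setCpx 3 (entryCell i 20)
    (.add (.cell 3 (entryCell i 20)) (.mul (.cell 4 (.const 0)) (.cell 3 (entryCell j 20)))))

/-- Computes the determinant of the matrix in array `3`, with the number of rows in register `23`,
by elimination. -/
def detProgram : Program :=
  .seq
    (.forN 22 23 0 (.forN 21 23 0 (.branch (.natLt (.reg 22) (.reg 21))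
      (.seq
        (.branch (.cpxEq (.cell 3 (entryCell 22 22)) (.const 0))
          (.seq (.setCpx 4 (.const 0) (.const 1)) (addRowProgram 22 21)) .skip)
        (.seq
          (.setCpx 4 (.const 0) (.sub (.const 0)
            (.div (.cell 3 (entryCell 21 22)) (.cell 3 (entryCell 22 22)))))
          (addRowProgram 21 22)))
      .skip)))
    (.seq (.setCpx 5 (.const 0) (.const 1))
      (.forN 22 23 0 (.setCpx 5 (.const 0)
        (.mul (.cell 5 (.const 0)) (.cell 3 (entryCell 22 22))))))

theorem addRowProgram_run {i j : ℕ} {s : Memory} {R m : ℕ} {f : ℕ → ℕ → ℂ}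
    (hm : ∀ a < m, s.nat 6 a = a * m) (hμ : s.nat 23 0 ≤ m) (hR : m ≤ R) (hR1 : 1 ≤ R)
    (hf : HoldsSquare (s.nat 23 0) f s) (hi : s.nat i 0 < s.nat 23 0) (hj : s.nat j 0 < s.nat 23 0)
    (hi20 : i ≠ 20 := by decide) (hj20 : j ≠ 20 := by decide) :
    Run (addRowProgram i j) s (6000 * R) fun s' =>
      HoldsSquare (s.nat 23 0) (addRow f (s.nat i 0) (s.nat j 0) (s.cpx 4 0)) s' := by
  set μ := s.nat 23 0 with hμd
  have key : Run (addRowProgram i j) s (200 * (R * 30)) fun s' =>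
      HoldsSquare μ (addRow f (s.nat i 0) (s.nat j 0) (s.cpx 4 0)) s' := by
    refine Run.forN (fun k s' => ∀ a < μ, ∀ b < μ, s'.cpx 3 (s.nat 6 a + b) =
      if b < k then addRow f (s.nat i 0) (s.nat j 0) (s.cpx 4 0) a b else f a b)
      (hμ.trans hR) hR1 (by norm_num) ?_ ?_ ?_
    · intro a ha b hb
      simpa using hf a ha b hb
    · intro k hk s' hfr hk' hinv
      refine Run.setCpx ?_
      have e1 : ∀ a, a ≠ 20 → s'.nat a = s.nat a := fun a ha => hfr.nat a (by
        simp [forN, natFree, ha])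
      have e2 : s'.cpx 4 = s.cpx 4 := hfr.cpx 4 rfl
      intro a ha b hb
      simp only [entryCell, NatExpr.val, NatExpr.val_reg, CpxExpr.val, e1 i hi20, e1 j hj20,
        e1 6 (by decide), hk', e2, Memory.setNat_cpx, Memory.setCpx_cpx_apply, true_and]
      rw [hinv _ hi k hk, hinv _ hj k hk, if_neg (lt_irrefl k), if_neg (lt_irrefl k),
        hinv a ha b hb]
      by_cases hc : a = s.nat i 0 ∧ b = k
      · obtain ⟨rfl, rfl⟩ := hc
        simp [addRow]
      · have hne : s.nat 6 a + b ≠ s.nat 6 (s.nat i 0) + k := by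
          rw [hm a (ha.trans_le hμ), hm _ (hi.trans_le hμ)]
          intro h
          have hbm := hb.trans_le hμ
          have hkm := hk.trans_le hμ
          have h1 := congrArg (· / m) h
          have h2 := congrArg (· % m) h
          simp only [Nat.mod_eq_of_lt hbm, Nat.mod_eq_of_lt hkm,
            mul_comm _ m, Nat.mul_add_div (show 0 < m by omega), Nat.div_eq_of_lt hbm,
            Nat.div_eq_of_lt hkm, Nat.mul_add_mod] at h1 h2
          exact hc ⟨by omega, h2⟩
        rw [if_neg hne]
        by_cases hbk : b < k
        · rw [if_pos hbk, if_pos (by omega)]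
        · rw [if_neg hbk]
          by_cases hbk' : b < k + 1
          · have hb' : b = k := by omega
            rw [if_pos hbk', addRow, Function.update_of_ne fun h => hc ⟨h, hb'⟩]
          · rw [if_neg hbk']
    · intro s' hfr hinv a ha b hb
      rw [hfr.nat 6 rfl, hinv a ha b hb, if_pos hb]
  exact key.mono_time (by omega)

/-- Elimination without exchange of rows: if the pivot is zero, the row to be cleared is first added
to the pivot row. If the pivot is zero even then, so is the entry to be cleared, and the convention
that division by 0 gives 0 makes the next step do nothing in that column. Only multiples of rows are
added to other rows, so no sign has to be tracked. -/
theorem detProgram_run {s : Memory} {R m : ℕ} {f : ℕ → ℕ → ℂ}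
    (hm : ∀ a < m, s.nat 6 a = a * m) (hμ : s.nat 23 0 ≤ m) (hR : m ≤ R) (hR1 : 1 ≤ R)
    (hf : HoldsSquare (s.nat 23 0) f s) :
    Run detProgram s (500000000 * R ^ 3) fun s' => s'.cpx 5 0 = squareDet (s.nat 23 0) f := by
  set μ := s.nat 23 0 with hμd
  have key : Run detProgram s (200 * (R * (200 * (R * (30 + ((30 + (30 + 6000 * R)) +
      (30 + 6000 * R)))))) + (30 + 200 * (R * 30))) fun s' => s'.cpx 5 0 = squareDet μ f := by
    refine Run.seq (R := fun s' => ∃ g, HoldsSquare μ g s' ∧ squareDet μ g = squareDet μ f ∧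
      ∀ c a, c < a → a < μ → g a c = 0) ?_ ?_
    · refine Run.forN (fun k s' => ∃ g, HoldsSquare μ g s' ∧ squareDet μ g = squareDet μ f ∧
        ∀ c a, c < k → c < a → a < μ → g a c = 0) (hμ.trans hR) hR1
        (Nat.mul_pos (by norm_num) (Nat.mul_pos hR1 (by omega))) ?_ ?_ ?_
      · exact ⟨f, hf, rfl, by simp⟩
      · rintro j hj s1 hf1 hj1 ⟨g, hg, hgd, hg0⟩
        have e1 : s1.nat 6 = s.nat 6 := hf1.nat 6 rfl
        have e2 : s1.nat 23 = s.nat 23 := hf1.nat 23 rfl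
        refine Run.forN (fun k s' => ∃ g, HoldsSquare μ g s' ∧ squareDet μ g = squareDet μ f ∧
          (∀ c a, c < j → c < a → a < μ → g a c = 0) ∧ ∀ a, j < a → a < k → g a j = 0)
          (by rw [e2]; exact hμ.trans hR) hR1 (by omega) ?_ ?_ ?_
        · exact ⟨g, hg, hgd, hg0, fun a _ h => absurd h (by omega)⟩
        · rintro i hi s2 hf2 hi2 ⟨g, hg, hgd, hg0, hgi⟩
          rw [e2] at hi
          have e3 : s2.nat 6 = s.nat 6 := (hf2.nat 6 rfl).trans e1
          have e4 : s2.nat 23 = s.nat 23 := (hf2.nat 23 rfl).trans e2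
          have e5 : s2.nat 22 0 = j := by rw [hf2.nat 22 rfl, hj1]
          refine Run.branch ?_ ?_
          · intro hlt
            have hlt : j < i := by simpa [Test.Holds, e5, hi2] using hlt
            refine Run.seq (R := fun s' => ∃ g, HoldsSquare μ g s' ∧
              squareDet μ g = squareDet μ f ∧
              (∀ c a, c < j → c < a → a < μ → g a c = 0) ∧ (∀ a, j < a → a < i → g a j = 0) ∧
              (g j j = 0 → g i j = 0)) ?_ ?_
            · refine Run.branch ?_ ?_
              · intro hz
                have hz : g j j = 0 := by
                  have := hg j hj j hj
                  rw [e3] at this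
                  simpa [Test.Holds, CpxExpr.val, entryCell, NatExpr.val, e3, e5, this] using hz
                refine Run.setCpx_seq ?_
                refine (addRowProgram_run (s := s2.setCpx 4 0 1) (f := g) (m := m)
                  (by simpa [e3] using hm) (by simpa [e4] using hμ) hR hR1
                  (by rw [Memory.setCpx_nat, e4]; exact hg) (by simpa [e4, e5] using hj)
                  (by simpa [e4, hi2] using hi)).mono le_rfl
                  fun s3 hf3 h3 => ?_
                simp only [Memory.setCpx_nat, Memory.setCpx_cpx_self, e4, e5, hi2, ← hμd] at h3
                refine ⟨_, h3, ?_, ?_, ?_, ?_⟩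
                · rw [squareDet_addRow hj hi hlt.ne, hgd]
                · intro c a hc hca ha
                  by_cases haj : a = j
                  · subst haj
                    simp [addRow, hg0 c a hc hca ha, hg0 c i hc (by omega) hi]
                  · simp [addRow, haj, hg0 c a hc hca ha]
                · intro a ha hai
                  simp [addRow, ha.ne', hgi a ha hai]
                · intro h
                  have : g i j = 0 := by simpa [addRow, hz] using h
                  simp [addRow, hlt.ne', this]
              · intro hz
                have hz : g j j ≠ 0 := by
                  have := hg j hj j hj
                  rw [e3] at this
                  simpa [Test.Holds, CpxExpr.val, entryCell, NatExpr.val, e3, e5, this] using hz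
                exact Run.mono_time (Run.skip ⟨g, hg, hgd, hg0, hgi, fun h => absurd h hz⟩)
                  (by omega)
            · rintro s3 hf3 ⟨g, hg, hgd, hg0, hgi, hgp⟩
              have e6 : s3.nat 6 = s.nat 6 := (hf3.nat 6 rfl).trans e3
              have e7 : s3.nat 23 = s.nat 23 := (hf3.nat 23 rfl).trans e4
              have e8 : s3.nat 22 0 = j := by rw [hf3.nat 22 rfl, e5]
              have e9 : s3.nat 21 0 = i := by rw [hf3.nat 21 rfl, hi2]
              refine Run.setCpx_seq ?_
              have hv : (CpxExpr.sub (.const 0) (.div (.cell 3 (entryCell 21 22))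
                  (.cell 3 (entryCell 22 22)))).val s3 = -(g i j / g j j) := by
                have h1 := hg j hj j hj
                have h2 := hg i hi j hj
                rw [e6] at h1 h2
                simp [CpxExpr.val, entryCell, NatExpr.val, e6, e8, e9, h1, h2]
              rw [hv]
              refine (addRowProgram_run (s := s3.setCpx 4 0 _) (f := g) (m := m)
                (by simpa [e6] using hm) (by simpa [e7] using hμ) hR hR1
                (by rw [Memory.setCpx_nat, e7]; exact hg) (by simpa [e7, e9] using hi)
                (by simpa [e7, e8] using hj)).mono le_rfl
                fun s4 hf4 h4 => ?_
              simp only [Memory.setCpx_nat, Memory.setCpx_cpx_self, e7, e8, e9,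
                ← hμd] at h4
              refine ⟨_, h4, ?_, ?_, ?_⟩
              · rw [squareDet_addRow hi hj hlt.ne', hgd]
              · intro c a hc hca ha
                by_cases hai : a = i
                · subst hai
                  simp [addRow, hg0 c a hc hca ha, hg0 c j hc (by omega) hj]
                · simp [addRow, hai, hg0 c a hc hca ha]
              · intro a ha hai
                -- In row `i` the new entry is `g i j - (g i j / g j j) * g j j`; for a zero pivot
                -- it is still 0 by `hgp`.
                by_cases hai : a = i
                · subst hai
                  by_cases hz : g j j = 0
                  · simp [addRow, hz, hgp hz]
                  · simp [addRow, hz]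
                · simp [addRow, hai, hgi a ha (by omega)]
          · intro hlt
            have hlt : i ≤ j := by simpa [Test.Holds, e5, hi2] using hlt
            exact Run.mono_time (Run.skip
              ⟨g, hg, hgd, hg0, fun a h1 h2 => absurd h2 (by omega)⟩) (by omega)
        · rintro s2 hf2 ⟨g, hg, hgd, hg0, hgi⟩
          refine ⟨g, hg, hgd, fun c a hc hca ha => ?_⟩
          by_cases hcj : c = j
          · subst hcj
            exact hgi a hca (by rw [e2]; exact ha)
          · exact hg0 c a (by omega) hca ha
      · rintro s1 _ ⟨g, hg, hgd, hg0⟩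
        exact ⟨g, hg, hgd, fun c a hca ha => hg0 c a (by omega) hca ha⟩
    · rintro s1 hf1 ⟨g, hg, hgd, hg0⟩
      have e2 : s1.nat 23 = s.nat 23 := hf1.nat 23 rfl
      refine Run.setCpx_seq ?_
      refine Run.forN (fun k s' => s'.cpx 5 0 = ∏ a ∈ Finset.range k, g a a)
        (by rw [Memory.setCpx_nat, e2]; exact hμ.trans hR) hR1 (by omega) ?_ ?_ ?_
      · simp [NatExpr.val, CpxExpr.val]
      · intro k hk s2 hf2 hk2 h2
        rw [Memory.setCpx_nat, e2] at hk
        refine Run.setCpx ?_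
        have e3 : s2.cpx 3 = s1.cpx 3 := by
          rw [hf2.cpx 3 rfl, Memory.setCpx_cpx_ne _ _ _ (by decide)]
        have e4 : s2.nat 6 = s1.nat 6 := hf2.nat 6 rfl
        simp [NatExpr.val, CpxExpr.val, entryCell, h2, Finset.prod_range_succ, hk2, e3, e4,
          hg k hk k hk]
      · intro s2 _ h2
        rw [h2, Memory.setCpx_nat, e2, ← hgd, squareDet_of_upper hg0]
  refine key.mono_time ?_
  have h1 : R ≤ R ^ 3 := Nat.le_self_pow (by norm_num) R
  have h2 : R ^ 2 ≤ R ^ 3 := Nat.pow_le_pow_right hR1 (by norm_num)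
  ring_nf
  ring_nf at h1 h2
  omega

/-! ### Transfer matrices -/

namespace NcABP

variable {d m : ℕ} (A : NcABP d m)

theorem width_pos : 0 < A.width :=
  (A.layerSize_pos 0).trans_le (Finset.le_sup (f := A.layerSize) (Finset.mem_univ 0))

theorem layerSize_le_width (l : Fin (d + 1)) : A.layerSize l ≤ A.width :=
  Finset.le_sup (f := A.layerSize) (Finset.mem_univ l)

/-- The coordinates of the labels, extended by `0`. -/
def extLabel (l u v a : ℕ) : ℂ :=
  if hl : l < d then
    if hu : u < A.layerSize (⟨l, hl⟩ : Fin d).castSucc then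
      if hv : v < A.layerSize (⟨l, hl⟩ : Fin d).succ then
        if ha : a < m then A.label ⟨l, hl⟩ ⟨u, hu⟩ ⟨v, hv⟩ ⟨a, ha⟩ else 0
      else 0
    else 0
  else 0

/-- The vertex number `0` in each of `n` copies of the branching program. -/
def zeroState (n : ℕ) : Fin n → Fin A.width := fun _ => ⟨0, A.width_pos⟩

end NcABP

/-! ### Products of column matrices and their restriction to bags. -/

namespace RectTableau

variable {n d m : ℕ} (T : RectTableau n d m) (A : NcABP d m)

/-- The number in row `b` of column `c`. -/
def num (c : Fin (T.shape.rowLen 0)) (b : Fin (T.shape.colLen c)) : Fin n :=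
  T.entry (T.shape.box c b)

/-- The set of the numbers in column `c`. -/
def colSet (c : Fin (T.shape.rowLen 0)) : Finset (Fin n) := Finset.univ.image (T.num c)

theorem num_mem_colSet (c : Fin (T.shape.rowLen 0)) (b : Fin (T.shape.colLen c)) :
    T.num c b ∈ T.colSet c := Finset.mem_image_of_mem _ (Finset.mem_univ b)

/-- The number of the columns in the list `L` that contain `v`. -/
def count (L : List (Fin (T.shape.rowLen 0))) (v : Fin n) : ℕ :=
  L.countP fun c => decide (v ∈ T.colSet c)

theorem count_cons (c : Fin (T.shape.rowLen 0)) (L : List (Fin (T.shape.rowLen 0))) (v : Fin n) :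
    T.count (c :: L) v = T.count L v + if v ∈ T.colSet c then 1 else 0 := by
  simp [count, List.countP_cons]

/-- The matrix of column `c`: a path in each of `n` copies of the branching program is in layer
`k v`, and the paths of the numbers in the column advance by one edge. -/
noncomputable def transfer (k : Fin n → ℕ) (c : Fin (T.shape.rowLen 0)) :
    Matrix (Fin n → Fin A.width) (Fin n → Fin A.width) ℂ :=
  Matrix.of fun σ σ' => if ∀ v ∉ T.colSet c, σ v = σ' v then
    Matrix.det (Matrix.of fun a b : Fin (T.shape.colLen c) =>
      A.extLabel (k (T.num c b)) (σ (T.num c b)) (σ' (T.num c b)) a) else 0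

/-- The product of the matrices of the columns in the list `L`, latest column first, after the
columns in the list `pre`. -/
noncomputable def segment (pre : List (Fin (T.shape.rowLen 0))) :
    List (Fin (T.shape.rowLen 0)) → Matrix (Fin n → Fin A.width) (Fin n → Fin A.width) ℂ
  | [] => 1
  | c :: L => segment pre L * T.transfer A (T.count (L ++ pre)) c

theorem segment_append (pre L L' : List (Fin (T.shape.rowLen 0))) :
    T.segment A pre (L' ++ L) = T.segment A pre L * T.segment A (L ++ pre) L' := by
  induction L' with
  | nil => simp [segment]
  | cons c L' ih => simp [segment, ih, mul_assoc]

/-- Permutations of the vertices of the copies that do not advance leave the product unchanged. -/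
theorem segment_submatrix (pre L : List (Fin (T.shape.rowLen 0)))
    (e : Fin n → Equiv.Perm (Fin A.width))
    (he : ∀ c ∈ L, ∀ v ∈ T.colSet c, e v = Equiv.refl _) :
    (T.segment A pre L).submatrix (Equiv.piCongrRight e) (Equiv.piCongrRight e) =
      T.segment A pre L := by
  induction L with
  | nil => simp [segment]
  | cons c L ih =>
    rw [segment, ← Matrix.submatrix_mul_equiv _ _ _ (Equiv.piCongrRight e) _,
      ih fun c hc => he c (by simp [hc])]
    congr 1
    ext σ σ'
    have h1 : ∀ v ∈ T.colSet c, ∀ τ : Fin n → Fin A.width, Equiv.piCongrRight e τ v = τ v := by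
      intro v hv τ
      simp [he c (by simp) v hv]
    have h2 : ∀ b, ∀ τ : Fin n → Fin A.width,
        Equiv.piCongrRight e τ (T.num c b) = τ (T.num c b) :=
      fun b => h1 _ (T.num_mem_colSet c b)
    simp only [transfer, Matrix.submatrix_apply, Matrix.of_apply, h2]
    simp only [Equiv.piCongrRight_apply, Pi.map_apply, EmbeddingLike.apply_eq_iff_eq]

/-- A number that occurs in none of the columns never moves: every factor forces the two states to
agree there. -/
theorem segment_eq_zero (pre L : List (Fin (T.shape.rowLen 0))) {v : Fin n}
    (hv : ∀ c ∈ L, v ∉ T.colSet c) {σ σ' : Fin n → Fin A.width} (h : σ v ≠ σ' v) :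
    T.segment A pre L σ σ' = 0 := by
  induction L generalizing σ' with
  | nil =>
    rw [segment, Matrix.one_apply_ne]
    exact fun h' => h (congrFun h' v)
  | cons c L ih =>
    rw [segment, Matrix.mul_apply]
    refine Finset.sum_eq_zero fun τ _ => ?_
    by_cases hτ : σ v = τ v
    · rw [transfer, Matrix.of_apply, if_neg, mul_zero]
      exact fun h' => h (hτ.trans (h' v (hv c (by simp))))
    · rw [ih (fun c hc => hv c (by simp [hc])) hτ, zero_mul]

/-- The states that are `0` outside of the set `B`. -/
def SupportedIn (B : Finset (Fin n)) (σ : Fin n → Fin A.width) : Prop := ∀ v ∉ B, (σ v : ℕ) = 0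

/-- Replacement of the vertices outside of `B` by `0`. -/
def restrict (B : Finset (Fin n)) (σ : Fin n → Fin A.width) : Fin n → Fin A.width :=
  fun v => if v ∈ B then σ v else ⟨0, A.width_pos⟩

/-- Meant for the bag `B` of a parent and the bag `C` of its child. A number outside of `C` either
stands still, and then its vertex must be the same in both states and may be renamed to 0, or it
lies outside of `B`, where both states are 0 already. -/
theorem segment_restrict (pre L : List (Fin (T.shape.rowLen 0))) {B C : Finset (Fin n)}
    (hL : ∀ c ∈ L, ∀ v ∈ T.colSet c, v ∈ B → v ∈ C) {σ σ' : Fin n → Fin A.width}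
    (hσ : SupportedIn A B σ) (hσ' : SupportedIn A B σ') :
    T.segment A pre L σ σ' = if ∀ v, v ∉ C → σ v = σ' v then
      T.segment A pre L (restrict A C σ) (restrict A C σ') else 0 := by
  split_ifs with h
  · have := T.segment_submatrix A pre L
      -- The renaming exchanges `σ v` and 0 outside of `C`. If such a `v` occurs in a column of `L`,
      -- then `v ∉ B` and `σ v = 0`, so the exchange is trivial, as invariance requires.
      (fun v => if v ∈ C then Equiv.refl _ else Equiv.swap (σ v) ⟨0, A.width_pos⟩) (by
        intro c hc v hv
        split_ifs with hC
        · rfl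
        · have : σ v = ⟨0, A.width_pos⟩ := Fin.ext (hσ v fun hB => hC (hL c hc v hv hB))
          rw [this, Equiv.swap_self])
    have h2 := congrFun (congrFun this σ) σ'
    rw [Matrix.submatrix_apply] at h2
    rw [← h2]
    congr 1 <;> funext v <;> by_cases hC : v ∈ C <;> simp [restrict, hC]
    rw [h v hC]
    simp
  · push Not at h
    obtain ⟨v, hv, hne⟩ := h
    refine T.segment_eq_zero A pre L (v := v) (fun c hc hvc => ?_) hne
    have hB : v ∉ B := fun hB => hv (hL c hc v hvc hB)
    exact hne (Fin.ext ((hσ v hB).trans (hσ' v hB).symm))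

open Classical in
-- A number outside of `B` stands still in one of the two blocks. Since the outer states are 0
-- there, the intermediate state must be 0 too. Hence the matrices indexed by states supported in
-- `B` multiply like the full ones.
theorem segment_append_apply (pre L L' : List (Fin (T.shape.rowLen 0))) {B : Finset (Fin n)}
    (hL : ∀ v ∉ B, (∀ c ∈ L, v ∉ T.colSet c) ∨ ∀ c ∈ L', v ∉ T.colSet c)
    {σ σ' : Fin n → Fin A.width} (hσ : SupportedIn A B σ) (hσ' : SupportedIn A B σ') :
    T.segment A pre (L' ++ L) σ σ' = ∑ τ with SupportedIn A B τ,
      T.segment A pre L σ τ * T.segment A (L ++ pre) L' τ σ' := by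
  rw [segment_append, Matrix.mul_apply, Finset.sum_filter]
  refine Finset.sum_congr rfl fun τ _ => ?_
  split_ifs with h
  · rfl
  · unfold SupportedIn at h
    push Not at h
    obtain ⟨v, hv, hne⟩ := h
    rcases hL v hv with h | h
    · rw [T.segment_eq_zero A pre L h, zero_mul]
      exact fun h' => hne (by rw [← h']; exact hσ v hv)
    · rw [T.segment_eq_zero A (L ++ pre) L' h, mul_zero]
      exact fun h' => hne (by rw [h']; exact hσ' v hv)

end RectTableau

/-! ### Products of tensor products of matrices -/

/-- The tensor product of the matrices `M v`. -/
def kron {n w : ℕ} (M : Fin n → Matrix (Fin w) (Fin w) ℂ) :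
    Matrix (Fin n → Fin w) (Fin n → Fin w) ℂ :=
  Matrix.of fun σ σ' => ∏ v, M v (σ v) (σ' v)

theorem kron_mul {n w : ℕ} (M N : Fin n → Matrix (Fin w) (Fin w) ℂ) :
    kron M * kron N = kron fun v => M v * N v := by
  ext σ σ'
  simp only [kron, Matrix.mul_apply, Matrix.of_apply, Finset.prod_univ_sum,
    Fintype.piFinset_univ, Finset.prod_mul_distrib]

theorem kron_one {n w : ℕ} : kron (fun _ : Fin n => (1 : Matrix (Fin w) (Fin w) ℂ)) = 1 := by
  ext σ σ'
  simp only [kron, Matrix.of_apply, Matrix.one_apply, Finset.prod_ite_zero, Finset.prod_const_one,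
    Finset.mem_univ, true_imp_iff, funext_iff]

/-- The product `M 0 * ⋯ * M (k - 1)`. -/
def prodTo {R : Type*} [Monoid R] (M : ℕ → R) : ℕ → R
  | 0 => 1
  | k + 1 => prodTo M k * M k

theorem prodTo_apply {w : ℕ} (M : ℕ → Matrix (Fin w) (Fin w) ℂ) (k : ℕ) (a b : Fin w) :
    prodTo M k a b = ∑ π : Fin (k + 1) → Fin w with π 0 = a ∧ π (Fin.last k) = b,
      ∏ l : Fin k, M l (π l.castSucc) (π l.succ) := by
  induction k generalizing b with
  | zero =>
    rw [prodTo, Matrix.one_apply, Finset.sum_filter,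
      ← (Equiv.funUnique (Fin 1) (Fin w)).symm.sum_comp]
    simp only [Fin.last_zero, Equiv.funUnique_symm_apply, uniqueElim_const, Finset.univ_eq_empty,
      Finset.prod_empty]
    by_cases h : a = b
    · subst h
      simp
    · rw [if_neg h, Finset.sum_eq_zero]
      rintro c -
      rw [if_neg]
      rintro ⟨rfl, rfl⟩
      exact h rfl
  | succ k ih =>
    rw [prodTo, Matrix.mul_apply, Finset.sum_filter,
      ← (Fin.snocEquiv fun _ : Fin (k + 2) => Fin w).sum_comp, Fintype.sum_prod_type]
    simp only [ih, Finset.sum_filter, Finset.sum_mul]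
    rw [Finset.sum_comm]
    simp only [Fin.snocEquiv_apply, Fin.snoc_last]
    rw [Finset.sum_eq_single b]
    · refine Finset.sum_congr rfl fun π _ => ?_
      rw [Finset.sum_eq_single (π (Fin.last k))]
      · have h0 : (Fin.snoc (α := fun _ => Fin w) π b : Fin (k + 2) → Fin w) 0 = π 0 :=
          Fin.snoc_castSucc (α := fun _ => Fin w) (i := 0) ..
        rw [h0]
        simp only [and_true, Fin.prod_univ_castSucc, Fin.snoc_castSucc, Fin.succ_last,
          Fin.snoc_last, ← Fin.castSucc_succ, Fin.val_castSucc, Fin.val_last, ite_mul, zero_mul]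
      · intro c _ hc
        rw [if_neg (fun h => hc h.2.symm), zero_mul]
      · simp
    · intro c _ hc
      refine Finset.sum_eq_zero fun π _ => if_neg fun h => hc h.2
    · simp

/-! ### Coordinates of the computed tensor as entries of matrix products. -/

namespace NcABP

variable {d m : ℕ} (A : NcABP d m)

/-- The matrix of the coordinates number `a` of the labels after layer `l`. -/
def labelMatrix (l a : ℕ) : Matrix (Fin A.width) (Fin A.width) ℂ :=
  Matrix.of fun u v => A.extLabel l u v a

theorem extLabel_apply (l : Fin d) (u : Fin (A.layerSize l.castSucc))
    (v : Fin (A.layerSize l.succ)) (a : Fin m) : A.extLabel l u v a = A.label l u v a := by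
  unfold extLabel
  rw [dif_pos l.2, dif_pos u.2, dif_pos v.2, dif_pos a.2]

theorem extLabel_eq_zero (l : Fin d) {u v : ℕ} (a : ℕ) (h : A.layerSize l.succ ≤ v) :
    A.extLabel l u v a = 0 := by
  unfold extLabel
  rw [dif_pos l.2]
  split_ifs <;> first | rfl | (exfalso; simp only [Fin.eta] at *; omega)

/-- The matrix product sums over all sequences of vertex numbers below the width, paths or not. A
sequence that leaves some layer after the first has an edge into a missing vertex, with extended
label 0. Vertex 0 is the only one of layers `0` and `d`, so fixing both ends at 0 loses no path. -/
theorem tensor_eq_prodTo (I : Fin d → Fin m) (J : ℕ → ℕ) (hJ : ∀ l : Fin d, J l = I l) :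
    A.tensor I = prodTo (fun l => A.labelMatrix l (J l)) d ⟨0, A.width_pos⟩ ⟨0, A.width_pos⟩ := by
  rw [prodTo_apply, tensor]
  let ι : A.Path → Fin (d + 1) → Fin A.width :=
    fun π l => Fin.castLE (A.layerSize_le_width l) (π l)
  have hι : Function.Injective ι := by
    intro π π' h
    funext l
    exact Fin.castLE_injective _ (congrFun h l)
  rw [← Finset.sum_subset (s₁ := Finset.univ.map ⟨ι, hι⟩), Finset.sum_map]
  · refine Finset.sum_congr rfl fun π _ => Finset.prod_congr rfl fun l _ => ?_
    rw [hJ]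
    exact (A.extLabel_apply l (π l.castSucc) (π l.succ) (I l)).symm
  · intro π hπ
    obtain ⟨π, -, rfl⟩ := Finset.mem_map.1 hπ
    simp only [Finset.mem_filter, Finset.mem_univ, true_and]
    refine ⟨Fin.ext ?_, Fin.ext ?_⟩
    · have := (π 0).2
      have h := A.source_layer
      simp only [Function.Embedding.coeFn_mk, ι, Fin.val_castLE]
      omega
    · have := (π (Fin.last d)).2
      have h := A.sink_layer
      simp only [Function.Embedding.coeFn_mk, ι, Fin.val_castLE]
      omega
  · intro π hπ hπ'
    simp only [Finset.mem_filter, Finset.mem_univ, true_and] at hπ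
    by_contra hne
    have hlt : ∀ l, (π l : ℕ) < A.layerSize l := by
      intro l
      by_contra hl
      cases l using Fin.cases with
      | zero =>
        rw [hπ.1] at hl
        exact hl (A.layerSize_pos 0)
      | succ l =>
        refine hne (Finset.prod_eq_zero (Finset.mem_univ l) ?_)
        exact A.extLabel_eq_zero l _ (not_lt.1 hl)
    exact hπ' (Finset.mem_map.2 ⟨fun l => ⟨π l, hlt l⟩, Finset.mem_univ _, rfl⟩)

end NcABP

/-! ### The value of a tableau as an entry of a product of column matrices. -/

namespace RectTableau

variable {n d m : ℕ} (T : RectTableau n d m) (A : NcABP d m)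

/-- The boxes, sorted by columns. -/
noncomputable def colEquiv :
    (Σ c : Fin (T.shape.rowLen 0), Fin (T.shape.colLen c)) ≃ T.shape.cells :=
  (T.boxEquiv (Classical.choice T.nonempty_lift)).trans
    (Classical.choice T.nonempty_lift).1.symm

theorem colEquiv_apply (c : Fin (T.shape.rowLen 0)) (b : Fin (T.shape.colLen c)) :
    T.colEquiv ⟨c, b⟩ = T.shape.box c b :=
  (Classical.choice T.nonempty_lift).1.symm_apply_apply _

theorem boxEquiv_apply (S : T.Lift) (c : Fin (T.shape.rowLen 0)) (b : Fin (T.shape.colLen c)) :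
    T.boxEquiv S ⟨c, b⟩ = S.1 (T.shape.box c b) := rfl

theorem card_num_eq (v : Fin n) : (Finset.univ.filter fun x : Σ c : Fin (T.shape.rowLen 0),
    Fin (T.shape.colLen c) => T.num x.1 x.2 = v).card = d := by
  refine (Finset.card_equiv T.colEquiv fun x => ?_).trans (T.content v)
  simp only [Finset.mem_filter, Finset.mem_univ, true_and]
  rw [← Sigma.eta x, T.colEquiv_apply]
  rfl

theorem count_le {L : List (Fin (T.shape.rowLen 0))} (hL : L.Nodup) (v : Fin n) :
    T.count L v ≤ d := by
  refine le_of_le_of_eq ?_ (T.card_num_eq v)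
  rw [count, List.countP_eq_length_filter,
    ← List.toFinset_card_of_nodup (hL.filter _)]
  refine Finset.card_le_card_of_surjOn Sigma.fst fun c hc => ?_
  simp only [List.coe_toFinset, List.mem_filter, decide_eq_true_eq, Set.mem_ofPred_eq] at hc
  obtain ⟨b, -, hb⟩ := Finset.mem_image.1 hc.2
  exact ⟨⟨c, b⟩, by simpa using hb, rfl⟩

/-- Without repetitions in columns, counting columns that contain `v` is the same as counting boxes
that contain `v`. So at the end every copy has reached layer `d`. -/
theorem count_eq {L : List (Fin (T.shape.rowLen 0))} (hL : L.Nodup) (hL' : ∀ c, c ∈ L)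
    (hinj : ∀ c, Function.Injective (T.num c)) (v : Fin n) : T.count L v = d := by
  refine (T.count_le hL v).antisymm ?_
  refine (T.card_num_eq v).symm.le.trans ?_
  rw [count, List.countP_eq_length_filter, ← List.toFinset_card_of_nodup (hL.filter _)]
  refine Finset.card_le_card_of_injOn Sigma.fst (fun x hx => ?_) ?_
  · simp only [Finset.coe_filter, Finset.mem_univ, true_and, Set.mem_ofPred_eq] at hx
    simp [hL', ← hx, T.num_mem_colSet]
  · rintro ⟨c, b⟩ hx ⟨c', b'⟩ hx' h
    simp only [Finset.coe_filter, Finset.mem_univ, true_and, Set.mem_ofPred_eq] at hx hx' h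
    subst h
    rw [hinj c (hx.trans hx'.symm)]

/-- If the boxes of a number in column `c` are swapped, the determinant of the column changes its
sign. -/
theorem eval_eq_zero (p : Tensor d m) (hp : p.IsSymmetric) (c : Fin (T.shape.rowLen 0))
    (hc : ¬ Function.Injective (T.num c)) : T.eval p = 0 := by
  unfold Function.Injective at hc
  push Not at hc
  obtain ⟨b, b', hb, hne⟩ := hc
  let S : T.Lift := Classical.choice T.nonempty_lift
  let x := T.shape.box c b
  let x' := T.shape.box c b'
  have hbox : ∀ (c' : Fin (T.shape.rowLen 0)) b₁ (c'' : Fin (T.shape.rowLen 0)) b₂,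
      T.shape.box c' b₁ = T.shape.box c'' b₂ → c' = c'' ∧ (b₁ : ℕ) = b₂ := by
    intro c' b₁ c'' b₂ h
    exact ⟨Fin.ext (congrArg (fun z : T.shape.cells => z.1.2) h),
      congrArg (fun z : T.shape.cells => z.1.1) h⟩
  -- The two boxes carry the same number, so the swapped bijection is again a lift. By symmetry of
  -- `p` both lifts give the same value, and by the sign change this value is its own negative.
  let S' : T.Lift := ⟨(Equiv.swap x x').trans S.1, fun y => by
    rw [Equiv.trans_apply, S.2]
    by_cases h1 : y = x
    · rw [h1, Equiv.swap_apply_left]; exact hb.symm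
    · by_cases h2 : y = x'
      · rw [h2, Equiv.swap_apply_right]; exact hb
      · rw [Equiv.swap_apply_of_ne_of_ne h1 h2]⟩
  have hS : ∀ c' b₁, S'.1 (T.shape.box c' b₁) = S.1 (Equiv.swap x x' (T.shape.box c' b₁)) :=
    fun _ _ => rfl
  have hcol : ∀ v, T.columnDets S' v = -T.columnDets S v := by
    intro v
    unfold columnDets
    rw [← Finset.mul_prod_erase _ _ (Finset.mem_univ c),
      ← Finset.mul_prod_erase _ _ (Finset.mem_univ c), ← neg_mul]
    congr 1
    · have h := Matrix.det_permute' (Equiv.swap b b') (Matrix.of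
        fun a b : Fin (T.shape.colLen c) => v (S.1 (T.shape.box c b)).1 (S.1 (T.shape.box c b)).2
          (Fin.castLE (T.colLen_le c) a))
      rw [Equiv.Perm.sign_swap hne] at h
      simp only [Units.val_neg, Units.val_one, Int.cast_neg, Int.cast_one, neg_mul, one_mul] at h
      rw [← h]
      congr 1
      ext a b₁
      have h3 : Equiv.swap x x' (T.shape.box c b₁) = T.shape.box c (Equiv.swap b b' b₁) := by
        by_cases h1 : b₁ = b
        · rw [h1, Equiv.swap_apply_left, Equiv.swap_apply_left]
        · by_cases h2 : b₁ = b'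
          · rw [h2, Equiv.swap_apply_right, Equiv.swap_apply_right]
          · rw [Equiv.swap_apply_of_ne_of_ne h1 h2, Equiv.swap_apply_of_ne_of_ne]
            · exact fun h => h1 (Fin.ext (hbox _ _ _ _ h).2)
            · exact fun h => h2 (Fin.ext (hbox _ _ _ _ h).2)
      simp only [Matrix.of_apply, Matrix.submatrix_apply, hS, h3, id]
    · refine Finset.prod_congr rfl fun c' hc' => ?_
      have hc' := Finset.ne_of_mem_erase hc'
      congr 1
      ext a b₁
      rw [Matrix.of_apply, Matrix.of_apply, hS, Equiv.swap_apply_of_ne_of_ne]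
      · exact fun h => hc' (hbox _ _ _ _ h).1
      · exact fun h => hc' (hbox _ _ _ _ h).1
  have h1 := T.eval_eq_evalLift S p hp
  have h2 := T.eval_eq_evalLift S' p hp
  have h3 : T.evalLift S' p = -T.evalLift S p := by
    unfold evalLift
    simp only [hcol, mul_neg, Finset.sum_neg_distrib]
  rw [h3, ← h1] at h2
  exact self_eq_neg.1 h2

theorem transfer_eq_zero (k : Fin n → ℕ) (c : Fin (T.shape.rowLen 0))
    (hc : ¬ Function.Injective (T.num c)) : T.transfer A k c = 0 := by
  unfold Function.Injective at hc
  push Not at hc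
  obtain ⟨b, b', hb, hne⟩ := hc
  ext σ σ'
  simp only [transfer, Matrix.of_apply, Matrix.zero_apply]
  split_ifs
  · refine Matrix.det_zero_of_column_eq hne fun a => ?_
    simp only [Matrix.of_apply, hb]
  · rfl

theorem segment_eq_zero_of_mem (pre L : List (Fin (T.shape.rowLen 0)))
    (c : Fin (T.shape.rowLen 0)) (hL : c ∈ L) (hc : ¬ Function.Injective (T.num c)) :
    T.segment A pre L = 0 := by
  induction L with
  | nil => simp at hL
  | cons c' L ih =>
    rw [segment]
    rcases List.mem_cons.1 hL with rfl | h
    · rw [T.transfer_eq_zero A _ _ hc, mul_zero]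
    · rw [ih h, zero_mul]

open Classical in
/-- The factor of the number `v` in the summand for the permutation `ρ` of the determinant of
column `c`. -/
noncomputable def colFactor (k : ℕ) (c : Fin (T.shape.rowLen 0))
    (ρ : Equiv.Perm (Fin (T.shape.colLen c))) (v : Fin n) :
    Matrix (Fin A.width) (Fin A.width) ℂ :=
  if h : ∃ b, T.num c b = v then A.labelMatrix k (ρ h.choose) else 1

/-- In a summand of the Leibniz formula every box contributes one factor, and distinct boxes belong
to distinct copies, so the summand is a tensor product over the copies. The copies outside of the
column contribute identity matrices, which encode the condition that the states agree there. -/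
theorem transfer_eq_sum (k : Fin n → ℕ) (c : Fin (T.shape.rowLen 0))
    (hc : Function.Injective (T.num c)) :
    T.transfer A k c = ∑ ρ : Equiv.Perm (Fin (T.shape.colLen c)),
      ((Equiv.Perm.sign ρ : ℤ) : ℂ) • kron fun v => T.colFactor A (k v) c ρ v := by
  have h1 : ∀ ρ b, T.colFactor A (k (T.num c b)) c ρ (T.num c b) =
      A.labelMatrix (k (T.num c b)) (ρ b) := by
    intro ρ b
    have h : ∃ b', T.num c b' = T.num c b := ⟨b, rfl⟩
    rw [colFactor, dif_pos h, hc h.choose_spec]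
  have h2 : ∀ ρ, ∀ v ∉ T.colSet c, T.colFactor A (k v) c ρ v = 1 := by
    intro ρ v hv
    refine dif_neg ?_
    rintro ⟨b, rfl⟩
    exact hv (T.num_mem_colSet c b)
  ext σ σ'
  simp only [Matrix.sum_apply, Matrix.smul_apply, kron, Matrix.of_apply, transfer, smul_eq_mul]
  have h3 : ∀ ρ, ∏ v, T.colFactor A (k v) c ρ v (σ v) (σ' v) =
      if ∀ v ∉ T.colSet c, σ v = σ' v then ∏ b, A.labelMatrix (k (T.num c b)) (ρ b)
        (σ (T.num c b)) (σ' (T.num c b)) else 0 := by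
    intro ρ
    rw [← Finset.prod_mul_prod_compl (T.colSet c), colSet, Finset.prod_image hc.injOn, ← colSet]
    simp only [h1]
    rw [Finset.prod_congr (s₁ := (T.colSet c)ᶜ) rfl (g := fun v => if σ v = σ' v then 1 else 0)
      (fun v hv => by rw [h2 ρ v (by simpa using hv), Matrix.one_apply]), Finset.prod_ite_zero]
    simp
  simp only [h3]
  split_ifs
  · rw [Matrix.det_apply']
    rfl
  · simp

/-- The product of the factors of the number `v`. -/
noncomputable def listFactor
    (ρ : (c : Fin (T.shape.rowLen 0)) → Equiv.Perm (Fin (T.shape.colLen c))) (v : Fin n) :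
    List (Fin (T.shape.rowLen 0)) → Matrix (Fin A.width) (Fin A.width) ℂ
  | [] => 1
  | c :: L => listFactor ρ v L * T.colFactor A (T.count L v) c (ρ c) v

theorem listFactor_congr {ρ ρ' : (c : Fin (T.shape.rowLen 0)) → Equiv.Perm (Fin (T.shape.colLen c))}
    (v : Fin n) (L : List (Fin (T.shape.rowLen 0))) (h : ∀ c ∈ L, ρ c = ρ' c) :
    T.listFactor A ρ v L = T.listFactor A ρ' v L := by
  induction L with
  | nil => rfl
  | cons c L ih =>
    rw [listFactor, listFactor, ih fun c hc => h c (by simp [hc]), h c (by simp)]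

/-- Tensor products multiply factor by factor, so expanding the product over all columns separates
the copies. The permutations at columns outside of `L` are pinned to 1, which keeps the index type
the same during the induction; adding a column frees its permutation. -/
theorem segment_eq_sum (hinj : ∀ c, Function.Injective (T.num c))
    (L : List (Fin (T.shape.rowLen 0))) (hL : L.Nodup) :
    T.segment A [] L = ∑ ρ ∈ Fintype.piFinset fun c : Fin (T.shape.rowLen 0) =>
        if c ∈ L then (Finset.univ : Finset (Equiv.Perm (Fin (T.shape.colLen c)))) else {1},
      (∏ c ∈ L.toFinset, ((Equiv.Perm.sign (ρ c) : ℤ) : ℂ)) •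
        kron fun v => T.listFactor A ρ v L := by
  induction L with
  | nil =>
    have : (Fintype.piFinset fun c : Fin (T.shape.rowLen 0) =>
        if c ∈ ([] : List (Fin (T.shape.rowLen 0))) then
          (Finset.univ : Finset (Equiv.Perm (Fin (T.shape.colLen c)))) else {1}) =
        {fun _ => 1} := by
      ext ρ
      simp [funext_iff]
    rw [this, Finset.sum_singleton]
    simp [listFactor, kron_one, segment]
  | cons c L ih =>
    obtain ⟨hc, hL⟩ := List.nodup_cons.1 hL
    rw [segment, List.append_nil, ih hL, T.transfer_eq_sum A _ _ (hinj c), Finset.sum_mul_sum,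
      ← Finset.sum_product']
    refine Finset.sum_bij' (fun x _ => Function.update x.1 c x.2)
      (fun ρ _ => (Function.update ρ c 1, ρ c)) ?_ ?_ ?_ ?_ ?_
    · rintro ⟨ρ, r⟩ hρ
      simp only [Finset.mem_product, Fintype.mem_piFinset, Finset.mem_univ, and_true] at hρ
      simp only [Fintype.mem_piFinset]
      intro c'
      by_cases h : c' = c
      · subst h; simp
      · have := hρ c'
        simpa [h] using this
    · intro ρ hρ
      simp only [Fintype.mem_piFinset] at hρ
      simp only [Finset.mem_product, Fintype.mem_piFinset, Finset.mem_univ, and_true]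
      intro c'
      by_cases h : c' = c
      · subst h; simp [hc]
      · have := hρ c'
        simpa [h] using this
    · rintro ⟨ρ, r⟩ hρ
      simp only [Finset.mem_product, Fintype.mem_piFinset, Finset.mem_univ, and_true] at hρ
      have h1 : ρ c = 1 := by simpa [hc] using hρ c
      simp [← h1]
    · intro ρ _
      simp
    · rintro ⟨ρ, r⟩ _
      have h1 : ∀ c' ∈ L, Function.update ρ c r c' = ρ c' := by
        intro c' hc'
        refine Function.update_of_ne ?_ _ _
        rintro rfl
        exact hc hc'
      rw [smul_mul_smul_comm, kron_mul]
      congr 1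
      · rw [List.toFinset_cons, Finset.prod_insert (by simpa using hc), mul_comm]
        congr 1
        · simp
        · exact Finset.prod_congr rfl fun c' hc' => by rw [h1 c' (by simpa using hc')]
      · congr 1
        funext v
        rw [listFactor, T.listFactor_congr A v L h1]
        simp

/-- The columns before `c` in a list, latest first. -/
def before (L : List (Fin (T.shape.rowLen 0))) (c : Fin (T.shape.rowLen 0)) :
    List (Fin (T.shape.rowLen 0)) := L.drop (L.idxOf c + 1)

theorem before_append {L₁ L₂ : List (Fin (T.shape.rowLen 0))} {c : Fin (T.shape.rowLen 0)}
    (h : (L₁ ++ c :: L₂).Nodup) : T.before (L₁ ++ c :: L₂) c = L₂ := by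
  have hc : c ∉ L₁ := fun hc => by
    have := List.nodup_append.1 h
    exact this.2.2 c hc c (by simp) rfl
  rw [before, List.idxOf_append_of_notMem hc, List.idxOf_cons_self, add_zero,
    List.drop_length_add_append]
  simp

/-- The occurrence of a number in a column receives as its position the number of earlier columns
that contain the same number. Of two columns with a common number the later one counts the earlier
one, so these positions are distinct; bijectivity follows since there are `n * d` boxes. -/
theorem exists_lift {L : List (Fin (T.shape.rowLen 0))} (hL : L.Nodup) (hL' : ∀ c, c ∈ L)
    (hinj : ∀ c, Function.Injective (T.num c)) : ∃ S : T.Lift, ∀ c b,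
      (T.boxEquiv S ⟨c, b⟩).1 = T.num c b ∧
      ((T.boxEquiv S ⟨c, b⟩).2 : ℕ) = T.count (T.before L c) (T.num c b) := by
  have hlt : ∀ c b, T.count (T.before L c) (T.num c b) < d := by
    intro c b
    obtain ⟨L₁, L₂, h⟩ := List.append_of_mem (hL' c)
    subst h
    rw [T.before_append hL]
    have h1 := T.count_le (hL.of_append_right) (T.num c b)
    rw [count_cons, if_pos (T.num_mem_colSet c b)] at h1
    omega
  let g : (Σ c : Fin (T.shape.rowLen 0), Fin (T.shape.colLen c)) → Fin n × Fin d :=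
    fun x => (T.num x.1 x.2, ⟨_, hlt x.1 x.2⟩)
  have hg : Function.Injective g := by
    rintro ⟨c, b⟩ ⟨c', b'⟩ h
    have h1 : T.num c b = T.num c' b' := congrArg Prod.fst h
    have h2 : T.count (T.before L c) (T.num c b) = T.count (T.before L c') (T.num c' b') :=
      congrArg (fun y => (y.2 : ℕ)) h
    have key : ∀ (c c' : Fin (T.shape.rowLen 0)) b, c' ∈ T.before L c →
        T.num c b ∈ T.colSet c' →
        T.count (T.before L c') (T.num c b) < T.count (T.before L c) (T.num c b) := by
      intro c c' b hc' hb
      obtain ⟨L₁, L₂, h⟩ := List.append_of_mem (hL' c)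
      subst h
      rw [T.before_append hL] at hc' ⊢
      obtain ⟨L₃, L₄, rfl⟩ := List.append_of_mem hc'
      have h3 : T.before (L₁ ++ c :: (L₃ ++ c' :: L₄)) c' = L₄ := by
        have : L₁ ++ c :: (L₃ ++ c' :: L₄) = (L₁ ++ c :: L₃) ++ c' :: L₄ := by simp
        rw [this] at hL ⊢
        exact T.before_append hL
      rw [h3]
      simp only [count, List.countP_append, List.countP_cons, hb, decide_true, if_true]
      omega
    have hcc : c = c' := by
      by_contra hne
      have : c' ∈ T.before L c ∨ c ∈ T.before L c' := by
        obtain ⟨L₁, L₂, h⟩ := List.append_of_mem (hL' c)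
        have hc' := hL' c'
        rw [h] at hc' hL ⊢
        rw [T.before_append hL]
        rcases List.mem_append.1 hc' with h3 | h3
        · right
          obtain ⟨L₃, L₄, rfl⟩ := List.append_of_mem h3
          have : (L₃ ++ c' :: L₄) ++ c :: L₂ = L₃ ++ c' :: (L₄ ++ c :: L₂) := by simp
          rw [this] at hL ⊢
          rw [T.before_append hL]
          simp
        · rcases List.mem_cons.1 h3 with h3 | h3
          · exact absurd h3.symm hne
          · exact Or.inl h3
      rcases this with h3 | h3
      · have := key c c' b h3 (h1 ▸ T.num_mem_colSet c' b')
        rw [h2, h1] at this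
        omega
      · have := key c' c b' h3 (h1 ▸ T.num_mem_colSet c b)
        rw [← h2, ← h1] at this
        omega
    subst hcc
    rw [hinj c h1]
  have hcard : Fintype.card (Σ c : Fin (T.shape.rowLen 0), Fin (T.shape.colLen c)) =
      Fintype.card (Fin n × Fin d) :=
    Fintype.card_congr (T.boxEquiv (Classical.choice T.nonempty_lift))
  let e := Equiv.ofBijective g ((Fintype.bijective_iff_injective_and_card g).2 ⟨hg, hcard⟩)
  refine ⟨⟨T.colEquiv.symm.trans e, fun x => ?_⟩, fun c b => ?_⟩
  · obtain ⟨⟨c, b⟩, rfl⟩ := T.colEquiv.surjective x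
    rw [Equiv.trans_apply, Equiv.symm_apply_apply, T.colEquiv_apply]
    rfl
  · rw [boxEquiv_apply, Equiv.trans_apply, ← T.colEquiv_apply, Equiv.symm_apply_apply]
    exact ⟨rfl, rfl⟩

/-- The value of the tableau is an entry of the product of the matrices of all columns. -/
theorem eval_eq_segment (p : Tensor d m) (hp : p.IsSymmetric) (hA : A.Computes p)
    {L : List (Fin (T.shape.rowLen 0))} (hL : L.Nodup) (hL' : ∀ c, c ∈ L) :
    T.eval p = T.segment A [] L (A.zeroState n) (A.zeroState n) := by
  by_cases hinj : ∀ c, Function.Injective (T.num c)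
  swap
  · push Not at hinj
    obtain ⟨c, hc⟩ := hinj
    rw [T.eval_eq_zero p hp c hc, T.segment_eq_zero_of_mem A [] L c (hL' c) hc, Matrix.zero_apply]
  obtain ⟨S, hS⟩ := T.exists_lift hL hL' hinj
  rw [T.eval_eq_evalLift S p hp, evalLift_eq_sum, T.segment_eq_sum A hinj L hL]
  have h1 : (Fintype.piFinset fun c : Fin (T.shape.rowLen 0) =>
      if c ∈ L then (Finset.univ : Finset (Equiv.Perm (Fin (T.shape.colLen c)))) else {1}) =
      Finset.univ := by
    ext ρ
    simp [hL']
  have h2 : L.toFinset = Finset.univ := by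
    ext c
    simp [hL']
  rw [h1, h2, Matrix.sum_apply]
  refine Finset.sum_congr rfl fun ρ _ => ?_
  rw [Matrix.smul_apply, smul_eq_mul]
  congr 1
  rw [kron, Matrix.of_apply]
  refine Finset.prod_congr rfl fun v _ => ?_
  -- The coordinates of the factors of copy `v`; only the values for `l < d` matter.
  let J : ℕ → ℕ := fun l => if h : l < d then T.rowAt S ρ v ⟨l, h⟩ else 0
  -- The position that the lift `S` gives to a box and the layer in which the box's copy waits are
  -- both the number of earlier columns with that number. So the factors of copy `v` appear in the
  -- order of the edges of a path.
  have key : ∀ L₁ L₂, L = L₁ ++ L₂ → T.listFactor A ρ v L₂ =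
      prodTo (fun l => A.labelMatrix l (J l)) (T.count L₂ v) := by
    intro L₁ L₂
    induction L₂ generalizing L₁ with
    | nil => intro _; simp [listFactor, count, prodTo]
    | cons c L₂ ih =>
      intro h
      rw [listFactor, ih (L₁ ++ [c]) (by simp [h]), count_cons]
      by_cases hv : v ∈ T.colSet c
      · obtain ⟨b, -, rfl⟩ := Finset.mem_image.1 hv
        rw [if_pos hv, prodTo]
        congr 1
        have hb : ∃ b', T.num c b' = T.num c b := ⟨b, rfl⟩
        rw [colFactor, dif_pos hb, hinj c hb.choose_spec]
        congr 1
        have hbef : T.before L c = L₂ := by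
          subst h
          exact T.before_append hL
        obtain ⟨h3, h4⟩ := hS c b
        rw [hbef] at h4
        have hlt : T.count L₂ (T.num c b) < d := h4 ▸ (T.boxEquiv S ⟨c, b⟩).2.2
        have h5 : (T.boxEquiv S).symm (T.num c b, ⟨_, hlt⟩) = ⟨c, b⟩ := by
          rw [Equiv.symm_apply_eq]
          exact Prod.ext h3.symm (Fin.ext h4.symm)
        simp only [J]
        rw [dif_pos hlt]
        exact (congrArg (fun x : (Σ c : Fin (T.shape.rowLen 0), Fin (T.shape.colLen c)) =>
          (ρ x.1 x.2 : ℕ)) h5).symm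
      · rw [if_neg hv, add_zero, colFactor, dif_neg, mul_one]
        rintro ⟨b, rfl⟩
        exact hv (T.num_mem_colSet c b)
  rw [key [] L rfl, T.count_eq hL hL' hinj, ← hA,
    A.tensor_eq_prodTo (T.rowAt S ρ v) J fun l => by simp [J]]
  rfl

end RectTableau

/-! ### Rooted trees -/

/-- The parents and the depths of the nodes of a tree with root `r`. -/
structure Rooting {V : Type*} (G : SimpleGraph V) (r : V) where
  par : V → V
  dep : V → ℕ
  par_root : par r = r
  dep_par : ∀ x, x ≠ r → dep (par x) + 1 = dep x
  adj_par : ∀ x, x ≠ r → G.Adj x (par x)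
  par_of_adj : ∀ x y, G.Adj x y → (x ≠ r ∧ par x = y) ∨ (y ≠ r ∧ par y = x)

/-- The depth is the distance from `r`, and the parent is the last but one vertex on the path from
`r`. In a tree the ends of an edge have distances that differ by exactly one. -/
theorem SimpleGraph.IsTree.nonempty_rooting {V : Type*} {G : SimpleGraph V} (h : G.IsTree) (r : V) :
    Nonempty (Rooting G r) := by
  classical
  choose p hp hl using fun x => h.connected.exists_path_of_dist r x
  -- If `y` were not on the path to `x`, the path to `y` would be that path extended by an edge,
  -- which contradicts the distances.
  have key : ∀ x y, G.Adj x y → G.dist r x = G.dist r y + 1 → (p x).penultimate = y := by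
    intro x y hxy hd
    refine (h.isAcyclic.eq_penultimate_of_adj_end (hp x) hxy ?_).symm
    by_contra hy
    have h1 := h.isAcyclic.mem_support_of_ne_mem_support_of_adj_of_isPath (hp y) (hp x) hxy.symm hy
    have h2 := congrArg SimpleGraph.Walk.length
      (h.isAcyclic.path_concat (hp x) (hp y) hxy h1)
    rw [SimpleGraph.Walk.length_concat, hl, hl] at h2
    omega
  have hnil : ∀ x, x ≠ r → ¬ (p x).Nil := fun x hx hn => hx hn.eq.symm
  have hadj : ∀ x, x ≠ r → G.Adj x (p x).penultimate := fun x hx =>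
    ((p x).adj_penultimate (hnil x hx)).symm
  refine ⟨⟨fun x => if x = r then r else (p x).penultimate, fun x => G.dist r x, by simp, ?_, ?_,
    ?_⟩⟩
  · intro x hx
    simp only [hx, if_false]
    have h1 : G.dist r (p x).penultimate ≤ (p x).dropLast.length := SimpleGraph.dist_le _
    have h2 := SimpleGraph.Walk.length_dropLast_add_one (hnil x hx)
    rw [hl] at h2
    rcases h.dist_eq_dist_add_one_of_adj r (hadj x hx) with h3 | h3 <;> omega
  · intro x hx
    simpa only [hx, if_false] using hadj x hx
  · intro x y hxy
    rcases h.dist_eq_dist_add_one_of_adj r hxy with h3 | h3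
    · have hx : x ≠ r := by
        rintro rfl
        simp at h3
      exact Or.inl ⟨hx, by simp only [hx, if_false]; exact key x y hxy h3⟩
    · have hy : y ≠ r := by
        rintro rfl
        simp at h3
      exact Or.inr ⟨hy, by simp only [hy, if_false]; exact key y x hxy.symm h3⟩

namespace Rooting

variable {V : Type*} {G : SimpleGraph V} {r : V} (ρ : Rooting G r)

/-- `z` is a descendant of `y`. -/
def Desc (y z : V) : Prop := ∃ k, ρ.par^[k] z = y

theorem desc_refl (y : V) : ρ.Desc y y := ⟨0, rfl⟩

theorem Desc.of_par {y z : V} (h : ρ.Desc y (ρ.par z)) : ρ.Desc y z := by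
  obtain ⟨k, hk⟩ := h
  exact ⟨k + 1, hk⟩

theorem Desc.par_left {y z : V} (h : ρ.Desc y z) : ρ.Desc (ρ.par y) z := by
  obtain ⟨k, rfl⟩ := h
  exact ⟨k + 1, Function.iterate_succ_apply' _ _ _⟩

theorem Desc.dep_le {y z : V} (h : ρ.Desc y z) : ρ.dep y ≤ ρ.dep z := by
  obtain ⟨k, rfl⟩ := h
  induction k generalizing z with
  | zero => exact le_rfl
  | succ k ih =>
    rw [Function.iterate_succ_apply]
    refine ih.trans ?_
    by_cases hz : z = r
    · rw [hz, ρ.par_root]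
    · have := ρ.dep_par z hz
      omega

theorem Desc.eq_or_lt {y z : V} (h : ρ.Desc y z) : z = y ∨ ρ.dep y < ρ.dep z := by
  obtain ⟨k, hk⟩ := h
  cases k with
  | zero => exact Or.inl hk
  | succ k =>
    by_cases hz : z = r
    · subst hz
      have : ∀ j, ρ.par^[j] z = z := fun j => Function.iterate_fixed ρ.par_root j
      rw [this] at hk
      exact Or.inl hk
    · right
      have h1 := Desc.dep_le ρ (y := y) (z := ρ.par z) ⟨k, hk⟩
      have := ρ.dep_par z hz
      omega

theorem not_desc_par {y : V} (hy : y ≠ r) : ¬ ρ.Desc y (ρ.par y) := by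
  intro h
  have h1 := Desc.dep_le ρ h
  have := ρ.dep_par y hy
  omega

/-- The only edge that leaves the set of the descendants of `y` is the edge from `y` to its
parent. -/
theorem eq_of_adj {y a b : V} (h : G.Adj a b) (ha : ρ.Desc y a) (hb : ¬ ρ.Desc y b) :
    a = y ∧ y ≠ r ∧ b = ρ.par y := by
  rcases ρ.par_of_adj a b h with ⟨har, hab⟩ | ⟨hbr, hba⟩
  · obtain ⟨k, hk⟩ := ha
    cases k with
    | zero =>
      obtain rfl : a = y := hk
      exact ⟨rfl, har, hab.symm⟩
    | succ k =>
      rw [Function.iterate_succ_apply, hab] at hk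
      exact absurd ⟨k, hk⟩ hb
  · rw [← hba] at ha
    exact absurd (Desc.of_par ρ ha) hb

/-- A connected set of nodes with nodes inside and outside of the set of descendants of `y`
contains `y` and its parent. -/
theorem mem_of_connected {S : Set V} (hS : (G.induce S).Connected) {y a b : V} (ha : a ∈ S)
    (hb : b ∈ S) (ha' : ρ.Desc y a) (hb' : ¬ ρ.Desc y b) : y ∈ S ∧ y ≠ r ∧ ρ.par y ∈ S := by
  obtain ⟨p⟩ := hS.preconnected ⟨a, ha⟩ ⟨b, hb⟩
  obtain ⟨e, -, h1, h2⟩ := p.exists_boundary_dart {z | ρ.Desc y z} ha' hb'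
  have hadj : G.Adj e.fst e.snd := e.adj
  obtain ⟨h3, h4, h5⟩ := ρ.eq_of_adj hadj h1 h2
  exact ⟨h3 ▸ e.fst.2, h4, h5 ▸ e.snd.2⟩

end Rooting

/-! ### Cliques are contained in bags -/

/-- The Helly property of subtrees. Root the tree and take the vertex `v` of the clique whose
topmost bag is deepest; this bag contains the clique. Any `u` in the clique shares with `v` a bag
below `top v`. If `top u` is below `top v` too, the two nodes coincide by the choice of `v`;
otherwise the subtree of `u` leaves the part below `top v`, and it can do so only through `top v`.
-/
theorem TreeDecomposition.exists_subset_bag {V : Type*} {G : SimpleGraph V}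
    (D : TreeDecomposition G) {C : Finset V} (hC : ∀ u ∈ C, ∀ v ∈ C, u ≠ v → G.Adj u v) :
    ∃ x, C ⊆ D.bag x := by
  classical
  obtain ⟨r⟩ := D.isTree.connected.nonempty
  obtain ⟨ρ⟩ := D.isTree.nonempty_rooting r
  rcases C.eq_empty_or_nonempty with rfl | hne
  · exact ⟨r, by simp⟩
  have hpair : ∀ u ∈ C, ∀ v ∈ C, ∃ x, u ∈ D.bag x ∧ v ∈ D.bag x := by
    intro u hu v hv
    by_cases huv : u = v
    · subst huv
      obtain ⟨x, hx⟩ := D.vertex_covered u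
      exact ⟨x, hx, hx⟩
    · exact D.edge_covered u v (hC u hu v hv huv)
  have htop : ∀ v, ∃ t, v ∈ D.bag t ∧ ∀ z, v ∈ D.bag z → ρ.dep t ≤ ρ.dep z := by
    intro v
    obtain ⟨t, ht, hmin⟩ := Finset.exists_min_image (Finset.univ.filter fun z => v ∈ D.bag z) ρ.dep
      (by obtain ⟨x, hx⟩ := D.vertex_covered v; exact ⟨x, by simpa using hx⟩)
    exact ⟨t, by simpa using ht, fun z hz => hmin z (by simpa using hz)⟩
  choose top htop hmin using htop
  obtain ⟨v, hv, hmax⟩ := Finset.exists_max_image C (fun v => ρ.dep (top v)) hne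
  refine ⟨top v, fun u hu => ?_⟩
  have hdesc : ∀ z, v ∈ D.bag z → ρ.Desc (top v) z := by
    intro z hz
    by_contra hz'
    obtain ⟨-, h2, h3⟩ := ρ.mem_of_connected (D.subtree v) (htop v) hz (ρ.desc_refl _) hz'
    have := hmin v _ h3
    have := ρ.dep_par _ h2
    omega
  obtain ⟨z, hz, hz'⟩ := hpair u hu v hv
  by_cases hd : ρ.Desc (top v) (top u)
  · rcases Rooting.Desc.eq_or_lt ρ hd with h | h
    · rw [← h]; exact htop u
    · have := hmax u hu
      omega
  · exact (ρ.mem_of_connected (D.subtree u) hz (htop u) (hdesc z hz') hd).1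

theorem RectTableau.exists_colSet_subset {n d m : ℕ} (T : RectTableau n d m)
    (D : TreeDecomposition T.columnGraph) (c : Fin (T.shape.rowLen 0)) :
    ∃ x, T.colSet c ⊆ D.bag x := by
  refine D.exists_subset_bag fun u hu v hv huv => ⟨huv, ?_⟩
  obtain ⟨b, -, rfl⟩ := Finset.mem_image.1 hu
  obtain ⟨b', -, rfl⟩ := Finset.mem_image.1 hv
  exact ⟨T.shape.box c b, T.shape.box c b', rfl, rfl, rfl⟩

/-! ### Depth first search -/

section dfs

variable {n d m : ℕ} {T : RectTableau n d m} {D : TreeDecomposition T.columnGraph}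
  {r : Fin D.size} (ρ : Rooting D.tree r)

/-- The columns in the frames of the stack, latest first. -/
def allCols (fr : List (Fin D.size × List (Fin (T.shape.rowLen 0)))) :
    List (Fin (T.shape.rowLen 0)) := (fr.map Prod.snd).flatten

/-- Each frame `(y, L)` of the stack belongs to a child of the node of the next frame, the columns
in `L` are contained in bags below `y`, and those in the next frame in bags of other nodes. -/
def FrameChain : List (Fin D.size × List (Fin (T.shape.rowLen 0))) → Prop
  | [] => True
  | [(y, L)] => y = r ∧ ∀ c ∈ L, ∃ z, ρ.Desc y z ∧ T.colSet c ⊆ D.bag z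
  | (y, L) :: (x, L') :: fr => y ≠ r ∧ ρ.par y = x ∧
      (∀ c ∈ L, ∃ z, ρ.Desc y z ∧ T.colSet c ⊆ D.bag z) ∧
      (∀ c ∈ L', ∃ z, ¬ ρ.Desc y z ∧ T.colSet c ⊆ D.bag z) ∧ FrameChain ((x, L') :: fr)

/-- The invariant of the depth first search with stack `fr` and set `V` of visited nodes. -/
structure SearchInv (fr : List (Fin D.size × List (Fin (T.shape.rowLen 0))))
    (V : Finset (Fin D.size)) : Prop where
  chain : FrameChain ρ fr
  nodup : (allCols fr).Nodup
  mem : ∀ f ∈ fr, f.1 ∈ V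
  par_mem : ∀ z ∈ V, z ≠ r → ρ.par z ∈ V
  -- A visited node that is no longer on the stack is finished: its children are visited, and the
  -- columns inside its bag have been collected.
  closed_par : ∀ z ∈ V, (∀ f ∈ fr, f.1 ≠ z) → ∀ z', z' ≠ r → ρ.par z' = z → z' ∈ V
  closed_col : ∀ z ∈ V, (∀ f ∈ fr, f.1 ≠ z) → ∀ c, T.colSet c ⊆ D.bag z → c ∈ allCols fr
  cols : ∀ c ∈ allCols fr, ∃ z ∈ V, T.colSet c ⊆ D.bag z

theorem FrameChain.desc {y : Fin D.size} {L : List (Fin (T.shape.rowLen 0))}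
    {fr : List (Fin D.size × List (Fin (T.shape.rowLen 0)))} (h : FrameChain ρ ((y, L) :: fr)) :
    ∀ c ∈ L, ∃ z, ρ.Desc y z ∧ T.colSet c ⊆ D.bag z := by
  match fr, h with
  | [], h => exact h.2
  | (x, L') :: fr, h => exact h.2.2.1

theorem FrameChain.congr {y : Fin D.size} {L L' : List (Fin (T.shape.rowLen 0))}
    {fr : List (Fin D.size × List (Fin (T.shape.rowLen 0)))} (h : FrameChain ρ ((y, L) :: fr))
    (hL : ∀ c ∈ L', ∃ z, ρ.Desc y z ∧ T.colSet c ⊆ D.bag z) : FrameChain ρ ((y, L') :: fr) := by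
  match fr, h with
  | [], h => exact ⟨h.1, hL⟩
  | (x, L') :: fr, h => exact ⟨h.1, h.2.1, hL, h.2.2.2⟩

namespace SearchInv

variable {ρ} {fr : List (Fin D.size × List (Fin (T.shape.rowLen 0)))} {V : Finset (Fin D.size)}
  {x y : Fin D.size} {L L' : List (Fin (T.shape.rowLen 0))}

theorem init : SearchInv ρ [(r, [])] {r} where
  chain := ⟨rfl, by simp⟩
  nodup := by simp [allCols]
  mem := by simp
  par_mem := by simp
  closed_par := by simp
  closed_col := by simp
  cols := by simp [allCols]

theorem mem_of_desc (h : SearchInv ρ fr V) {z : Fin D.size} (hz : z ∈ V)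
    (hy : ρ.Desc y z) : y ∈ V := by
  obtain ⟨k, rfl⟩ := hy
  induction k generalizing z with
  | zero => exact hz
  | succ k ih =>
    rw [Function.iterate_succ_apply]
    refine ih ?_
    by_cases hzr : z = r
    · rw [hzr, ρ.par_root, ← hzr]; exact hz
    · exact h.par_mem z hz hzr

/-- An unvisited neighbour of `x` must be a child, because visited nodes have visited parents. For
the same reason nothing below `y` has been visited, so the columns collected so far lie in bags that
are not below `y`. -/
theorem push (h : SearchInv ρ ((x, L) :: fr) V) (hxy : D.tree.Adj x y) (hy : y ∉ V) :
    SearchInv ρ ((y, []) :: (x, L) :: fr) (insert y V) := by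
  have hx : x ∈ V := h.mem (x, L) (by simp)
  have hpar : y ≠ r ∧ ρ.par y = x := by
    rcases ρ.par_of_adj x y hxy with ⟨h1, h2⟩ | h1
    · exact absurd (h2 ▸ h.par_mem x hx h1) hy
    · exact h1
  have hall : allCols ((y, []) :: (x, L) :: fr) = allCols ((x, L) :: fr) := rfl
  refine ⟨⟨hpar.1, hpar.2, by simp, fun c hc => ?_, h.chain⟩, hall ▸ h.nodup, ?_, ?_, ?_, ?_, ?_⟩
  · obtain ⟨z, hz, hcz⟩ := h.cols c (by simp [allCols, hc])
    exact ⟨z, fun hd => hy (h.mem_of_desc hz hd), hcz⟩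
  · intro f hf
    rcases List.mem_cons.1 hf with rfl | hf
    · exact Finset.mem_insert_self _ _
    · exact Finset.mem_insert_of_mem (h.mem f hf)
  · intro z hz hzr
    rcases Finset.mem_insert.1 hz with rfl | hz
    · rw [hpar.2]; exact Finset.mem_insert_of_mem hx
    · exact Finset.mem_insert_of_mem (h.par_mem z hz hzr)
  · intro z hz hz' w hw hwz
    rcases Finset.mem_insert.1 hz with rfl | hz
    · exact absurd rfl (hz' (z, []) (by simp))
    · exact Finset.mem_insert_of_mem
        (h.closed_par z hz (fun f hf => hz' f (List.mem_cons_of_mem _ hf)) w hw hwz)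
  · intro z hz hz' c hc
    rcases Finset.mem_insert.1 hz with rfl | hz
    · exact absurd rfl (hz' (z, []) (by simp))
    · exact h.closed_col z hz (fun f hf => hz' f (List.mem_cons_of_mem _ hf)) c hc
  · intro c hc
    obtain ⟨z, hz, hcz⟩ := h.cols c hc
    exact ⟨z, Finset.mem_insert_of_mem hz, hcz⟩

theorem add_col (h : SearchInv ρ ((x, L) :: fr) V) {c : Fin (T.shape.rowLen 0)}
    (hc : c ∉ allCols ((x, L) :: fr)) (hcx : T.colSet c ⊆ D.bag x) :
    SearchInv ρ ((x, c :: L) :: fr) V := by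
  have hall : allCols ((x, c :: L) :: fr) = c :: allCols ((x, L) :: fr) := rfl
  refine ⟨h.chain.congr ρ ?_, ?_, ?_, h.par_mem, ?_, ?_, ?_⟩
  · intro c' hc'
    rcases List.mem_cons.1 hc' with rfl | hc'
    · exact ⟨x, ρ.desc_refl x, hcx⟩
    · exact h.chain.desc ρ c' hc'
  · rw [hall]; exact List.nodup_cons.2 ⟨hc, h.nodup⟩
  · intro f hf
    rcases List.mem_cons.1 hf with rfl | hf
    · exact h.mem (x, L) (by simp)
    · exact h.mem f (List.mem_cons_of_mem _ hf)
  · intro z hz hz'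
    refine h.closed_par z hz fun f hf => ?_
    rcases List.mem_cons.1 hf with rfl | hf
    · exact hz' (x, c :: L) (by simp)
    · exact hz' f (List.mem_cons_of_mem _ hf)
  · intro z hz hz' c' hc'
    rw [hall]
    refine List.mem_cons_of_mem _ (h.closed_col z hz (fun f hf => ?_) c' hc')
    rcases List.mem_cons.1 hf with rfl | hf
    · exact hz' (x, c :: L) (by simp)
    · exact hz' f (List.mem_cons_of_mem _ hf)
  · intro c' hc'
    rw [hall] at hc'
    rcases List.mem_cons.1 hc' with rfl | hc'
    · exact ⟨x, h.mem (x, L) (by simp), hcx⟩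
    · exact h.cols c' hc'

/-- The child's columns are put on top of those of the parent, so `allCols`, and with it the global
order of the columns, stays the same. The hypotheses `hy` and `hcol` say that `y` may count as
finished. -/
theorem pop (h : SearchInv ρ ((y, L') :: (x, L) :: fr) V) (hy : ∀ z, D.tree.Adj y z → z ∈ V)
    (hcol : ∀ c, T.colSet c ⊆ D.bag y → c ∈ allCols ((y, L') :: (x, L) :: fr)) :
    SearchInv ρ ((x, L' ++ L) :: fr) V := by
  obtain ⟨hyr, hpar, hL', hL, hchain⟩ := h.chain
  have hall : allCols ((x, L' ++ L) :: fr) = allCols ((y, L') :: (x, L) :: fr) := by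
    simp [allCols]
  refine ⟨hchain.congr ρ ?_, hall ▸ h.nodup, ?_, h.par_mem, ?_, ?_, ?_⟩
  · intro c hc
    rcases List.mem_append.1 hc with hc | hc
    · obtain ⟨z, hz, hcz⟩ := hL' c hc
      exact ⟨z, hpar ▸ Rooting.Desc.par_left ρ hz, hcz⟩
    · exact hchain.desc ρ c hc
  · intro f hf
    rcases List.mem_cons.1 hf with rfl | hf
    · exact h.mem (x, L) (by simp)
    · exact h.mem f (by simp [hf])
  · intro z hz hz' w hw hwz
    by_cases hzy : z = y
    · subst hzy
      exact hy w (hwz ▸ (ρ.adj_par w hw).symm)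
    · refine h.closed_par z hz (fun f hf => ?_) w hw hwz
      rcases List.mem_cons.1 hf with rfl | hf
      · exact fun h => hzy h.symm
      · rcases List.mem_cons.1 hf with rfl | hf
        · exact hz' (x, L' ++ L) (by simp)
        · exact hz' f (by simp [hf])
  · intro z hz hz' c hc
    rw [hall]
    by_cases hzy : z = y
    · subst hzy
      exact hcol c hc
    · refine h.closed_col z hz (fun f hf => ?_) c hc
      rcases List.mem_cons.1 hf with rfl | hf
      · exact fun h => hzy h.symm
      · rcases List.mem_cons.1 hf with rfl | hf
        · exact hz' (x, L' ++ L) (by simp)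
        · exact hz' f (by simp [hf])
  · intro c hc
    rw [hall] at hc
    exact h.cols c hc

/-- Provides the hypothesis of `segment_restrict`: a number of a column below `y` that is also in
the bag of the parent has a subtree crossing the edge between the two nodes. -/
theorem mem_bag_of_mem (h : SearchInv ρ ((y, L') :: (x, L) :: fr) V) :
    ∀ c ∈ L', ∀ v ∈ T.colSet c, v ∈ D.bag x → v ∈ D.bag y := by
  obtain ⟨hyr, hpar, hL', -, -⟩ := h.chain
  intro c hc v hv hvx
  obtain ⟨z, hz, hcz⟩ := hL' c hc
  exact (ρ.mem_of_connected (D.subtree v) (hcz hv) hvx hz (hpar ▸ ρ.not_desc_par hyr)).1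

/-- Provides the hypothesis of `segment_append_apply`: a number that occurs in both blocks has bags
on both sides of the tree edge, hence belongs to the bag of the parent. -/
theorem not_mem_or (h : SearchInv ρ ((y, L') :: (x, L) :: fr) V) :
    ∀ v ∉ D.bag x, (∀ c ∈ L, v ∉ T.colSet c) ∨ ∀ c ∈ L', v ∉ T.colSet c := by
  obtain ⟨hyr, hpar, hL', hL, -⟩ := h.chain
  intro v hv
  by_contra hcon
  push Not at hcon
  obtain ⟨⟨c, hc, hvc⟩, c', hc', hvc'⟩ := hcon
  obtain ⟨z, hz, hcz⟩ := hL c hc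
  obtain ⟨z', hz', hcz'⟩ := hL' c' hc'
  have h1 := (ρ.mem_of_connected (D.subtree v) (hcz' hvc') (hcz hvc) hz' hz).2.2
  rw [hpar] at h1
  exact hv h1

/-- When only the root is left and it is finished, the visited set is closed under adjacency, so it
is everything by connectedness. As every column fits into some bag, no column is missing. -/
theorem mem_of_singleton (h : SearchInv ρ [(y, L)] V) (hy : ∀ z, D.tree.Adj y z → z ∈ V)
    (hcol : ∀ c, T.colSet c ⊆ D.bag y → c ∈ L) : L.Nodup ∧ ∀ c, c ∈ L := by
  have hall : allCols [(y, L)] = L := by simp [allCols]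
  refine ⟨hall ▸ h.nodup, fun c => ?_⟩
  obtain ⟨x, hx⟩ := T.exists_colSet_subset D c
  have hr : y = r := h.chain.1
  have hV : ∀ z, z ∈ V := by
    intro z
    by_contra hz
    obtain ⟨p⟩ := D.isTree.connected.preconnected r z
    have hrV : r ∈ V := hr ▸ h.mem (y, L) (by simp)
    obtain ⟨e, -, h1, h2⟩ := p.exists_boundary_dart {z | z ∈ V} hrV hz
    refine h2 ?_
    rcases ρ.par_of_adj _ _ e.adj with ⟨h3, h4⟩ | ⟨h3, h4⟩
    · exact h4 ▸ h.par_mem _ h1 h3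
    · by_cases hey : e.fst = y
      · exact hy _ (hey ▸ e.adj)
      · exact h.closed_par _ h1 (by simpa using fun h => hey h.symm) _ h3 h4
  by_cases hxy : x = y
  · exact hcol c (hxy ▸ hx)
  · exact hall ▸ h.closed_col x (hV x) (by simpa using fun h => hxy h.symm) c hx

end SearchInv

end dfs

/-! ### Loops over pairs of indices, products of matrices in memory -/

/-- Runs `B` for all values of the registers `57` and `58` below the value of register `Kr`. -/
def pairLoop (Kr : ℕ) (B : Program) : Program := .forN 57 Kr 0 (.forN 58 Kr 0 B)

theorem pair_lt_iff {K i j i' j' : ℕ} (hj : j < K) (hj' : j' < K) :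
    i * K + j < i' * K + j' ↔ i < i' ∨ i = i' ∧ j < j' := by
  constructor
  · intro h
    rcases lt_trichotomy i i' with h1 | h1 | h1
    · exact Or.inl h1
    · subst h1
      exact Or.inr ⟨rfl, by omega⟩
    · have : (i' + 1) * K ≤ i * K := Nat.mul_le_mul_right _ h1
      rw [add_mul] at this
      omega
  · rintro (h1 | ⟨rfl, h1⟩)
    · have : (i + 1) * K ≤ i' * K := Nat.mul_le_mul_right _ h1
      rw [add_mul] at this
      omega
    · omega

/-- Besides writing its own entry, the body has to leave all other cells of the array alone. The
cells below `o` survive as well, which allows a stack of matrices in a single array. -/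
theorem pairLoop_run {Kr : ℕ} {B : Program} {s : Memory} {K M T o arr : ℕ} {val : ℕ → ℕ → ℂ}
    (hK : s.nat Kr 0 = K) (hM : K ≤ M) (hM1 : 1 ≤ M) (hT : 1 ≤ T)
    (hB : ∀ i < K, ∀ j < K, ∀ s',
      (∀ a, B.natFree a = true → a ≠ 57 → a ≠ 58 → s'.nat a = s.nat a) →
      (∀ a, B.cpxFree a = true → s'.cpx a = s.cpx a) → s'.nat 57 0 = i → s'.nat 58 0 = j →
      Run B s' T fun s'' => s''.cpx arr (o + (i * K + j)) = val i j ∧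
        ∀ p ≠ o + (i * K + j), s''.cpx arr p = s'.cpx arr p)
    (h57 : B.natFree 57 = true := by rfl) (h58 : B.natFree 58 = true := by rfl)
    (hKr : B.natFree Kr = true := by rfl) (hKr' : Kr ≠ 57 ∧ Kr ≠ 58 := by decide) :
    Run (pairLoop Kr B) s (40000 * (M * (M * T))) fun s' =>
      (∀ i < K, ∀ j < K, s'.cpx arr (o + (i * K + j)) = val i j) ∧
      ∀ p < o, s'.cpx arr p = s.cpx arr p := by
  have key : Run (pairLoop Kr B) s (200 * (M * (200 * (M * T)))) fun s' =>
      (∀ i < K, ∀ j < K, s'.cpx arr (o + (i * K + j)) = val i j) ∧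
      ∀ p < o, s'.cpx arr p = s.cpx arr p := by
    refine Run.forN (fun k s' => (∀ i < k, ∀ j < K, s'.cpx arr (o + (i * K + j)) = val i j) ∧
      ∀ p < o, s'.cpx arr p = s.cpx arr p) (by rw [hK]; exact hM) hM1
      (Nat.mul_pos (by norm_num) (Nat.mul_pos hM1 hT)) (by simp) ?_ ?_ ?_ ?_
    · rintro i hi s1 hf1 hi1 ⟨hinv, hlow⟩
      rw [hK] at hi
      have e1 : s1.nat Kr = s.nat Kr := hf1.nat _ (by
        simp [Program.forN, natFree, hKr, hKr'.1, hKr'.2])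
      refine Run.forN (fun k s' => (∀ i' j', j' < K → (i' < i ∨ i' = i ∧ j' < k) →
        s'.cpx arr (o + (i' * K + j')) = val i' j') ∧ ∀ p < o, s'.cpx arr p = s.cpx arr p)
        (by rw [e1, hK]; exact hM) hM1 hT ?_ ?_ ?_ ?_ ?_
      · refine ⟨fun i' j' hj' h => ?_, hlow⟩
        rcases h with h | ⟨-, h⟩
        · exact hinv i' h j' hj'
        · omega
      · rintro j hj s2 hf2 hj2 ⟨hinv, hlow⟩
        rw [e1, hK] at hj
        refine (hB i hi j hj s2 ?_ ?_ ?_ hj2).mono le_rfl ?_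
        · intro a ha h1 h2
          rw [hf2.nat a (by simp [Program.forN, natFree, ha, h2]),
            hf1.nat a (by simp [Program.forN, natFree, ha, h1, h2])]
        · intro a ha
          rw [hf2.cpx a (by simp [Program.forN, cpxFree, ha]),
            hf1.cpx a (by simp [Program.forN, cpxFree, ha])]
        · rw [hf2.nat 57 (by simp [Program.forN, natFree, h57]), hi1]
        · rintro s3 - ⟨h3, h3'⟩
          refine ⟨fun i' j' hj' h => ?_, fun p hp => ?_⟩
          · by_cases hij : i' = i ∧ j' = j
            · rw [hij.1, hij.2]; exact h3
            · have hlt : i' < i ∨ i' = i ∧ j' < j := by omega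
              have := (pair_lt_iff hj' hj).2 hlt
              rw [Memory.setNat_cpx, h3' _ (by omega)]
              exact hinv i' j' hj' hlt
          · rw [Memory.setNat_cpx, h3' _ (by omega), hlow p hp]
      · rintro s2 - ⟨hinv, hlow⟩
        rw [e1, hK] at hinv
        refine ⟨fun i' hi' j hj => hinv i' j hj (by omega), hlow⟩
      · exact h58
      · simp [Program.forN, natFree, hKr, hKr'.2]
    · rintro s1 - h
      rw [hK] at h
      exact h
    · simp [Program.forN, natFree, h57]
    · simp [Program.forN, natFree, hKr, hKr'.1, hKr'.2]
  exact key.mono_time (le_of_eq (by ring))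

/-- The program `mm` multiplies matrices with at most `K` rows in time `TM`. -/
def MatMulBound (mm : Program) (K TM : ℕ) : Prop :=
  ∀ (k : ℕ), 1 ≤ k → k ≤ K → ∀ (X Y : Matrix (Fin k) (Fin k) ℂ) (s : Memory),
    s.nat 0 0 = k →
    (∀ i j : Fin k, s.cpx 0 (i * k + j) = X i j) →
    (∀ i j : Fin k, s.cpx 1 (i * k + j) = Y i j) →
    ∃ (s' : Memory) (t : ℕ), Runs mm s s' t ∧ t ≤ TM ∧
      ∀ i j : Fin k, s'.cpx 2 (i * k + j) = (X * Y) i j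

/-- Copies a block of an array. -/
def copyCpx (dst src : ℕ) (i j : NatExpr) (len : ℕ) : Program :=
  .forN 20 len 0 (.setCpx dst i (.cell src j))

/-- Multiplies the matrix in the complex array `2`, from the cell in register `o` on, by the matrix
in the complex array `101`.  The number of rows is in register `Kr`, its square in register `Ks`. -/
def mulProgram (mm : Program) (o Kr Ks : ℕ) : Program :=
  .seq (copyCpx 100 2 (.reg 20) (.add (.reg o) (.reg 20)) Ks)
    (.seq (.setNat 100 (.const 0) (.reg Kr))
      (.seq (mm.shift 100) (copyCpx 2 102 (.add (.reg o) (.reg 20)) (.reg 20) Ks)))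

theorem mulProgram_natFree (mm : Program) {o Kr Ks a : ℕ} (ha : a < 100) (ha' : a ≠ 20) :
    (mulProgram mm o Kr Ks).natFree a = true := by
  simp [mulProgram, copyCpx, Program.forN, natFree, natFree_shift ha, ha', ha.ne]

/-- The relocated `mm` finds the number of rows in natural array `100`, the factors in complex
arrays `100` and `101`, and leaves the product in `102`; its other cells may contain anything. Among
the natural arrays below `100` only the counter `20` is lost. -/
theorem mulProgram_run {mm : Program} {M TM : ℕ} (hmm : MatMulBound mm M TM) {o Kr Ks : ℕ}
    {s : Memory} {K b : ℕ} {X Y : ℕ → ℕ → ℂ} (hK : s.nat Kr 0 = K) (hKs : s.nat Ks 0 = K * K)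
    (hb : s.nat o 0 = b) (hK1 : 1 ≤ K) (hKM : K ≤ M)
    (hX : ∀ i < K, ∀ j < K, s.cpx 2 (b + (i * K + j)) = X i j)
    (hY : ∀ i < K, ∀ j < K, s.cpx 101 (0 + (i * K + j)) = Y i j)
    (ho : o < 100 ∧ o ≠ 20 := by decide) (hKr : Kr < 100 ∧ Kr ≠ 20 := by decide)
    (hKs' : Ks < 100 ∧ Ks ≠ 20 := by decide) :
    Run (mulProgram mm o Kr Ks) s (20000 * (M * M) + TM) fun s' =>
      (∀ i < K, ∀ j < K, s'.cpx 2 (b + (i * K + j)) = ∑ t ∈ Finset.range K, X i t * Y t j) ∧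
      ∀ p < b, s'.cpx 2 p = s.cpx 2 p := by
  have hKK : K * K ≤ M * M := Nat.mul_le_mul hKM hKM
  have hM1 : 1 ≤ M * M := le_trans (Nat.mul_pos hK1 hK1) hKK
  have key : Run (mulProgram mm o Kr Ks) s
      (200 * ((M * M) * 30) + (30 + (TM + 200 * ((M * M) * 30)))) fun s' =>
      (∀ i < K, ∀ j < K, s'.cpx 2 (b + (i * K + j)) = ∑ t ∈ Finset.range K, X i t * Y t j) ∧
      ∀ p < b, s'.cpx 2 p = s.cpx 2 p := by
    refine Run.seq (R := fun s1 => ∀ p < K * K, s1.cpx 100 p = s.cpx 2 (b + p)) ?_ ?_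
    · refine Run.forN (fun k s1 => ∀ p < k, s1.cpx 100 p = s.cpx 2 (b + p)) (by rw [hKs]; exact hKK)
        hM1 (by norm_num) (by simp) ?_ ?_ ?_ ?_
      · intro k hk s1 hf1 hk1 hinv
        refine Run.setCpx ?_
        have e1 : s1.nat o = s.nat o := hf1.nat _ (by simp [Program.forN, natFree, ho.2])
        have e2 : s1.cpx 2 = s.cpx 2 := hf1.cpx 2 rfl
        intro p hp
        simp only [NatExpr.val, NatExpr.val_reg, CpxExpr.val, hk1, e1, e2, hb, Memory.setNat_cpx,
          Memory.setCpx_cpx_apply, true_and]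
        by_cases hpk : p = k
        · rw [if_pos hpk, hpk]
        · rw [if_neg hpk]
          exact hinv p (by omega)
      · intro s1 _ h
        rw [hKs] at h
        exact h
      · rfl
      · simp [Program.forN, natFree, hKs'.2]
    · intro s1 hf1 h1
      have e1 : ∀ a, a ≠ 20 → s1.nat a = s.nat a := fun a ha => hf1.nat a (by
        simp [copyCpx, Program.forN, natFree, ha])
      have e2 : ∀ a, a ≠ 100 → s1.cpx a = s.cpx a := fun a ha => hf1.cpx a (by
        simp [copyCpx, Program.forN, cpxFree, ha])
      refine Run.setNat_seq ?_
      simp only [NatExpr.val, NatExpr.val_reg, e1 _ hKr.2, hK]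
      set s2 := s1.setNat 100 0 K with hs2
      have e3 : ∀ a < 100, a ≠ 20 → s2.nat a = s.nat a := fun a ha ha' => by
        rw [hs2, Memory.setNat_nat_ne _ _ _ (by omega), e1 a ha']
      have e4 : s2.cpx = s1.cpx := rfl
      refine Run.seq (R := fun s3 => ∀ i < K, ∀ j < K, s3.cpx 102 (i * K + j) =
        ∑ t ∈ Finset.range K, X i t * Y t j) ?_ ?_
      · obtain ⟨u, t, hr, ht, hu⟩ := hmm K hK1 hKM (Matrix.of fun i j => X i j)
          (Matrix.of fun i j => Y i j) (s2.drop 100) (by simp [Memory.drop, hs2]) (by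
            intro i j
            have hlt : (i : ℕ) * K + j < K * K := by
              have := (pair_lt_iff (i' := K) j.2 hK1).2 (Or.inl i.2)
              simpa using this
            rw [Matrix.of_apply, ← hX i i.2 j j.2, ← h1 _ hlt]
            rfl) (by
            intro i j
            rw [Matrix.of_apply, ← hY i i.2 j j.2, zero_add, ← e2 101 (by decide)]
            rfl)
        obtain ⟨s3, hr3, hs3⟩ := hr.shift s2 rfl
        refine ⟨s3, t, hr3, ht, fun i hi j hj => ?_⟩
        have := hu ⟨i, hi⟩ ⟨j, hj⟩
        rw [← hs3] at this
        refine Eq.trans this ?_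
        rw [Matrix.mul_apply, Finset.sum_range]
        rfl
      · intro s3 hf3 h3
        have e5 : ∀ a < 100, a ≠ 20 → s3.nat a = s.nat a := fun a ha ha' => by
          rw [hf3.nat a (natFree_shift ha _), e3 a ha ha']
        have e6 : s3.cpx 2 = s.cpx 2 := by
          rw [hf3.cpx 2 (cpxFree_shift (by norm_num) _), e4, e2 2 (by decide)]
        refine Run.forN (fun k s' => (∀ p < k, s'.cpx 2 (b + p) = s3.cpx 102 p) ∧
          ∀ p < b, s'.cpx 2 p = s.cpx 2 p) (by rw [e5 _ hKs'.1 hKs'.2, hKs]; exact hKK)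
          hM1 (by norm_num) ?_ ?_ ?_ ?_ ?_
        · refine ⟨by simp, fun p _ => ?_⟩
          rw [Memory.setNat_cpx, e6]
        · rintro k hk s4 hf4 hk4 ⟨hinv, hinv'⟩
          refine Run.setCpx ?_
          have e7 : s4.nat o = s.nat o := by
            rw [hf4.nat _ (by simp [Program.forN, natFree, ho.2]), e5 _ ho.1 ho.2]
          have e8 : s4.cpx 102 = s3.cpx 102 := hf4.cpx 102 rfl
          refine ⟨fun p hp => ?_, fun p hp => ?_⟩ <;>
          simp only [NatExpr.val, NatExpr.val_reg, CpxExpr.val, hk4, e7, e8, hb, Memory.setNat_cpx,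
            Memory.setCpx_cpx_apply, true_and]
          · by_cases hpk : p = k
            · rw [if_pos (by omega), hpk]
            · rw [if_neg (by omega)]
              exact hinv p (by omega)
          · rw [if_neg (by omega)]
            exact hinv' p hp
        · rintro s4 - ⟨h4, h4'⟩
          rw [e5 _ hKs'.1 hKs'.2, hKs] at h4
          refine ⟨fun i hi j hj => ?_, h4'⟩
          have hlt : i * K + j < K * K := by
            have := (pair_lt_iff (i' := K) hj hK1).2 (Or.inl hi)
            simpa using this
          rw [h4 _ hlt, h3 i hi j hj]
        · rfl
        · simp [Program.forN, natFree, hKs'.2]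
  exact key.mono_time (by omega)

/-! ### Numbers of states -/

section states

variable {n d m : ℕ} (A : NcABP d m) (B C : Finset (Fin n))

/-- The number `v` is the number of an element of `B`. -/
def InBag (v : ℕ) : Prop := ∃ h : v < n, (⟨v, h⟩ : Fin n) ∈ B

/-- The place values for the states that are supported in `B`. -/
noncomputable def bagPlace : ℕ → ℕ := placeValue (InBag B) A.width

/-- The number of states that are supported in `B`. -/
noncomputable def bagDim : ℕ := bagPlace A B n

/-- The state number `i`. -/
noncomputable def bagState (i : ℕ) : Fin n → Fin A.width :=
  fun v => ⟨digit (bagPlace A B) v i, digit_placeValue_lt A.width_pos _ _⟩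

theorem placeValues_bagPlace : PlaceValues (bagPlace A B) := placeValues_placeValue _ A.width_pos

theorem bagDim_pos : 0 < bagDim A B := (placeValues_bagPlace A B).pos n

theorem bagDim_eq_pow : bagDim A B = A.width ^ B.card := by
  classical
  rw [bagDim, bagPlace, placeValue_eq_pow]
  congr 1
  have : (Finset.range n).filter (InBag B) = B.map Fin.valEmbedding := by
    ext v
    simp only [InBag, Finset.mem_filter, Finset.mem_range, Finset.mem_map, Fin.valEmbedding_apply]
    constructor
    · rintro ⟨-, h, hv⟩
      exact ⟨_, hv, rfl⟩
    · rintro ⟨v, hv, rfl⟩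
      exact ⟨v.2, v.2, hv⟩
  rw [this, Finset.card_map]

variable {B}

theorem inBag_iff (v : Fin n) : InBag B v ↔ v ∈ B := ⟨fun ⟨_, h⟩ => h, fun h => ⟨v.2, h⟩⟩

theorem bagPlace_div (v : ℕ) [Decidable (InBag B v)] :
    bagPlace A B (v + 1) / bagPlace A B v = if InBag B v then A.width else 1 := by
  have hpos := (placeValues_bagPlace A B).pos v
  rw [bagPlace] at hpos ⊢
  rw [placeValue]
  split_ifs
  · exact Nat.mul_div_cancel_left _ hpos
  · exact Nat.div_self hpos

theorem supportedIn_bagState (i : ℕ) : RectTableau.SupportedIn A B (bagState A B i) := by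
  intro v hv
  exact digit_placeValue_of_not A.width_pos (by rwa [inBag_iff]) i

/-- The weighted digit sum that turns numbers of states supported in `B` into numbers of states
supported in `C`. -/
theorem bagState_code [DecidablePred (InBag C)] (i : ℕ) :
    (∑ v ∈ Finset.range n, digit (bagPlace A B) v i * if InBag C v then bagPlace A C v else 0) <
      bagDim A C ∧
    bagState A C (∑ v ∈ Finset.range n, digit (bagPlace A B) v i *
      if InBag C v then bagPlace A C v else 0) =
      RectTableau.restrict A C (bagState A B i) := by
  have hσ : ∀ v < n, (if InBag C v then digit (bagPlace A B) v i else 0) <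
      bagPlace A C (v + 1) / bagPlace A C v := by
    intro v _
    rw [bagPlace_div]
    split_ifs
    · exact digit_placeValue_lt A.width_pos _ _
    · exact Nat.one_pos
  have e : ∀ v, digit (bagPlace A B) v i * (if InBag C v then bagPlace A C v else 0) =
      (if InBag C v then digit (bagPlace A B) v i else 0) * bagPlace A C v := by
    intro v
    split_ifs <;> simp
  simp only [e]
  refine ⟨(placeValues_bagPlace A C).sum_lt hσ, ?_⟩
  funext v
  refine Fin.ext ?_
  have := (placeValues_bagPlace A C).digit_sum hσ v.2
  simp only [bagState, RectTableau.restrict]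
  rw [this]
  simp only [inBag_iff]
  split_ifs <;> rfl

theorem exists_bagState_eq {τ : Fin n → Fin A.width} (hτ : RectTableau.SupportedIn A B τ) :
    ∃ i < bagDim A B, bagState A B i = τ := by
  classical
  have hσ : ∀ v < n, (if h : v < n then (τ ⟨v, h⟩ : ℕ) else 0) <
      bagPlace A B (v + 1) / bagPlace A B v := by
    intro v hv
    rw [bagPlace_div, dif_pos hv]
    split_ifs with h
    · exact Fin.is_lt _
    · rw [hτ ⟨v, hv⟩ fun h' => h ⟨hv, h'⟩]
      exact Nat.one_pos
  refine ⟨_, (placeValues_bagPlace A B).sum_lt hσ, ?_⟩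
  funext v
  refine Fin.ext ?_
  simp only [bagState]
  rw [(placeValues_bagPlace A B).digit_sum hσ v.2, dif_pos v.2]

theorem bagState_injOn {i j : ℕ} (hi : i < bagDim A B) (hj : j < bagDim A B)
    (h : bagState A B i = bagState A B j) : i = j := by
  have h1 := (placeValues_bagPlace A B).sum_digit n i
  have h2 := (placeValues_bagPlace A B).sum_digit n j
  rw [Nat.mod_eq_of_lt (show i < bagPlace A B n from hi)] at h1
  rw [Nat.mod_eq_of_lt (show j < bagPlace A B n from hj)] at h2
  rw [← h1, ← h2]
  refine Finset.sum_congr rfl fun v hv => ?_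
  have := congrArg Fin.val (congrFun h ⟨v, Finset.mem_range.1 hv⟩)
  simp only [bagState] at this
  rw [this]

theorem bagState_zero : bagState A B 0 = A.zeroState n := by
  funext v
  refine Fin.ext ?_
  simp [bagState, digit, NcABP.zeroState]

/-- Translates the sum over states in `segment_append_apply` into the sum over indices that a
multiplication of matrices in memory performs. -/
theorem sum_bagState (F : (Fin n → Fin A.width) → ℂ)
    [DecidablePred fun τ : Fin n → Fin A.width => RectTableau.SupportedIn A B τ] :
    ∑ τ : Fin n → Fin A.width with RectTableau.SupportedIn A B τ, F τ =
      ∑ i ∈ Finset.range (bagDim A B), F (bagState A B i) := by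
  symm
  refine Finset.sum_bij (fun i _ => bagState A B i) ?_ ?_ ?_ ?_
  · intro i _
    simpa using supportedIn_bagState A i
  · intro i hi j hj h
    exact bagState_injOn A (Finset.mem_range.1 hi) (Finset.mem_range.1 hj) h
  · intro τ hτ
    obtain ⟨i, hi, h⟩ := exists_bagState_eq A (B := B) (τ := τ) (by simpa using hτ)
    exact ⟨i, Finset.mem_range.2 hi, h⟩
  · intro _ _
    rfl

end states

/-! ### Tables of the nodes of the tree -/

section tables

variable {n d m : ℕ} {T : RectTableau n d m} {A : NcABP d m} {D : TreeDecomposition T.columnGraph}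

/-- The memory holds the input and tables of multiples. -/
structure Setup (T : RectTableau n d m) (A : NcABP d m) (D : TreeDecomposition T.columnGraph)
    (s : Memory) : Prop where
  input : HoldsInput T A D s
  row : ∀ a < m, s.nat 6 a = a * m
  target : ∀ v < A.width, s.nat 7 v = v * m
  source : ∀ u < A.width, s.nat 8 u = u * (A.width * m)
  layer : ∀ l < d, s.nat 9 l = l * (A.width * (A.width * m))
  bagRow : ∀ x < D.size, s.nat 10 x = x * n
  treeRow : ∀ x < D.size, s.nat 11 x = x * D.size
  column : ∀ c < T.shape.rowLen 0, s.nat 12 c = c * m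

theorem HoldsInput.congr {s s' : Memory} (h : HoldsInput T A D s)
    (hn : ∀ a < 6, s'.nat a = s.nat a) (hc : s'.cpx 0 = s.cpx 0) : HoldsInput T A D s' := by
  obtain ⟨h0, h1, h2, h3, h4, h5, h6, h7, h8, h9, h10, h11⟩ := h
  constructor <;> (try rw [hn _ (by norm_num)]) <;> (try rw [hc]) <;> assumption

theorem Setup.congr {s s' : Memory} (h : Setup T A D s) (hn : ∀ a < 20, s'.nat a = s.nat a)
    (hc : s'.cpx 0 = s.cpx 0) : Setup T A D s' := by
  obtain ⟨h0, h1, h2, h3, h4, h5, h6, h7⟩ := h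
  refine ⟨h0.congr (fun a ha => hn a (by omega)) hc, ?_, ?_, ?_, ?_, ?_, ?_, ?_⟩ <;>
    (rw [hn _ (by norm_num)]; assumption)

/-- The program changes none of the arrays that are described by `Setup`. -/
def Program.KeepsSetup (P : Program) : Prop := (∀ a < 20, P.natFree a = true) ∧ P.cpxFree 0 = true

theorem Setup.frame {s s' : Memory} {P : Program} (h : Setup T A D s) (hf : P.Frame s s')
    (hP : P.KeepsSetup) : Setup T A D s' :=
  h.congr (fun a ha => hf.nat a (hP.1 a ha)) (hf.cpx 0 hP.2)

/-- Bounds for the sizes of the input. -/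
structure SizeBound (T : RectTableau n d m) (A : NcABP d m) (D : TreeDecomposition T.columnGraph)
    (R K : ℕ) : Prop where
  n_le : n ≤ R
  d_le : d ≤ R
  m_le : m ≤ R
  size_le : D.size ≤ R
  cols_le : T.shape.rowLen 0 ≤ R
  one_le : 1 ≤ R
  width_le : A.width ≤ K
  dim_le : ∀ x, bagDim A (D.bag x) ≤ K

theorem SizeBound.one_le_K {R K : ℕ} (h : SizeBound T A D R K) : 1 ≤ K :=
  A.width_pos.trans_le h.width_le

theorem placeValue_congr {B B' : ℕ → Prop} {w n : ℕ} (h : ∀ v < n, B v ↔ B' v) {v : ℕ}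
    (hv : v ≤ n) : placeValue B w v = placeValue B' w v := by
  induction v with
  | zero => rfl
  | succ v ih =>
    rw [placeValue, placeValue, ih (by omega)]
    by_cases hB : B v
    · rw [if_pos hB, if_pos ((h v hv).1 hB)]
    · rw [if_neg hB, if_neg fun h' => hB ((h v hv).2 h')]

theorem HoldsInput.bag_eq_one_iff {s : Memory} (h : HoldsInput T A D s) (x : Fin D.size)
    (v : Fin n) : s.nat 5 (x * n + v) = 1 ↔ v ∈ D.bag x := by
  rw [h.bag_eq]
  split_ifs with hv <;> simp [hv]

/-- Computes the place values and the number of states of a node. -/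
def loadNode (u fb P Kr Rw Ks : ℕ) : Program :=
  .seq (.setNat fb (.const 0) (.cell 10 (.reg u)))
    (.seq (placeTable P fb)
      (.seq (.setNat Kr (.const 0) (.cell P (.cell 0 (.const 0)))) (mulTable Rw Ks Kr 0 Kr 0)))

/-- The arrays hold the data of node `x`. -/
structure NodeData (A : NcABP d m) (D : TreeDecomposition T.columnGraph) (x : Fin D.size)
    (fb P Kr Rw Ks : ℕ) (s : Memory) : Prop where
  base : s.nat fb 0 = x * n
  place : ∀ v ≤ n, s.nat P v = bagPlace A (D.bag x) v
  dim : s.nat Kr 0 = bagDim A (D.bag x)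
  row : ∀ i < bagDim A (D.bag x), s.nat Rw i = i * bagDim A (D.bag x)
  sq : s.nat Ks 0 = bagDim A (D.bag x) * bagDim A (D.bag x)

theorem NodeData.congr {x : Fin D.size} {fb P Kr Rw Ks : ℕ} {s s' : Memory}
    (h : NodeData A D x fb P Kr Rw Ks s) (h1 : s'.nat fb = s.nat fb) (h2 : s'.nat P = s.nat P)
    (h3 : s'.nat Kr = s.nat Kr) (h4 : s'.nat Rw = s.nat Rw) (h5 : s'.nat Ks = s.nat Ks) :
    NodeData A D x fb P Kr Rw Ks s' := by
  obtain ⟨g1, g2, g3, g4, g5⟩ := h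
  constructor <;> simpa only [h1, h2, h3, h4, h5]

theorem loadNode_run {R K : ℕ} (hb : SizeBound T A D R K) {u fb P Kr Rw Ks : ℕ} {s : Memory}
    (hs : Setup T A D s) (x : Fin D.size) (hx : s.nat u 0 = x)
    (h : 22 < P ∧ P < Rw ∧ Rw < fb ∧ fb < Kr ∧ Kr < Ks := by decide) :
    Run (loadNode u fb P Kr Rw Ks) s (3000000 * (R * K)) (NodeData A D x fb P Kr Rw Ks) := by
  have hR1 := hb.one_le
  have hK1 := hb.one_le_K
  have key : Run (loadNode u fb P Kr Rw Ks) s (30 + (2000000 * (R * K) + (30 + 13000 * K)))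
      (NodeData A D x fb P Kr Rw Ks) := by
    refine Run.setNat_seq ?_
    simp only [NatExpr.val, NatExpr.val_reg, hx, hs.bagRow x x.2]
    obtain ⟨s1, hs1⟩ : ∃ s1, s1 = s.setNat fb 0 (x * n) := ⟨_, rfl⟩
    rw [← hs1]
    have e1 : ∀ a, a ≠ fb → s1.nat a = s.nat a := fun a ha => by
      rw [hs1, Memory.setNat_nat_ne _ _ _ ha]
    have e2 : s1.nat fb 0 = x * n := by rw [hs1]; simp
    have e3 : s1.nat 0 0 = n := by rw [e1 _ (by omega), hs.input.n_eq]
    have e4 : s1.nat 0 5 = A.width := by rw [e1 _ (by omega), hs.input.width_eq]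
    refine (placeTable_run (s := s1) (by rw [e3]; exact hb.n_le) hR1
      (by rw [e4]; exact hb.width_le) hK1 (by simp; omega) (by simp; omega)).seq ?_
    intro s2 hf2 h2
    have hfree : ∀ a, a ∉ [20, 21, 22, P] → s2.nat a = s1.nat a := fun a ha => hf2.nat a (by
      simp only [List.mem_cons, not_or] at ha
      simp [placeTable, Program.forN, natFree, ha.1, ha.2.1, ha.2.2.1, ha.2.2.2.1])
    have h2' : ∀ v ≤ n, s2.nat P v = bagPlace A (D.bag x) v := by
      intro v hv
      rw [h2 v (by omega), e2, e4, bagPlace, e1 5 (by omega)]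
      refine placeValue_congr (fun u hu => ?_) hv
      rw [hs.input.bag_eq_one_iff x ⟨u, hu⟩]
      exact (inBag_iff ⟨u, hu⟩).symm
    have e5 : s2.nat 0 0 = n := by rw [hfree 0 (by simp; omega), e3]
    refine Run.setNat_seq ?_
    simp only [NatExpr.val, e5, h2' n le_rfl]
    obtain ⟨s3, hs3⟩ : ∃ s3, s3 = s2.setNat Kr 0 (bagPlace A (D.bag x) n) := ⟨_, rfl⟩
    rw [← hs3]
    have e6 : ∀ a, a ≠ Kr → s3.nat a = s2.nat a := fun a ha => by
      rw [hs3, Memory.setNat_nat_ne _ _ _ ha]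
    have e7 : s3.nat Kr 0 = bagDim A (D.bag x) := by rw [hs3]; simp [bagDim]
    refine (mulTable_run (s := s3) (M := K) (by rw [e7]; exact hb.dim_le x) hK1
      (by simp; omega) (by simp; omega) (by simp; omega)).mono le_rfl ?_
    intro s4 hf4 h4
    rw [e7] at h4
    have hfree' : ∀ a, a ∉ [20, Rw, Ks] → s4.nat a = s3.nat a := fun a ha => hf4.nat a (by
      simp only [List.mem_cons, not_or] at ha
      simp [mulTable, Program.forN, natFree, ha.1, ha.2.1, ha.2.2.1])
    refine ⟨?_, ?_, ?_, h4.1, h4.2⟩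
    · rw [hfree' fb (by simp; omega), e6 _ (by omega), hfree fb (by simp; omega), e2]
    · intro v hv
      rw [hfree' P (by simp; omega), e6 _ (by omega), h2' v hv]
    · rw [hfree' Kr (by simp; omega), e7]
  refine key.mono_time ?_
  have : K ≤ R * K := Nat.le_mul_of_pos_left _ hR1
  omega

/-- Chooses weights according to the flags in array `43`. -/
def flagWeights (e e' : NatExpr) : Program :=
  .forN 61 0 0 (.branch (.natEq (.cell 43 (.reg 61)) (.const 0))
    (.setNat 38 (.reg 61) e) (.setNat 38 (.reg 61) e'))

theorem flagWeights_run {e e' : NatExpr} {f f' : ℕ → ℕ} {s : Memory} {R : ℕ}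
    (hR : s.nat 0 0 ≤ R) (hR1 : 1 ≤ R)
    (he : ∀ v < s.nat 0 0, ∀ s', (∀ a, a ≠ 38 → a ≠ 61 → s'.nat a = s.nat a) → s'.nat 61 0 = v →
      e.val s' = f v ∧ e'.val s' = f' v)
    (hc : Nat.ble e.cost 20 = true := by rfl) (hc' : Nat.ble e'.cost 20 = true := by rfl) :
    Run (flagWeights e e') s (12000 * R) fun s' => ∀ v < s.nat 0 0,
      s'.nat 38 v = if s.nat 43 v = 0 then f v else f' v := by
  have hc := Nat.le_of_ble_eq_true hc
  have hc' := Nat.le_of_ble_eq_true hc'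
  have key : Run (flagWeights e e') s (200 * (R * (30 + 30))) fun s' => ∀ v < s.nat 0 0,
      s'.nat 38 v = if s.nat 43 v = 0 then f v else f' v := by
    refine Run.forN (fun k s' => ∀ v < k, s'.nat 38 v = if s.nat 43 v = 0 then f v else f' v)
      hR hR1 (by norm_num) (by simp) ?_ (fun _ _ h => h) (by rfl) (by rfl)
    intro k hk s' hf hk' hinv
    have e1 : ∀ a, a ≠ 38 → a ≠ 61 → s'.nat a = s.nat a := fun a h1 h2 => hf.nat a (by
      simp [Program.forN, natFree, h1, h2])
    obtain ⟨he1, he2⟩ := he k hk s' e1 hk'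
    have hset : ∀ (e : NatExpr) (g : ℕ), e.val s' = g →
        (g = if s.nat 43 k = 0 then f k else f' k) →
        ∀ v < k + 1, ((s'.setNat 38 ((NatExpr.reg 61).val s') (e.val s')).setNat 61 0 (k + 1)).nat
          38 v = if s.nat 43 v = 0 then f v else f' v := by
      intro e g hg hg' v hv
      rw [Memory.setNat_nat_ne _ _ _ (by decide), Memory.setNat_nat_apply, NatExpr.val_reg, hk', hg]
      by_cases hvk : v = k
      · subst hvk; simp [hg']
      · simp [hvk, hinv v (by omega)]
    have hcell : (NatExpr.cell 43 (.reg 61)).val s' = s.nat 43 k := by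
      simp [NatExpr.val, hk', e1 43 (by decide) (by decide)]
    have hreg : (NatExpr.reg 61).cost = 2 := rfl
    refine Run.branch ?_ ?_
    · intro h0
      have h0 : s.nat 43 k = 0 := by rw [← hcell]; exact h0
      exact Run.setNat (hset e _ he1 (by rw [if_pos h0])) (Nat.ble_eq_true_of_le (by omega))
    · intro h0
      have h0 : s.nat 43 k ≠ 0 := by rw [← hcell]; exact h0
      exact Run.setNat (hset e' _ he2 (by rw [if_neg h0])) (Nat.ble_eq_true_of_le (by omega))
  exact key.mono_time (by omega)

/-- The flags in array `43` describe the set `C`. -/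
def HoldsFlags (C : Finset (Fin n)) (s : Memory) : Prop :=
  ∀ v : Fin n, s.nat 43 v = if v ∈ C then 1 else 0

/-- Computes numbers of the restrictions of the states to the complement of the flagged set. -/
def maskTable (P : ℕ) : Program :=
  .seq (flagWeights (.cell P (.reg 61)) (.const 0))
    (.seq (.setNat 27 (.const 0) (.const 0)) (weightTable P 38 39 27))

/-- The weights are the place values outside of the flagged set and 0 inside, so `sum_digit_eq`
applies. Afterwards a single comparison per pair of states suffices. -/
theorem maskTable_run {R K : ℕ} {P : ℕ} {s : Memory} {B C : Finset (Fin n)} (hn : s.nat 0 0 = n)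
    (hR : n ≤ R) (hR1 : 1 ≤ R) (hK : bagDim A B ≤ K) (hC : HoldsFlags C s)
    (hP : ∀ v ≤ n, s.nat P v = bagPlace A B v)
    (h : 27 < P ∧ P < 38 := by decide) :
    Run (maskTable P) s (3000000 * (R * K)) fun s' => ∀ i < bagDim A B, ∀ j < bagDim A B,
      s'.nat 39 i = s'.nat 39 j ↔ ∀ v ∉ C, bagState A B i v = bagState A B j v := by
  classical
  have hK1 : 1 ≤ K := (bagDim_pos A B).trans_le hK
  have key : Run (maskTable P) s (12000 * R + (30 + 2000000 * (R * K))) fun s' =>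
      ∀ i < bagDim A B, ∀ j < bagDim A B,
      s'.nat 39 i = s'.nat 39 j ↔ ∀ v ∉ C, bagState A B i v = bagState A B j v := by
    refine (flagWeights_run (s := s) (f := bagPlace A B) (f' := fun _ => 0) (by rw [hn]; exact hR)
      hR1 ?_).seq ?_
    · intro v hv s' hs' hv'
      rw [hn] at hv
      simp only [NatExpr.val, NatExpr.val_reg, hv', and_true]
      rw [hs' P (by omega) (by omega), hP v hv.le]
    · intro s1 hf1 h1
      have e1 : ∀ a, a ≠ 38 → a ≠ 61 → s1.nat a = s.nat a := fun a ha ha' => hf1.nat a (by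
        simp [flagWeights, Program.forN, natFree, ha, ha'])
      refine Run.setNat_seq ?_
      simp only [NatExpr.val]
      obtain ⟨s2, hs2⟩ : ∃ s2, s2 = s1.setNat 27 0 0 := ⟨_, rfl⟩
      rw [← hs2]
      have e2 : ∀ a, a ≠ 27 → s2.nat a = s1.nat a := fun a ha => by
        rw [hs2, Memory.setNat_nat_ne _ _ _ ha]
      have e3 : s2.nat 0 0 = n := by rw [e2 _ (by omega), e1 _ (by omega) (by omega), hn]
      have e4 : s2.nat 27 0 = 0 := by rw [hs2]; simp
      refine (weightTable_run (s := s2) (R := R) (K := K) (placeValues_bagPlace A B) ?_ ?_ hR1 ?_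
        (by simp; omega) (by simp; omega)).mono le_rfl ?_
      · intro v hv
        rw [e3] at hv
        rw [e2 _ (by omega), e1 _ (by omega) (by omega), hP v hv]
      · rw [e3]; exact hR
      · rw [e3]; exact hK
      · rintro s3 - ⟨h3, -⟩ i hi j hj
        rw [e3, e4] at h3
        have h4 : ∀ i < bagDim A B, s3.nat 39 i = ∑ v ∈ Finset.range n,
            digit (bagPlace A B) v i * if ¬ InBag C v then bagPlace A B v else 0 := by
          intro i hi
          rw [← zero_add i, h3 i hi, zero_add]
          refine Finset.sum_congr rfl fun v hv => ?_
          have hv := Finset.mem_range.1 hv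
          rw [e2 38 (by omega), h1 v (by omega), hC ⟨v, hv⟩]
          have := inBag_iff (B := C) ⟨v, hv⟩
          simp only at this
          rw [this]
          congr 1
          by_cases hvC : (⟨v, hv⟩ : Fin n) ∈ C <;> simp [hvC]
        rw [h4 i hi, h4 j hj, (placeValues_bagPlace A B).sum_digit_eq (B := fun v => ¬ InBag C v)]
        constructor
        · intro h v hv
          exact Fin.ext (h v v.2 (by rwa [inBag_iff]))
        · intro h v hv hvC
          exact congrArg Fin.val (h ⟨v, hv⟩ fun h' => hvC ⟨hv, h'⟩)
  refine key.mono_time ?_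
  have : R ≤ R * K := Nat.le_mul_of_pos_right _ hK1
  omega

/-- Computes the numbers of the restrictions of the states of one node to the flagged set, the
bag of another node. -/
def codeTable (P P' : ℕ) : Program :=
  .seq (flagWeights (.const 0) (.cell P' (.reg 61)))
    (.seq (.setNat 27 (.const 0) (.const 0)) (weightTable P 38 40 27))

/-- The digits with respect to `B` are weighted by the place values with respect to `C`; digits
outside of `C` get weight 0. -/
theorem codeTable_run {R K : ℕ} {P P' : ℕ} {s : Memory} {B C : Finset (Fin n)}
    (hn : s.nat 0 0 = n) (hR : n ≤ R) (hR1 : 1 ≤ R) (hK : bagDim A B ≤ K) (hC : HoldsFlags C s)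
    (hP : ∀ v ≤ n, s.nat P v = bagPlace A B v) (hP' : ∀ v ≤ n, s.nat P' v = bagPlace A C v)
    (h : 27 < P ∧ P < 38 := by decide)
    (h' : P' ≠ 38 ∧ P' ≠ 61 := by decide) :
    Run (codeTable P P') s (3000000 * (R * K)) fun s' => ∀ i < bagDim A B,
      s'.nat 40 i < bagDim A C ∧
      bagState A C (s'.nat 40 i) = RectTableau.restrict A C (bagState A B i) := by
  classical
  have hK1 : 1 ≤ K := (bagDim_pos A B).trans_le hK
  have key : Run (codeTable P P') s (12000 * R + (30 + 2000000 * (R * K))) fun s' =>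
      ∀ i < bagDim A B, s'.nat 40 i < bagDim A C ∧
      bagState A C (s'.nat 40 i) = RectTableau.restrict A C (bagState A B i) := by
    refine (flagWeights_run (s := s) (f := fun _ => 0) (f' := bagPlace A C) (by rw [hn]; exact hR)
      hR1 ?_).seq ?_
    · intro v hv s' hs' hv'
      rw [hn] at hv
      simp only [NatExpr.val, NatExpr.val_reg, hv', true_and]
      rw [hs' P' h'.1 h'.2, hP' v hv.le]
    · intro s1 hf1 h1
      have e1 : ∀ a, a ≠ 38 → a ≠ 61 → s1.nat a = s.nat a := fun a ha ha' => hf1.nat a (by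
        simp [flagWeights, Program.forN, natFree, ha, ha'])
      refine Run.setNat_seq ?_
      simp only [NatExpr.val]
      obtain ⟨s2, hs2⟩ : ∃ s2, s2 = s1.setNat 27 0 0 := ⟨_, rfl⟩
      rw [← hs2]
      have e2 : ∀ a, a ≠ 27 → s2.nat a = s1.nat a := fun a ha => by
        rw [hs2, Memory.setNat_nat_ne _ _ _ ha]
      have e3 : s2.nat 0 0 = n := by rw [e2 _ (by omega), e1 _ (by omega) (by omega), hn]
      have e4 : s2.nat 27 0 = 0 := by rw [hs2]; simp
      refine (weightTable_run (s := s2) (R := R) (K := K) (placeValues_bagPlace A B) ?_ ?_ hR1 ?_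
        (by simp; omega) (by simp; omega)).mono le_rfl ?_
      · intro v hv
        rw [e3] at hv
        rw [e2 _ (by omega), e1 _ (by omega) (by omega), hP v hv]
      · rw [e3]; exact hR
      · rw [e3]; exact hK
      · rintro s3 - ⟨h3, -⟩ i hi
        rw [e3, e4] at h3
        have h4 : s3.nat 40 i = ∑ v ∈ Finset.range n,
            digit (bagPlace A B) v i * if InBag C v then bagPlace A C v else 0 := by
          rw [← zero_add i, h3 i hi, zero_add]
          refine Finset.sum_congr rfl fun v hv => ?_
          have hv := Finset.mem_range.1 hv
          rw [e2 38 (by omega), h1 v (by omega), hC ⟨v, hv⟩]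
          have := inBag_iff (B := C) ⟨v, hv⟩
          simp only at this
          rw [this]
          congr 1
          by_cases hvC : (⟨v, hv⟩ : Fin n) ∈ C <;> simp [hvC]
        rw [h4]
        exact bagState_code A C i
  refine key.mono_time ?_
  have : R ≤ R * K := Nat.le_mul_of_pos_right _ hK1
  omega

end tables

/-! ### The matrix of a column -/

/-- Hides the new memory behind its frame condition and the contents of the one array concerned, so
that long sequences of assignments do not build up nested updates. -/
theorem Run.setNat_seq' {a : ℕ} {i e : NatExpr} {P : Program} {s : Memory} {T : ℕ}
    {Q : Memory → Prop}
    (h : ∀ s', (Program.setNat a i e).Frame s s' → s'.nat a (i.val s) = e.val s →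
      (∀ j, j ≠ i.val s → s'.nat a j = s.nat a j) → Run P s' T Q)
    (hc : Nat.ble (i.cost + e.cost) 29 = true := by rfl) :
    Run (.seq (.setNat a i e) P) s (30 + T) Q := by
  refine (Run.setNat (Q := fun s' => s'.nat a (i.val s) = e.val s ∧
    ∀ j, j ≠ i.val s → s'.nat a j = s.nat a j) ?_ hc).seq fun s' hf hs' => h s' hf hs'.1 hs'.2
  refine ⟨by simp, fun j hj => ?_⟩
  rw [Memory.setNat_nat_apply, if_neg fun h' => hj h'.2]

section column

variable {n d m : ℕ} {T : RectTableau n d m} {A : NcABP d m} {D : TreeDecomposition T.columnGraph}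

/-- The memory holds the input, and the data of node `x` in the registers of the current node. -/
structure AtNode (T : RectTableau n d m) (A : NcABP d m) (D : TreeDecomposition T.columnGraph)
    (x : Fin D.size) (s : Memory) : Prop where
  setup : Setup T A D s
  node : NodeData A D x 46 34 47 36 49 s

/-- The program changes none of the arrays that are described by `AtNode`. -/
def Program.KeepsNode (P : Program) : Prop :=
  P.KeepsSetup ∧ ∀ a ∈ [46, 34, 47, 36, 49], P.natFree a = true

theorem AtNode.frame {x : Fin D.size} {s s' : Memory} {P : Program} (h : AtNode T A D x s)
    (hf : P.Frame s s') (hP : P.KeepsNode) : AtNode T A D x s' :=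
  ⟨h.setup.frame hf hP.1, h.node.congr (hf.nat _ (hP.2 _ (by simp))) (hf.nat _ (hP.2 _ (by simp)))
    (hf.nat _ (hP.2 _ (by simp))) (hf.nat _ (hP.2 _ (by simp))) (hf.nat _ (hP.2 _ (by simp)))⟩

/-- The cell of the number in column `56` and row `59`. -/
def entryExpr : NatExpr := .cell 2 (.add (.cell 12 (.reg 56)) (.reg 59))

theorem Setup.entryExpr_val {s : Memory} (h : Setup T A D s) {c : Fin (T.shape.rowLen 0)}
    {b : Fin (T.shape.colLen c)} (hc : s.nat 56 0 = c) (hb : s.nat 59 0 = b) :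
    entryExpr.val s = T.num c b := by
  simp only [entryExpr, NatExpr.val, NatExpr.val_reg, hc, hb, h.column c c.2]
  exact h.input.entry_eq (T.shape.box c b)

/-- Computes the set of the numbers in column `56`, tests whether it is contained in the bag of the
current node, and loads the length of the column. -/
def flagsProgram : Program :=
  .seq (fillNat 43 0 0 0)
    (.seq (.setNat 44 (.const 0) (.const 1))
      (.seq (.setNat 23 (.const 0) (.cell 1 (.reg 56)))
        (.forN 59 23 0
          (.seq (.setNat 63 (.const 0) entryExpr)
            (.seq (.setNat 43 (.reg 63) (.const 1))
              (.branch (.natEq (.cell 5 (.add (.reg 46) (.reg 63))) (.const 1)) .skip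
                (.setNat 44 (.const 0) (.const 0))))))))

theorem flagsProgram_run {R K : ℕ} (hb : SizeBound T A D R K) {s : Memory} {x : Fin D.size}
    (hs : AtNode T A D x s) {c : Fin (T.shape.rowLen 0)} (hc : s.nat 56 0 = c) :
    Run flagsProgram s (40000 * R) fun s' => HoldsFlags (T.colSet c) s' ∧
      s'.nat 23 0 = T.shape.colLen c ∧ (s'.nat 44 0 = 1 ↔ T.colSet c ⊆ D.bag x) := by
  have hR1 := hb.one_le
  have hμR : T.shape.colLen c ≤ R := (T.colLen_le c).trans hb.m_le
  have key : Run flagsProgram s (6000 * R + (30 + (30 + 200 * (R * (30 + (30 + (30 + 30)))))))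
      fun s' => HoldsFlags (T.colSet c) s' ∧
      s'.nat 23 0 = T.shape.colLen c ∧ (s'.nat 44 0 = 1 ↔ T.colSet c ⊆ D.bag x) := by
    refine (fillNat_run (s := s) (a := 43) (lenA := 0) (lenJ := 0) (c := 0) (M := R)
      (by rw [hs.setup.input.n_eq]; exact hb.n_le) hR1).seq ?_
    intro s1 hf1 h1
    rw [hs.setup.input.n_eq] at h1
    refine Run.setNat_seq' fun s2 hf2 h2 _ => ?_
    refine Run.setNat_seq' fun s3 hf3 h3 _ => ?_
    have hs3 : AtNode T A D x s3 := ((hs.frame hf1 ⟨⟨by decide, rfl⟩, by decide⟩).frame hf2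
      ⟨⟨by decide, rfl⟩, by decide⟩).frame hf3 ⟨⟨by decide, rfl⟩, by decide⟩
    have hs2 := (hs.frame hf1 ⟨⟨by decide, rfl⟩, by decide⟩).frame hf2
      ⟨⟨by decide, rfl⟩, by decide⟩
    have hc2 : s2.nat 56 0 = c := by rw [hf2.nat 56 rfl, hf1.nat 56 rfl, hc]
    have hc3 : s3.nat 56 0 = c := by rw [hf3.nat 56 rfl, hc2]
    simp only [NatExpr.val, NatExpr.val_reg, hc2] at h2 h3
    rw [hs2.setup.input.colLen_eq c c.2] at h3
    have h43 : ∀ v < n, s3.nat 43 v = 0 := fun v hv => by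
      rw [hf3.nat 43 rfl, hf2.nat 43 rfl, h1 v hv]
    have h44 : s3.nat 44 0 = 1 := by rw [hf3.nat 44 rfl, h2]
    refine Run.forN (fun k s' => (∀ v : Fin n, s'.nat 43 v = 1 ∧ (∃ b : Fin (T.shape.colLen c),
        (b : ℕ) < k ∧ T.num c b = v) ∨ s'.nat 43 v = 0 ∧
        ∀ b : Fin (T.shape.colLen c), (b : ℕ) < k → T.num c b ≠ v) ∧
        (s'.nat 44 0 = 1 ↔ ∀ b : Fin (T.shape.colLen c), (b : ℕ) < k → T.num c b ∈ D.bag x))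
      (by rw [h3]; exact hμR) hR1 (by norm_num) ?_ ?_ ?_
    · refine ⟨fun v => Or.inr ⟨?_, by simp⟩, ?_⟩
      · rw [Memory.setNat_nat_ne _ _ _ (by decide), h43 v v.2]
      · rw [Memory.setNat_nat_ne _ _ _ (by decide), h44]
        simp
    · rintro k hk s4 hf4 hk4 ⟨hinv, hinv'⟩
      rw [h3] at hk
      have hs4 := hs3.frame hf4 ⟨⟨by decide, rfl⟩, by decide⟩
      have hent := hs4.setup.entryExpr_val (b := ⟨k, hk⟩) (by rw [hf4.nat 56 rfl, hc3]) hk4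
      set v := T.num c ⟨k, hk⟩ with hv
      refine Run.setNat_seq' fun s5 hf5 h5 _ => ?_
      rw [hent] at h5
      simp only [NatExpr.val] at h5
      refine Run.setNat_seq' fun s6 hf6 h6 h6' => ?_
      simp only [NatExpr.val, NatExpr.val_reg, h5] at h6 h6'
      have hs6 := (hs4.frame hf5 ⟨⟨by decide, rfl⟩, by decide⟩).frame hf6
        ⟨⟨by decide, rfl⟩, by decide⟩
      have hbag := hs6.setup.input.bag_eq_one_iff x v
      have h63 : s6.nat 63 0 = v := by rw [hf6.nat 63 rfl, h5]
      have hfl : ∀ u : Fin n, s6.nat 43 u = 1 ∧ (∃ b : Fin (T.shape.colLen c),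
          (b : ℕ) < k + 1 ∧ T.num c b = u) ∨ s6.nat 43 u = 0 ∧
          ∀ b : Fin (T.shape.colLen c), (b : ℕ) < k + 1 → T.num c b ≠ u := by
        intro u
        by_cases huv : u = v
        · subst huv
          exact Or.inl ⟨h6, ⟨k, hk⟩, by simp, rfl⟩
        · rw [h6' u fun h => huv (Fin.ext h), hf5.nat 43 rfl]
          refine (hinv u).imp (fun h => ⟨h.1, ?_⟩) fun h => ⟨h.1, fun b hb => ?_⟩
          · obtain ⟨b, hb, hb'⟩ := h.2
            exact ⟨b, by omega, hb'⟩
          · by_cases hbk : (b : ℕ) = k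
            · have : b = ⟨k, hk⟩ := Fin.ext hbk
              rw [this]
              exact fun h => huv h.symm
            · exact h.2 b (by omega)
      have h44' : s6.nat 44 = s4.nat 44 := by rw [hf6.nat 44 rfl, hf5.nat 44 rfl]
      refine Run.branch ?_ ?_
      · intro h
        have h : v ∈ D.bag x := by
          rw [← hbag]
          simpa [Test.Holds, NatExpr.val, hs6.node.base, h63] using h
        refine Run.mono_time (Run.skip ⟨?_, ?_⟩) (by norm_num)
        · intro u
          rw [Memory.setNat_nat_ne _ _ _ (by decide)]
          exact hfl u
        · rw [Memory.setNat_nat_ne _ _ _ (by decide), h44', hinv']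
          refine ⟨fun h' b hb => ?_, fun h' b hb => h' b (by omega)⟩
          by_cases hbk : (b : ℕ) = k
          · have : b = ⟨k, hk⟩ := Fin.ext hbk
            rw [this]
            exact h
          · exact h' b (by omega)
      · intro h
        have h : v ∉ D.bag x := by
          rw [← hbag]
          simpa [Test.Holds, NatExpr.val, hs6.node.base, h63] using h
        refine Run.setNat ⟨?_, ?_⟩
        · intro u
          rw [Memory.setNat_nat_ne _ _ _ (by decide), Memory.setNat_nat_ne _ _ _ (by decide)]
          exact hfl u
        · rw [Memory.setNat_nat_ne _ _ _ (by decide)]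
          simp only [NatExpr.val, Memory.setNat_nat_self]
          refine ⟨fun h' => absurd h' (by norm_num), fun h' => absurd (h' ⟨k, hk⟩ (by simp)) h⟩
    · rintro s' hf' ⟨hinv, hinv'⟩
      rw [h3] at hinv hinv'
      refine ⟨fun v => ?_, ?_, ?_⟩
      · rcases hinv v with ⟨h, b, -, hb⟩ | ⟨h, hb⟩
        · rw [h, if_pos (by rw [← hb]; exact T.num_mem_colSet c b)]
        · rw [h, if_neg]
          intro hv
          obtain ⟨b, -, hb'⟩ := Finset.mem_image.1 hv
          exact hb b b.2 hb'
      · rw [hf'.nat 23 rfl, h3]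
      · rw [hinv']
        constructor
        · intro h v hv
          obtain ⟨b, -, rfl⟩ := Finset.mem_image.1 hv
          exact h b b.2
        · intro h b _
          exact h (T.num_mem_colSet c b)
  exact key.mono_time (by omega)

/-- Computes, for each number in column `56`, the table of its digits in the numbers of states. -/
def digitTables : Program :=
  .seq (.setNat 27 (.const 0) (.const 0))
    (.forN 59 23 0
      (.seq (fillNat 38 0 0 0)
        (.seq (.setNat 63 (.const 0) entryExpr)
          (.seq (.setNat 38 (.reg 63) (.const 1))
            (.seq (weightTable 34 38 41 27)
              (.seq (.setNat 42 (.reg 59) (.reg 27))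
                (.setNat 27 (.const 0) (.add (.reg 27) (.reg 47)))))))))

/-- With weight 1 at one number and 0 elsewhere, the weighted digit sum of `i` is the vertex of this
number in state `i`. The tables for the rows of the column follow one another in array `41`, and
array `42` keeps their offsets. -/
theorem digitTables_run {R K : ℕ} (hb : SizeBound T A D R K) {s : Memory} {x : Fin D.size}
    (hs : AtNode T A D x s) {c : Fin (T.shape.rowLen 0)} (hc : s.nat 56 0 = c)
    (hμ : s.nat 23 0 = T.shape.colLen c) :
    Run digitTables s (500000000 * (R * (R * K))) fun s' => ∀ b : Fin (T.shape.colLen c),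
      ∀ i < bagDim A (D.bag x),
        s'.nat 41 (s'.nat 42 b + i) = bagState A (D.bag x) i (T.num c b) := by
  classical
  have hR1 := hb.one_le
  have hK1 := hb.one_le_K
  have hμR : T.shape.colLen c ≤ R := (T.colLen_le c).trans hb.m_le
  set N := bagDim A (D.bag x) with hN
  have key : Run digitTables s (30 + 200 * (R * (6000 * R + (30 + (30 +
      (2000000 * (R * K) + (30 + 30))))))) fun s' => ∀ b : Fin (T.shape.colLen c),
      ∀ i < N, s'.nat 41 (s'.nat 42 b + i) = bagState A (D.bag x) i (T.num c b) := by
    refine Run.setNat_seq' fun s1 hf1 h1 _ => ?_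
    simp only [NatExpr.val] at h1
    have hs1 := hs.frame hf1 ⟨⟨by decide, rfl⟩, by decide⟩
    have hμ1 : s1.nat 23 0 = T.shape.colLen c := by rw [hf1.nat 23 rfl, hμ]
    refine Run.forN (fun k s' => s'.nat 27 0 = k * N ∧ ∀ b, (b : ℕ) < k → s'.nat 42 b = b * N ∧
      ∀ i < N, s'.nat 41 (b * N + i) = if hb : b < T.shape.colLen c then
        (bagState A (D.bag x) i (T.num c ⟨b, hb⟩) : ℕ) else 0)
        (by rw [hμ1]; exact hμR) hR1 (by omega) ?_ ?_ ?_
    · refine ⟨?_, by simp⟩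
      rw [Memory.setNat_nat_ne _ _ _ (by decide), h1, zero_mul]
    · rintro k hk s2 hf2 hk2 ⟨hinv, hinv'⟩
      rw [hμ1] at hk
      have hs2 := hs1.frame hf2 ⟨⟨by decide, rfl⟩, by decide⟩
      have hc2 : s2.nat 56 0 = c := by rw [hf2.nat 56 rfl, hf1.nat 56 rfl, hc]
      refine (fillNat_run (s := s2) (a := 38) (lenA := 0) (lenJ := 0) (c := 0) (M := R)
        (by rw [hs2.setup.input.n_eq]; exact hb.n_le) hR1).seq ?_
      intro s3 hf3 h3
      rw [hs2.setup.input.n_eq] at h3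
      have hs3 := hs2.frame hf3 ⟨⟨by decide, rfl⟩, by decide⟩
      have hent := hs3.setup.entryExpr_val (b := ⟨k, hk⟩) (by rw [hf3.nat 56 rfl, hc2])
        (by rw [hf3.nat 59 rfl, hk2])
      set v := T.num c ⟨k, hk⟩ with hv
      refine Run.setNat_seq' fun s4 hf4 h4 _ => ?_
      rw [hent] at h4
      simp only [NatExpr.val] at h4
      refine Run.setNat_seq' fun s5 hf5 h5 h5' => ?_
      simp only [NatExpr.val, NatExpr.val_reg, h4] at h5 h5'
      have hs5 := (hs3.frame hf4 ⟨⟨by decide, rfl⟩, by decide⟩).frame hf5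
        ⟨⟨by decide, rfl⟩, by decide⟩
      have hn5 := hs5.setup.input.n_eq
      refine (weightTable_run (pv := 34) (wt := 38) (out := 41) (ob := 27) (s := s5) (R := R)
        (K := K) (placeValues_bagPlace A (D.bag x)) ?_ (by rw [hn5]; exact hb.n_le) hR1
        (by rw [hn5]; exact hb.dim_le x)).seq ?_
      · rw [hn5]; exact hs5.node.place
      intro s6 hf6 h6
      have h27 : s5.nat 27 0 = k * N := by
        rw [hf5.nat 27 rfl, hf4.nat 27 rfl, hf3.nat 27 rfl, hinv]
      rw [hn5, h27] at h6
      obtain ⟨h6, h6'⟩ := h6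
      have e5 : ∀ a, a ∉ [20, 38, 63] → s5.nat a = s2.nat a := by
        intro a ha
        simp only [List.mem_cons, List.not_mem_nil, or_false, not_or] at ha
        rw [hf5.nat a (by simp [natFree, ha]), hf4.nat a (by simp [natFree, ha]),
          hf3.nat a (by simp [fillNat, Program.forN, natFree, ha])]
      have h59 : s6.nat 59 0 = k := by rw [hf6.nat 59 rfl, e5 59 (by decide), hk2]
      refine Run.setNat_seq' fun s7 hf7 h7 h7' => ?_
      simp only [NatExpr.val_reg, h59, hf6.nat 27 rfl, h27] at h7 h7'
      refine Run.setNat ?_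
      have h47 : s7.nat 47 0 = N := by rw [hf7.nat 47 rfl, hf6.nat 47 rfl, hs5.node.dim]
      have h27' : s7.nat 27 0 = k * N := by rw [hf7.nat 27 rfl, hf6.nat 27 rfl, h27]
      simp only [NatExpr.val, NatExpr.val_reg, h47, h27']
      rw [Memory.setNat_nat_ne _ _ _ (show 27 ≠ 59 by decide),
        Memory.setNat_nat_ne _ _ _ (show 42 ≠ 59 by decide),
        Memory.setNat_nat_ne _ _ _ (show 41 ≠ 59 by decide),
        Memory.setNat_nat_ne _ _ _ (show 42 ≠ 27 by decide),
        Memory.setNat_nat_ne _ _ _ (show 41 ≠ 27 by decide), Memory.setNat_nat_self,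
        hf7.nat 41 rfl]
      refine ⟨by ring, fun b hbk => ?_⟩
      by_cases hb' : b = k
      · subst hb'
        refine ⟨h7, fun i hi => ?_⟩
        rw [h6 i hi, dif_pos hk]
        have hvn : (v : ℕ) ∈ Finset.range n := Finset.mem_range.2 v.2
        rw [Finset.sum_eq_single_of_mem _ hvn, h5, mul_one]
        · rfl
        · intro u hu huv
          rw [h5' u huv, hf4.nat 38 rfl, h3 u (Finset.mem_range.1 hu), mul_zero]
      · have hbk : b < k := by omega
        obtain ⟨h8, h9⟩ := hinv' b hbk
        refine ⟨?_, fun i hi => ?_⟩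
        · rw [h7' b hb', hf6.nat 42 rfl, e5 42 (by decide), h8]
        · have : (b + 1) * N ≤ k * N := Nat.mul_le_mul_right _ hbk
          rw [add_mul] at this
          rw [h6' _ (by omega), e5 41 (by decide), h9 i hi]
    · rintro s' _ ⟨-, hinv⟩ b i hi
      rw [hμ1] at hinv
      obtain ⟨h8, h9⟩ := hinv b b.2
      rw [h8, h9 i hi, dif_pos b.2]
  refine key.mono_time ?_
  have h1 : 1 ≤ R * K := Nat.mul_pos hR1 hK1
  have h2 : R ≤ R * K := Nat.le_mul_of_pos_right _ hK1
  have h3 : R * (6000 * R + (30 + (30 + (2000000 * (R * K) + (30 + 30))))) ≤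
    R * (2200000 * (R * K)) := Nat.mul_le_mul_left _ (by omega)
  have h4 : 1 ≤ R * (R * K) := Nat.mul_pos hR1 h1
  have h5 : R * (2200000 * (R * K)) = 2200000 * (R * (R * K)) := by ring
  omega

/-- Writes values to column `59` of the matrix in array `3`. -/
def writeColumn (e : CpxExpr) : Program := .forN 60 23 0 (.setCpx 3 (entryCell 60 59) e)

theorem writeColumn_run {e : CpxExpr} {s : Memory} {R μ b : ℕ} {g : ℕ → ℂ} (hμ : s.nat 23 0 = μ)
    (hμR : μ ≤ R) (hR1 : 1 ≤ R) (h6 : ∀ a < μ, s.nat 6 a = a * m) (hμm : μ ≤ m)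
    (hb : s.nat 59 0 = b) (hbμ : b < μ)
    (he : ∀ s', (∀ a, a ≠ 60 → s'.nat a = s.nat a) → (∀ a, a ≠ 3 → s'.cpx a = s.cpx a) →
      ∀ a < μ, s'.nat 60 0 = a → e.val s' = g a)
    (hc : Nat.ble ((entryCell 60 59).cost + e.cost) 29 = true := by rfl) :
    Run (writeColumn e) s (6000 * R) fun s' =>
      ∀ a < μ, ∀ b' < μ, s'.cpx 3 (s.nat 6 a + b') =
        if b' = b then g a else s.cpx 3 (s.nat 6 a + b') := by
  have key : Run (writeColumn e) s (200 * (R * 30)) fun s' =>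
      ∀ a < μ, ∀ b' < μ, s'.cpx 3 (s.nat 6 a + b') =
        if b' = b then g a else s.cpx 3 (s.nat 6 a + b') := by
    refine Run.forN (fun k s' => ∀ a < μ, ∀ b' < μ, s'.cpx 3 (s.nat 6 a + b') =
        if b' = b ∧ a < k then g a else s.cpx 3 (s.nat 6 a + b')) (by rw [hμ]; exact hμR) hR1
        (by norm_num) ?_ ?_ ?_ (by rfl) (by rfl)
    · intro a _ b' _
      simp
    · intro k hk s' hf hk' hinv
      rw [hμ] at hk
      have e1 : ∀ a, a ≠ 60 → s'.nat a = s.nat a := fun a ha => hf.nat a (by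
        simp [Program.forN, natFree, ha])
      have hv := he s' e1 (fun a ha => hf.cpx a (by simp [Program.forN, cpxFree, ha])) k hk hk'
      refine Run.setCpx ?_ hc
      intro a ha b' hb'
      simp only [entryCell, NatExpr.val, NatExpr.val_reg, hk', e1 6 (by decide), e1 59 (by decide),
        hb, hv, Memory.setNat_cpx, Memory.setCpx_cpx_apply, true_and, h6 a ha, h6 k hk]
      have hiff : a * m + b' = k * m + b ↔ a = k ∧ b' = b := by
        constructor
        · intro h
          rcases lt_trichotomy (a * m + b') (k * m + b) with h' | h' | h'
          · omega
          · have h1 := (pair_lt_iff (i := a) (i' := k) (hb'.trans_le hμm) (hbμ.trans_le hμm)).not.1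
              (by omega)
            have h2 := (pair_lt_iff (i := k) (i' := a) (hbμ.trans_le hμm) (hb'.trans_le hμm)).not.1
              (by omega)
            omega
          · omega
        · rintro ⟨rfl, rfl⟩
          rfl
      by_cases h : a = k ∧ b' = b
      · rw [if_pos (hiff.2 h), if_pos ⟨h.2, by omega⟩, h.1]
      · rw [if_neg fun h' => h (hiff.1 h'), ← h6 a ha, hinv a ha b' hb']
        by_cases hb2 : b' = b
        · have : a < k + 1 ↔ a < k := by omega
          simp only [this]
        · simp [hb2]
    · intro s' _ hinv a ha b' hb'
      rw [hμ] at hinv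
      rw [hinv a ha b' hb']
      simp [ha]
  exact key.mono_time (by omega)

/-- Writes the matrix whose determinant is the entry in row `57` and column `58` of the matrix of
column `56`. -/
def fillProgram : Program :=
  .forN 59 23 0
    (.seq (.setNat 63 (.const 0) entryExpr)
      (.seq (.setNat 64 (.const 0) (.cell 30 (.reg 63)))
        (.seq (.setNat 65 (.const 0) (.cell 41 (.add (.cell 42 (.reg 59)) (.reg 57))))
          (.seq (.setNat 66 (.const 0) (.cell 41 (.add (.cell 42 (.reg 59)) (.reg 58))))
            (.branch (.natLt (.reg 65) (.cell 3 (.reg 64)))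
              (.branch (.natLt (.reg 66) (.cell 3 (.add (.reg 64) (.const 1))))
                (.seq
                  (.setNat 67 (.const 0)
                    (.add (.add (.cell 9 (.reg 64)) (.cell 8 (.reg 65))) (.cell 7 (.reg 66))))
                  (writeColumn (.cell 0 (.add (.reg 67) (.reg 60)))))
                (writeColumn (.const 0)))
              (writeColumn (.const 0)))))))

/-- The matrices whose determinants are the entries of the matrix of column `c`. -/
noncomputable def labelEntry (T : RectTableau n d m) (A : NcABP d m) (k : Fin n → ℕ)
    (c : Fin (T.shape.rowLen 0)) (σ σ' : Fin n → Fin A.width) (a b : ℕ) : ℂ :=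
  if hb : b < T.shape.colLen c then
    A.extLabel (k (T.num c ⟨b, hb⟩)) (σ (T.num c ⟨b, hb⟩)) (σ' (T.num c ⟨b, hb⟩)) a
  else 0

theorem squareDet_labelEntry (k : Fin n → ℕ) (c : Fin (T.shape.rowLen 0))
    {σ σ' : Fin n → Fin A.width} (h : ∀ v ∉ T.colSet c, σ v = σ' v) :
    squareDet (T.shape.colLen c) (labelEntry T A k c σ σ') = T.transfer A k c σ σ' := by
  rw [RectTableau.transfer, Matrix.of_apply, if_pos h, squareDet]
  congr 1
  ext a b
  simp only [Matrix.of_apply, labelEntry]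
  rw [dif_pos b.2]

/-- The memory describes the column `c`, and the copies of the branching program are in the layers
`k`. -/
structure AtColumn (A : NcABP d m) (D : TreeDecomposition T.columnGraph) (x : Fin D.size)
    (c : Fin (T.shape.rowLen 0)) (k : Fin n → ℕ) (s : Memory) : Prop where
  node : AtNode T A D x s
  column : s.nat 56 0 = c
  length : s.nat 23 0 = T.shape.colLen c
  layer : ∀ v : Fin n, s.nat 30 v = k v
  digits : ∀ b : Fin (T.shape.colLen c), ∀ i < bagDim A (D.bag x),
    s.nat 41 (s.nat 42 b + i) = bagState A (D.bag x) i (T.num c b)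

theorem AtColumn.frame {x : Fin D.size} {c : Fin (T.shape.rowLen 0)} {k : Fin n → ℕ}
    {s s' : Memory} {P : Program} (h : AtColumn A D x c k s)
    (hf : P.Frame s s') (hP : P.KeepsNode) (hP' : ∀ a ∈ [56, 23, 30, 41, 42], P.natFree a = true) :
    AtColumn A D x c k s' := by
  obtain ⟨h1, h2, h3, h4, h5⟩ := h
  refine ⟨h1.frame hf hP, ?_, ?_, ?_, ?_⟩
  · rw [hf.nat _ (hP' _ (by simp)), h2]
  · rw [hf.nat _ (hP' _ (by simp)), h3]
  · rw [hf.nat _ (hP' _ (by simp))]; exact h4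
  · rw [hf.nat 41 (hP' _ (by simp)), hf.nat 42 (hP' _ (by simp))]; exact h5

theorem fillProgram_run {R K : ℕ} (hb : SizeBound T A D R K) {s : Memory} {x : Fin D.size}
    {c : Fin (T.shape.rowLen 0)} {k : Fin n → ℕ} (hs : AtColumn A D x c k s)
    (hk : ∀ v ∈ T.colSet c, k v < d) {i j : ℕ} (hi : i < bagDim A (D.bag x))
    (hj : j < bagDim A (D.bag x)) (hi' : s.nat 57 0 = i) (hj' : s.nat 58 0 = j) :
    Run fillProgram s (2000000 * (R * R))
      (HoldsSquare (T.shape.colLen c)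
        (labelEntry T A k c (bagState A (D.bag x) i) (bagState A (D.bag x) j))) := by
  have hR1 := hb.one_le
  have hμm := T.colLen_le c
  have hμR : T.shape.colLen c ≤ R := hμm.trans hb.m_le
  set μ := T.shape.colLen c with hμ
  set f := labelEntry T A k c (bagState A (D.bag x) i) (bagState A (D.bag x) j) with hf
  have key : Run fillProgram s
      (200 * (R * (30 + (30 + (30 + (30 + (30 + (30 + (30 + 6000 * R)))))))))
      (HoldsSquare μ f) := by
    refine Run.forN (fun l s' => ∀ a < μ, ∀ b < l, b < μ → s'.cpx 3 (s.nat 6 a + b) = f a b)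
      (by rw [hs.length]; exact hμR) hR1 (by omega) (by simp) ?_ ?_
    · intro l hl s1 hf1 hl1 hinv
      rw [hs.length] at hl
      have hs1 := hs.frame hf1 ⟨⟨by decide, rfl⟩, by decide⟩ (by decide)
      have hent := hs1.node.setup.entryExpr_val (b := ⟨l, hl⟩) hs1.column hl1
      set v := T.num c ⟨l, hl⟩ with hv
      refine Run.setNat_seq' fun s2 hf2 h2 _ => ?_
      rw [hent] at h2
      simp only [NatExpr.val] at h2
      have hs2 := hs1.frame hf2 ⟨⟨by decide, rfl⟩, by decide⟩ (by decide)
      refine Run.setNat_seq' fun s3 hf3 h3 _ => ?_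
      simp only [NatExpr.val, NatExpr.val_reg, h2, hs2.layer v] at h3
      have hs3 := hs2.frame hf3 ⟨⟨by decide, rfl⟩, by decide⟩ (by decide)
      have h59 : s3.nat 59 0 = l := by rw [hf3.nat 59 rfl, hf2.nat 59 rfl, hl1]
      have h57 : s3.nat 57 0 = i := by rw [hf3.nat 57 rfl, hf2.nat 57 rfl, hf1.nat 57 rfl, hi']
      have h58 : s3.nat 58 0 = j := by rw [hf3.nat 58 rfl, hf2.nat 58 rfl, hf1.nat 58 rfl, hj']
      refine Run.setNat_seq' fun s4 hf4 h4 _ => ?_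
      have hd3 := hs3.digits ⟨l, hl⟩ i hi
      simp only [NatExpr.val, NatExpr.val_reg, h59, h57] at h4 hd3
      rw [hd3] at h4
      have hs4 := hs3.frame hf4 ⟨⟨by decide, rfl⟩, by decide⟩ (by decide)
      refine Run.setNat_seq' fun s5 hf5 h5 _ => ?_
      have hd4 := hs4.digits ⟨l, hl⟩ j hj
      simp only [NatExpr.val, NatExpr.val_reg, hf4.nat 59 rfl, h59, hf4.nat 58 rfl, h58] at h5 hd4
      rw [hd4] at h5
      have hs5 := hs4.frame hf5 ⟨⟨by decide, rfl⟩, by decide⟩ (by decide)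
      have h64 : s5.nat 64 0 = k v := by rw [hf5.nat 64 rfl, hf4.nat 64 rfl, h3]
      have h65 : s5.nat 65 0 = bagState A (D.bag x) i v := by rw [hf5.nat 65 rfl, h4]
      have h66 : s5.nat 66 0 = bagState A (D.bag x) j v := h5
      have h59' : s5.nat 59 0 = l := by rw [hf5.nat 59 rfl, hf4.nat 59 rfl, h59]
      have h3c : s5.cpx 3 = s1.cpx 3 := by
        rw [hf5.cpx 3 rfl, hf4.cpx 3 rfl, hf3.cpx 3 rfl, hf2.cpx 3 rfl]
      have h6c : s5.nat 6 = s.nat 6 := by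
        rw [hf5.nat 6 rfl, hf4.nat 6 rfl, hf3.nat 6 rfl, hf2.nat 6 rfl, hf1.nat 6 rfl]
      have hkv : k v < d := hk v (T.num_mem_colSet c _)
      have hlay : s5.nat 3 (k v) = A.layerSize (⟨k v, hkv⟩ : Fin d).castSucc :=
        hs5.node.setup.input.layer_eq (⟨k v, hkv⟩ : Fin d).castSucc
      have hlay' : s5.nat 3 (k v + 1) = A.layerSize (⟨k v, hkv⟩ : Fin d).succ :=
        hs5.node.setup.input.layer_eq (⟨k v, hkv⟩ : Fin d).succ
      have hfa : ∀ a, f a l = A.extLabel (k v) (bagState A (D.bag x) i v)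
          (bagState A (D.bag x) j v) a := fun a => by
        rw [hf, labelEntry, dif_pos hl]
      have hfin : ∀ s' : Memory, (∀ a < μ, ∀ b' < μ, s'.cpx 3 (s5.nat 6 a + b') =
          if b' = l then f a l else s5.cpx 3 (s5.nat 6 a + b')) →
          ∀ a < μ, ∀ b < l + 1, b < μ → (s'.setNat 59 0 (l + 1)).cpx 3 (s.nat 6 a + b) = f a b := by
        intro s' h a ha b hb hbμ
        rw [Memory.setNat_cpx, ← h6c, h a ha b hbμ]
        split_ifs with hbl
        · rw [hbl]
        · rw [h3c, h6c, hinv a ha b (by omega) hbμ]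
      have hw0 : (∀ a, f a l = 0) → Run (writeColumn (.const 0)) s5 (6000 * R) fun s' =>
          ∀ a < μ, ∀ b < l + 1, b < μ → (s'.setNat 59 0 (l + 1)).cpx 3 (s.nat 6 a + b) = f a b := by
        intro h0
        refine (writeColumn_run (m := m) (g := fun a => f a l) hs5.length hμR hR1
          (fun a ha => hs5.node.setup.row a (ha.trans_le hμm)) hμm h59' hl ?_).mono le_rfl
          fun s' _ h => hfin s' h
        intro s' _ _ a _ _
        simp [CpxExpr.val, h0 a]
      -- Cells for vertices beyond the size of a layer may contain garbage, so the program compares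
      -- with the layer sizes and writes the zeros that `extLabel` prescribes.
      refine Run.branch ?_ ?_
      · intro hlt
        have hlt : (bagState A (D.bag x) i v : ℕ) < A.layerSize (⟨k v, hkv⟩ : Fin d).castSucc := by
          simpa [Test.Holds, NatExpr.val, h64, h65, hlay] using hlt
        refine Run.branch ?_ ?_
        · intro hlt'
          have hlt' : (bagState A (D.bag x) j v : ℕ) < A.layerSize (⟨k v, hkv⟩ : Fin d).succ := by
            simpa [Test.Holds, NatExpr.val, h64, h66, hlay'] using hlt'
          -- The address of the label is a sum of three entries of the tables of multiples, for the
          -- layer, the source and the target of the edge.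
          refine Run.setNat_seq' fun s6 hf6 h6 _ => ?_
          simp only [NatExpr.val, NatExpr.val_reg, h64, h65, h66, hs5.node.setup.layer _ hkv,
            hs5.node.setup.source _ (Fin.is_lt _), hs5.node.setup.target _ (Fin.is_lt _)] at h6
          have hs6 := hs5.frame hf6 ⟨⟨by decide, rfl⟩, by decide⟩ (by decide)
          refine (writeColumn_run (m := m) (g := fun a => f a l) hs6.length hμR hR1
            (fun a ha => hs6.node.setup.row a (ha.trans_le hμm)) hμm
            (by rw [hf6.nat 59 rfl, h59']) hl ?_).mono le_rfl ?_
          · intro s' hn hcx a ha ha'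
            simp only [CpxExpr.val, NatExpr.val, NatExpr.val_reg, ha', hn 67 (by decide), h6,
              hcx 0 (by decide)]
            rw [hfa, NcABP.extLabel, dif_pos hkv, dif_pos hlt, dif_pos hlt',
              dif_pos (ha.trans_le hμm)]
            rw [← hs6.node.setup.input.label_eq]
            congr 1
            simp only
            ring
          · intro s' _ h
            refine hfin s' ?_
            rw [hf6.nat 6 rfl, hf6.cpx 3 rfl] at h
            exact h
        · intro hlt'
          have hlt' : ¬ (bagState A (D.bag x) j v : ℕ) < A.layerSize (⟨k v, hkv⟩ : Fin d).succ := by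
            simpa [Test.Holds, NatExpr.val, h64, h66, hlay'] using hlt'
          refine (hw0 fun a => ?_).mono_time (by omega)
          rw [hfa, NcABP.extLabel, dif_pos hkv, dif_pos hlt, dif_neg hlt']
      · intro hlt
        have hlt : ¬ (bagState A (D.bag x) i v : ℕ) <
            A.layerSize (⟨k v, hkv⟩ : Fin d).castSucc := by
          simpa [Test.Holds, NatExpr.val, h64, h65, hlay] using hlt
        refine (hw0 fun a => ?_).mono_time (by omega)
        rw [hfa, NcABP.extLabel, dif_pos hkv, dif_neg hlt]
    · intro s' hf' hinv a ha b hb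
      rw [hs.length] at hinv
      rw [hf'.nat 6 rfl]
      exact hinv a ha b hb hb
  refine key.mono_time ?_
  have h1 : R ≤ R * R := Nat.le_mul_of_pos_left _ hR1
  have h2 : R * (30 + (30 + (30 + (30 + (30 + (30 + (30 + 6000 * R))))))) ≤ R * (7000 * R) :=
    Nat.mul_le_mul_left _ (by omega)
  have h3 : R * (7000 * R) = 7000 * (R * R) := by ring
  omega

end column

theorem Program.Frame.pairLoop {Kr : ℕ} {B : Program} {s s' : Memory}
    (h : ∀ a, B.natFree a = true → a ≠ 57 → a ≠ 58 → s'.nat a = s.nat a)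
    (h' : ∀ a, B.cpxFree a = true → s'.cpx a = s.cpx a) : (_root_.pairLoop Kr B).Frame s s' := by
  refine ⟨fun a ha => ?_, fun a ha => ?_⟩
  · simp only [_root_.pairLoop, Program.forN, natFree, Bool.and_eq_true, bne_iff_ne] at ha
    exact h a ha.2.1.2.1 ha.1 ha.2.1.1
  · simp only [_root_.pairLoop, Program.forN, cpxFree, Bool.and_eq_true] at ha
    exact h' a ha.2.1.2.1

theorem size_bounds {R K : ℕ} (hR : 1 ≤ R) (hK : 1 ≤ K) :
    1 ≤ R ^ 3 * (K * K) ∧ R ≤ R ^ 3 * (K * K) ∧ R * K ≤ R ^ 3 * (K * K) ∧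
    R * (R * K) ≤ R ^ 3 * (K * K) ∧ R * R ≤ R ^ 3 ∧ 1 ≤ R ^ 3 ∧ K * K ≤ R ^ 3 * (K * K) ∧
    K ≤ R ^ 3 * (K * K) := by
  have h1 : 1 ≤ R ^ 3 := Nat.one_le_pow _ _ hR
  have h2 : R * R ≤ R ^ 3 := by rw [← sq]; exact Nat.pow_le_pow_right hR (by norm_num)
  have h3 : R ≤ R ^ 3 := Nat.le_self_pow (by norm_num) R
  have h4 : 1 ≤ K * K := Nat.mul_pos hK hK
  have h5 : K ≤ K * K := Nat.le_mul_of_pos_left _ hK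
  refine ⟨Nat.mul_pos h1 h4, h3.trans (Nat.le_mul_of_pos_right _ h4), Nat.mul_le_mul h3 h5, ?_, h2,
    h1, Nat.le_mul_of_pos_left _ h1, h5.trans (Nat.le_mul_of_pos_left _ h1)⟩
  rw [← mul_assoc]
  exact Nat.mul_le_mul h2 h5

/-! ### Computing the matrix of a column and multiplying it into the product of a node. -/

section merge

variable {n d m : ℕ} {T : RectTableau n d m} {A : NcABP d m} {D : TreeDecomposition T.columnGraph}

/-- Computes the entry in row `57` and column `58` of the matrix of column `56`. -/
def columnEntry : Program :=
  .branch (.natEq (.cell 39 (.reg 57)) (.cell 39 (.reg 58)))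
    (.seq fillProgram
      (.seq detProgram
        (.setCpx 101 (.add (.cell 36 (.reg 57)) (.reg 58)) (.cell 5 (.const 0)))))
    (.setCpx 101 (.add (.cell 36 (.reg 57)) (.reg 58)) (.const 0))

/-- Computes the matrix of column `56`. -/
def transferProgram : Program :=
  .seq (maskTable 34) (.seq digitTables (pairLoop 47 columnEntry))

/-- The tables are prepared once, so that each of the at most `K * K` pairs of states costs one
comparison and, if the states agree outside of the column, one determinant of order at most `R`. -/
theorem transferProgram_run {R K : ℕ} (hb : SizeBound T A D R K) {s : Memory} {x : Fin D.size}
    (hs : AtNode T A D x s) {c : Fin (T.shape.rowLen 0)} (hc : s.nat 56 0 = c)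
    (hμ : s.nat 23 0 = T.shape.colLen c) (hC : HoldsFlags (T.colSet c) s) {k : Fin n → ℕ}
    (hk : ∀ v : Fin n, s.nat 30 v = k v) (hkd : ∀ v ∈ T.colSet c, k v < d) :
    Run transferProgram s (30000000000000 * (R ^ 3 * (K * K))) fun s' =>
      ∀ i < bagDim A (D.bag x), ∀ j < bagDim A (D.bag x),
      s'.cpx 101 (0 + (i * bagDim A (D.bag x) + j)) =
        T.transfer A k c (bagState A (D.bag x) i) (bagState A (D.bag x) j) := by
  have hR1 := hb.one_le
  have hK1 := hb.one_le_K
  have hμm := T.colLen_le c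
  set N := bagDim A (D.bag x) with hN
  have key : Run transferProgram s (3000000 * (R * K) + (500000000 * (R * (R * K)) +
      40000 * (K * (K * (30 + (2000000 * (R * R) + (500000000 * R ^ 3 + 30))))))) fun s' =>
      ∀ i < N, ∀ j < N, s'.cpx 101 (0 + (i * N + j)) =
        T.transfer A k c (bagState A (D.bag x) i) (bagState A (D.bag x) j) := by
    refine (maskTable_run (s := s) (A := A) (B := D.bag x) (C := T.colSet c) (P := 34) (R := R)
      (K := K) hs.setup.input.n_eq hb.n_le hR1 (hb.dim_le x) hC hs.node.place).seq ?_
    intro s1 hf1 h1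
    have hs1 := hs.frame hf1 ⟨⟨by decide, rfl⟩, by decide⟩
    have hc1 : s1.nat 56 0 = c := by rw [hf1.nat 56 rfl, hc]
    have hμ1 : s1.nat 23 0 = T.shape.colLen c := by rw [hf1.nat 23 rfl, hμ]
    refine (digitTables_run hb hs1 hc1 hμ1).seq ?_
    intro s2 hf2 h2
    have hs2 : AtColumn A D x c k s2 := ⟨hs1.frame hf2 ⟨⟨by decide, rfl⟩, by decide⟩,
      by rw [hf2.nat 56 rfl, hc1], by rw [hf2.nat 23 rfl, hμ1],
      fun v => by rw [hf2.nat 30 rfl, hf1.nat 30 rfl, hk], h2⟩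
    have h39 : s2.nat 39 = s1.nat 39 := hf2.nat 39 rfl
    refine (pairLoop_run (s := s2) (o := 0) (arr := 101) (K := N) (val := fun i j =>
      T.transfer A k c (bagState A (D.bag x) i) (bagState A (D.bag x) j)) hs2.node.node.dim
      (hb.dim_le x) hK1 (by omega) ?_).mono le_rfl fun _ _ h => h.1
    intro i hi j hj s3 hn3 hc3 hi3 hj3
    have hf3 : (pairLoop 47 columnEntry).Frame s2 s3 := Frame.pairLoop hn3 hc3
    have hs3 := hs2.frame hf3 ⟨⟨by decide, rfl⟩, by decide⟩ (by decide)
    have hiff : (Test.natEq (.cell 39 (.reg 57)) (.cell 39 (.reg 58))).Holds s3 ↔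
        ∀ v ∉ T.colSet c, bagState A (D.bag x) i v = bagState A (D.bag x) j v := by
      simp only [Test.Holds, NatExpr.val, NatExpr.val_reg, hi3, hj3, hf3.nat 39 rfl, h39]
      exact h1 i hi j hj
    refine Run.branch ?_ ?_
    · intro h
      rw [hiff] at h
      refine (fillProgram_run hb hs3 hkd hi hj hi3 hj3).seq ?_
      intro s4 hf4 h4
      have hs4 := hs3.frame hf4 ⟨⟨by decide, rfl⟩, by decide⟩ (by decide)
      rw [← hs4.length] at h4
      refine (detProgram_run (s := s4) hs4.node.setup.row (by rw [hs4.length]; exact hμm) hb.m_le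
        hR1 h4).seq ?_
      intro s5 hf5 h5
      rw [hs4.length, squareDet_labelEntry k c h] at h5
      have hs5 := hs4.frame hf5 ⟨⟨by decide, rfl⟩, by decide⟩ (by decide)
      have hi5 : s5.nat 57 0 = i := by rw [hf5.nat 57 rfl, hf4.nat 57 rfl, hi3]
      have hj5 : s5.nat 58 0 = j := by rw [hf5.nat 58 rfl, hf4.nat 58 rfl, hj3]
      have h101 : s5.cpx 101 = s3.cpx 101 := by rw [hf5.cpx 101 rfl, hf4.cpx 101 rfl]
      refine Run.setCpx ?_
      simp only [NatExpr.val, NatExpr.val_reg, CpxExpr.val, hi5, hj5, hs5.node.node.row i hi, h5,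
        zero_add, Memory.setCpx_cpx_apply, true_and, h101]
      exact ⟨if_pos rfl, fun p hp => if_neg hp⟩
    · intro h
      rw [hiff] at h
      refine (Run.setCpx ?_).mono_time (by omega)
      simp only [NatExpr.val, NatExpr.val_reg, CpxExpr.val, hi3, hj3, hs3.node.node.row i hi,
        zero_add, Memory.setCpx_cpx_apply, true_and]
      refine ⟨?_, fun p hp => if_neg hp⟩
      rw [← hN, if_pos rfl, RectTableau.transfer, Matrix.of_apply, if_neg h]
  refine key.mono_time ?_
  obtain ⟨h1, h2, h3, h4, h5, h6, h7, h8⟩ := size_bounds hR1 hK1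
  have h9 : K * (K * (30 + (2000000 * (R * R) + (500000000 * R ^ 3 + 30)))) ≤
      K * (K * (600000000 * R ^ 3)) :=
    Nat.mul_le_mul_left _ (Nat.mul_le_mul_left _ (by omega))
  have h10 : K * (K * (600000000 * R ^ 3)) = 600000000 * (R ^ 3 * (K * K)) := by ring
  omega

/-- Multiplies the matrix of the current node by the matrix of column `56`. -/
def columnProgram (mm : Program) : Program :=
  .seq transferProgram
    (.seq (mulProgram mm 48 47 49)
      (.seq (.forN 61 0 0
          (.setNat 30 (.reg 61) (.add (.cell 30 (.reg 61)) (.cell 43 (.reg 61)))))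
        (.setNat 29 (.reg 56) (.const 1))))

/-- The block of array `2` that starts in cell `o` holds the product of the matrices of the columns
in `L`, after the columns in `pre`, restricted to the states that are supported in `B`. -/
def HoldsSegment (T : RectTableau n d m) (A : NcABP d m) (B : Finset (Fin n))
    (pre L : List (Fin (T.shape.rowLen 0))) (o : ℕ) (s : Memory) : Prop :=
  ∀ i < bagDim A B, ∀ j < bagDim A B, s.cpx 2 (o + (i * bagDim A B + j)) =
    T.segment A pre L (bagState A B i) (bagState A B j)

theorem columnProgram_run {R K TM : ℕ} {mm : Program} (hmm : MatMulBound mm K TM)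
    (hb : SizeBound T A D R K) {s : Memory} {x : Fin D.size}
    (hs : AtNode T A D x s) {c : Fin (T.shape.rowLen 0)} (hc : s.nat 56 0 = c)
    (hμ : s.nat 23 0 = T.shape.colLen c) (hC : HoldsFlags (T.colSet c) s)
    {pre L : List (Fin (T.shape.rowLen 0))} (hnd : (c :: (L ++ pre)).Nodup)
    (hcx : T.colSet c ⊆ D.bag x)
    (hk : ∀ v : Fin n, s.nat 30 v = T.count (L ++ pre) v) {o : ℕ} (ho : s.nat 48 0 = o)
    (hacc : HoldsSegment T A (D.bag x) pre L o s) :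
    Run (columnProgram mm) s (40000000000000 * (R ^ 3 * (K * K)) + TM) fun s' =>
      HoldsSegment T A (D.bag x) pre (c :: L) o s' ∧ (∀ p < o, s'.cpx 2 p = s.cpx 2 p) ∧
      (∀ v : Fin n, s'.nat 30 v = T.count (c :: (L ++ pre)) v) ∧ s'.nat 29 c = 1 ∧
      ∀ c' ≠ (c : ℕ), s'.nat 29 c' = s.nat 29 c' := by
  classical
  have hR1 := hb.one_le
  have hK1 := hb.one_le_K
  -- Including the new column, a number occurs in at most `d` distinct columns, so a copy that must
  -- advance has not reached the last layer.
  have hkd : ∀ v ∈ T.colSet c, T.count (L ++ pre) v < d := by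
    intro v hv
    have := T.count_le hnd v
    rw [T.count_cons, if_pos hv] at this
    omega
  set N := bagDim A (D.bag x) with hN
  have key : Run (columnProgram mm) s (30000000000000 * (R ^ 3 * (K * K)) +
      ((20000 * (K * K) + TM) + (200 * (R * 30) + 30))) fun s' =>
      HoldsSegment T A (D.bag x) pre (c :: L) o s' ∧ (∀ p < o, s'.cpx 2 p = s.cpx 2 p) ∧
      (∀ v : Fin n, s'.nat 30 v = T.count (c :: (L ++ pre)) v) ∧ s'.nat 29 c = 1 ∧
      ∀ c' ≠ (c : ℕ), s'.nat 29 c' = s.nat 29 c' := by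
    refine (transferProgram_run hb hs hc hμ hC hk hkd).seq ?_
    intro s1 hf1 h1
    have hs1 := hs.frame hf1 ⟨⟨by decide, rfl⟩, by decide⟩
    refine (mulProgram_run hmm (o := 48) (Kr := 47) (Ks := 49) (s := s1) (K := N) (b := o)
      (X := fun i j => T.segment A pre L (bagState A (D.bag x) i) (bagState A (D.bag x) j))
      (Y := fun i j => T.transfer A (T.count (L ++ pre)) c (bagState A (D.bag x) i)
        (bagState A (D.bag x) j)) hs1.node.dim hs1.node.sq (by rw [hf1.nat 48 rfl, ho])
      (bagDim_pos A _) (hb.dim_le x) (by rw [hf1.cpx 2 rfl]; exact hacc) h1).seq ?_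
    rintro s2 hf2 ⟨h2, h2'⟩
    have e2 : ∀ a < 100, a ≠ 20 → s2.nat a = s1.nat a := fun a ha ha' =>
      hf2.nat a (mulProgram_natFree mm ha ha')
    have hn2 : s2.nat 0 0 = n := by
      rw [e2 0 (by decide) (by decide), hs1.setup.input.n_eq]
    refine Run.seq (R := fun s3 => ∀ v : Fin n, s3.nat 30 v = T.count (c :: (L ++ pre)) v) ?_ ?_
    · refine Run.forN (fun l s3 => ∀ v : Fin n, s3.nat 30 v = T.count (L ++ pre) v +
        if v ∈ T.colSet c ∧ (v : ℕ) < l then 1 else 0) (by rw [hn2]; exact hb.n_le) hR1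
        (by norm_num) ?_ ?_ ?_
      · intro v
        rw [Memory.setNat_nat_ne _ _ _ (by decide), e2 30 (by decide) (by decide), hf1.nat 30 rfl,
          hk]
        simp
      · intro l hl s3 hf3 hl3 hinv
        rw [hn2] at hl
        refine Run.setNat fun v => ?_
        have h43 : s3.nat 43 l = if (⟨l, hl⟩ : Fin n) ∈ T.colSet c then 1 else 0 := by
          rw [hf3.nat 43 rfl, e2 43 (by decide) (by decide), hf1.nat 43 rfl]
          exact hC ⟨l, hl⟩
        have hinvl := hinv ⟨l, hl⟩
        simp only [NatExpr.val, NatExpr.val_reg, hl3, h43] at hinvl ⊢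
        rw [Memory.setNat_nat_ne _ _ _ (by decide), Memory.setNat_nat_apply]
        by_cases hv : (v : ℕ) = l
        · obtain rfl : v = ⟨l, hl⟩ := Fin.ext hv
          rw [if_pos ⟨rfl, rfl⟩, hinvl]
          simp
        · rw [if_neg fun h => hv h.2, hinv v]
          have : (v : ℕ) < l + 1 ↔ (v : ℕ) < l := by omega
          simp only [this]
      · intro s3 _ hinv v
        rw [hn2] at hinv
        rw [hinv v, T.count_cons]
        simp
    · intro s3 hf3 h3
      refine Run.setNat ?_
      have hc3 : s3.nat 56 0 = c := by
        rw [hf3.nat 56 rfl, e2 56 (by decide) (by decide), hf1.nat 56 rfl, hc]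
      have hc2 : s3.cpx 2 = s2.cpx 2 := hf3.cpx 2 rfl
      simp only [NatExpr.val, NatExpr.val_reg, hc3]
      refine ⟨?_, ?_, ?_, ?_, ?_⟩
      · intro i hi j hj
        rw [Memory.setNat_cpx, hc2, h2 i hi j hj]
        -- Numbers outside of the bag are not in column `c`, so the product of the small matrices is
        -- the product of the full ones on supported states.
        have := T.segment_append_apply A pre L [c] (B := D.bag x)
          (fun v hv => Or.inr (by simpa using fun h => hv (hcx h)))
          (supportedIn_bagState A i) (supportedIn_bagState A j)
        rw [sum_bagState] at this
        simp only [List.singleton_append, RectTableau.segment, Matrix.one_mul,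
          List.nil_append] at this
        exact this.symm
      · intro p hp
        rw [Memory.setNat_cpx, hc2, h2' p hp, hf1.cpx 2 rfl]
      · intro v
        rw [Memory.setNat_nat_ne _ _ _ (by decide), h3]
      · simp
      · intro c' hc'
        rw [Memory.setNat_nat_apply, if_neg fun h => hc' h.2, hf3.nat 29 rfl,
          e2 29 (by decide) (by decide), hf1.nat 29 rfl]
  refine key.mono_time ?_
  obtain ⟨h1, h2, h3, h4, h5, h6, h7, h8⟩ := size_bounds hR1 hK1
  omega

/-! ### The product of the matrices of a node and of its parent -/

/-- Loads the bag of the current node. -/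
def bagFlags : Program :=
  .forN 61 0 0 (.setNat 43 (.reg 61) (.cell 5 (.add (.reg 46) (.reg 61))))

theorem bagFlags_run {R K : ℕ} (hb : SizeBound T A D R K) {s : Memory} {y : Fin D.size}
    (hs : AtNode T A D y s) : Run bagFlags s (6000 * R) (HoldsFlags (D.bag y)) := by
  have hn := hs.setup.input.n_eq
  have key : Run bagFlags s (200 * (R * 30)) (HoldsFlags (D.bag y)) := by
    refine Run.forN (fun l s' => ∀ v : Fin n, (v : ℕ) < l → s'.nat 43 v =
      if v ∈ D.bag y then 1 else 0) (by rw [hn]; exact hb.n_le) hb.one_le (by norm_num) (by simp)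
      ?_ ?_
    · intro l hl s1 hf1 hl1 hinv
      rw [hn] at hl
      have hs1 := hs.frame hf1 ⟨⟨by decide, rfl⟩, by decide⟩
      refine Run.setNat fun v hv => ?_
      simp only [NatExpr.val, NatExpr.val_reg, hl1, hs1.node.base]
      rw [Memory.setNat_nat_ne _ _ _ (by decide), Memory.setNat_nat_apply]
      by_cases hvl : (v : ℕ) = l
      · rw [if_pos ⟨rfl, hvl⟩, ← hvl, hs1.setup.input.bag_eq]
      · rw [if_neg fun h => hvl h.2]
        exact hinv v (by omega)
    · intro s' _ h v
      rw [hn] at h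
      exact h v v.2
  exact key.mono_time (by omega)

/-- Computes an entry of the matrix of the current node on the states of the parent. -/
def mergeEntry : Program :=
  .branch (.natEq (.cell 39 (.reg 57)) (.cell 39 (.reg 58)))
    (.setCpx 101 (.add (.cell 37 (.reg 57)) (.reg 58))
      (.cell 2 (.add (.reg 48) (.add (.cell 36 (.cell 40 (.reg 57))) (.cell 40 (.reg 58))))))
    (.setCpx 101 (.add (.cell 37 (.reg 57)) (.reg 58)) (.const 0))

/-- Multiplies the matrix of the parent by the matrix of the current node. -/
def mergeProgram (mm : Program) : Program :=
  .seq (.setNat 51 (.const 0) (.cell 31 (.sub (.reg 33) (.const 2))))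
    (.seq (loadNode 51 52 35 53 37 55)
      (.seq (.setNat 54 (.const 0) (.cell 32 (.sub (.reg 33) (.const 2))))
        (.seq bagFlags
          (.seq (maskTable 35)
            (.seq (codeTable 35 34) (.seq (pairLoop 53 mergeEntry) (mulProgram mm 54 53 55)))))))

/-- The matrix of the child is first rewritten on the states of the parent: the entry is 0 unless
the two states agree outside of the child's bag, and then it is looked up at their restrictions to
that bag. This is `segment_restrict`; `segment_append_apply` justifies the multiplication that
follows. The parent is at position `height - 2` of the stack. -/
theorem mergeProgram_run {R K TM : ℕ} {mm : Program} (hmm : MatMulBound mm K TM)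
    (hb : SizeBound T A D R K) {s : Memory} {x y : Fin D.size} (hs : AtNode T A D y s)
    {pre L L' : List (Fin (T.shape.rowLen 0))} {o o' : ℕ} (hx : s.nat 31 (s.nat 33 0 - 2) = x)
    (ho : s.nat 32 (s.nat 33 0 - 2) = o) (ho' : s.nat 48 0 = o')
    (hacc : HoldsSegment T A (D.bag x) pre L o s)
    (hacc' : HoldsSegment T A (D.bag y) (L ++ pre) L' o' s)
    (hL' : ∀ c ∈ L', ∀ v ∈ T.colSet c, v ∈ D.bag x → v ∈ D.bag y)
    (hL : ∀ v ∉ D.bag x, (∀ c ∈ L, v ∉ T.colSet c) ∨ ∀ c ∈ L', v ∉ T.colSet c) :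
    Run (mergeProgram mm) s (40000000000000 * (R ^ 3 * (K * K)) + TM) fun s' =>
      HoldsSegment T A (D.bag x) pre (L' ++ L) o s' ∧ ∀ p < o, s'.cpx 2 p = s.cpx 2 p := by
  classical
  have hR1 := hb.one_le
  have hK1 := hb.one_le_K
  set N := bagDim A (D.bag x) with hN
  have key : Run (mergeProgram mm) s (30 + (3000000 * (R * K) + (30 + (6000 * R +
      (3000000 * (R * K) + (3000000 * (R * K) + (40000 * (K * (K * (30 + 30))) +
      (20000 * (K * K) + TM)))))))) fun s' =>
      HoldsSegment T A (D.bag x) pre (L' ++ L) o s' ∧ ∀ p < o, s'.cpx 2 p = s.cpx 2 p := by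
    refine Run.setNat_seq' fun s1 hf1 h1 _ => ?_
    simp only [NatExpr.val, NatExpr.val_reg, hx] at h1
    have hs1 := hs.frame hf1 ⟨⟨by decide, rfl⟩, by decide⟩
    refine (loadNode_run hb hs1.setup x h1).seq fun s2 hf2 h2 => ?_
    have hs2 := hs1.frame hf2 ⟨⟨by decide, rfl⟩, by decide⟩
    refine Run.setNat_seq' fun s3 hf3 h3 _ => ?_
    simp only [NatExpr.val, NatExpr.val_reg, hf2.nat 33 rfl, hf1.nat 33 rfl, hf2.nat 32 rfl,
      hf1.nat 32 rfl, ho] at h3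
    have hs3 := hs2.frame hf3 ⟨⟨by decide, rfl⟩, by decide⟩
    have h3' := h2.congr (hf3.nat 52 rfl) (hf3.nat 35 rfl) (hf3.nat 53 rfl) (hf3.nat 37 rfl)
      (hf3.nat 55 rfl)
    refine (bagFlags_run hb hs3).seq fun s4 hf4 h4 => ?_
    have hs4 := hs3.frame hf4 ⟨⟨by decide, rfl⟩, by decide⟩
    have h4' := h3'.congr (hf4.nat 52 rfl) (hf4.nat 35 rfl) (hf4.nat 53 rfl) (hf4.nat 37 rfl)
      (hf4.nat 55 rfl)
    refine (maskTable_run (s := s4) (P := 35) hs4.setup.input.n_eq hb.n_le hR1 (hb.dim_le x) h4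
      h4'.place).seq fun s5 hf5 h5 => ?_
    have hs5 := hs4.frame hf5 ⟨⟨by decide, rfl⟩, by decide⟩
    have h5' := h4'.congr (hf5.nat 52 rfl) (hf5.nat 35 rfl) (hf5.nat 53 rfl) (hf5.nat 37 rfl)
      (hf5.nat 55 rfl)
    have hfl : HoldsFlags (D.bag y) s5 := by
      intro v
      rw [hf5.nat 43 rfl]
      exact h4 v
    refine (codeTable_run (s := s5) (P := 35) (P' := 34) hs5.setup.input.n_eq hb.n_le hR1
      (hb.dim_le x) hfl h5'.place hs5.node.place).seq fun s6 hf6 h6 => ?_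
    have hs6 := hs5.frame hf6 ⟨⟨by decide, rfl⟩, by decide⟩
    have h6' := h5'.congr (hf6.nat 52 rfl) (hf6.nat 35 rfl) (hf6.nat 53 rfl) (hf6.nat 37 rfl)
      (hf6.nat 55 rfl)
    have e6 : s6.cpx 2 = s.cpx 2 := by
      rw [hf6.cpx 2 rfl, hf5.cpx 2 rfl, hf4.cpx 2 rfl, hf3.cpx 2 rfl, hf2.cpx 2 rfl,
        hf1.cpx 2 rfl]
    have h48 : s6.nat 48 0 = o' := by
      rw [hf6.nat 48 rfl, hf5.nat 48 rfl, hf4.nat 48 rfl, hf3.nat 48 rfl, hf2.nat 48 rfl,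
        hf1.nat 48 rfl, ho']
    refine (pairLoop_run (s := s6) (o := 0) (arr := 101) (K := N) (val := fun i j =>
      T.segment A (L ++ pre) L' (bagState A (D.bag x) i) (bagState A (D.bag x) j)) h6'.dim
      (hb.dim_le x) hK1 (by omega) ?_).seq ?_
    · intro i hi j hj s7 hn7 hc7 hi7 hj7
      have hf7 : (pairLoop 53 mergeEntry).Frame s6 s7 := Frame.pairLoop hn7 hc7
      have hs7 := hs6.frame hf7 ⟨⟨by decide, rfl⟩, by decide⟩
      have h7' := h6'.congr (hf7.nat 52 rfl) (hf7.nat 35 rfl) (hf7.nat 53 rfl) (hf7.nat 37 rfl)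
        (hf7.nat 55 rfl)
      have hiff : (Test.natEq (.cell 39 (.reg 57)) (.cell 39 (.reg 58))).Holds s7 ↔
          ∀ v ∉ D.bag y, bagState A (D.bag x) i v = bagState A (D.bag x) j v := by
        simp only [Test.Holds, NatExpr.val, NatExpr.val_reg, hi7, hj7, hf7.nat 39 rfl,
          hf6.nat 39 rfl]
        exact h5 i hi j hj
      have hseg := T.segment_restrict A (L ++ pre) L' hL' (supportedIn_bagState A (B := D.bag x) i)
        (supportedIn_bagState A j)
      have h40 : s7.nat 40 = s6.nat 40 := hf7.nat 40 rfl
      obtain ⟨hlt, heq⟩ := h6 i hi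
      obtain ⟨hlt', heq'⟩ := h6 j hj
      refine Run.branch ?_ ?_
      · intro h
        rw [hiff] at h
        rw [if_pos h, ← heq, ← heq'] at hseg
        refine Run.setCpx ?_
        simp only [NatExpr.val, NatExpr.val_reg, CpxExpr.val, hi7, hj7, h7'.row i hi, h40,
          hs7.node.row _ hlt, hf7.nat 48 rfl, h48, zero_add, Memory.setCpx_cpx_apply, true_and,
          hf7.cpx 2 rfl, e6]
        refine ⟨?_, fun p hp => if_neg hp⟩
        rw [← hN, if_pos rfl, hseg]
        exact hacc' _ hlt _ hlt'
      · intro h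
        rw [hiff] at h
        rw [if_neg h] at hseg
        refine Run.setCpx ?_
        simp only [NatExpr.val, NatExpr.val_reg, CpxExpr.val, hi7, hj7, h7'.row i hi, zero_add,
          Memory.setCpx_cpx_apply, true_and]
        refine ⟨?_, fun p hp => if_neg hp⟩
        rw [← hN, if_pos rfl, hseg]
    · rintro s7 hf7 ⟨h7, -⟩
      have h7' := h6'.congr (hf7.nat 52 rfl) (hf7.nat 35 rfl) (hf7.nat 53 rfl) (hf7.nat 37 rfl)
        (hf7.nat 55 rfl)
      have h54 : s7.nat 54 0 = o := by
        rw [hf7.nat 54 rfl, hf6.nat 54 rfl, hf5.nat 54 rfl, hf4.nat 54 rfl, h3]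
      have e7 : s7.cpx 2 = s.cpx 2 := by rw [hf7.cpx 2 rfl, e6]
      refine (mulProgram_run hmm (o := 54) (Kr := 53) (Ks := 55) (s := s7) (K := N) (b := o)
        (X := fun i j => T.segment A pre L (bagState A (D.bag x) i) (bagState A (D.bag x) j))
        (Y := fun i j => T.segment A (L ++ pre) L' (bagState A (D.bag x) i)
          (bagState A (D.bag x) j)) h7'.dim h7'.sq h54 (bagDim_pos A _) (hb.dim_le x)
        (by rw [e7]; exact hacc) h7).mono le_rfl ?_
      rintro s8 - ⟨h8, h8'⟩
      refine ⟨fun i hi j hj => ?_, fun p hp => by rw [h8' p hp, e7]⟩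
      rw [h8 i hi j hj]
      have := T.segment_append_apply A pre L L' hL (supportedIn_bagState A i)
        (supportedIn_bagState A j)
      rw [sum_bagState] at this
      exact this.symm
  refine key.mono_time ?_
  obtain ⟨h1, h2, h3, h4, h5, h6, h7, h8⟩ := size_bounds hR1 hK1
  have h9 : K * (K * (30 + 30)) = 60 * (K * K) := by ring
  omega

end merge

/-! ### The search through the tree -/

/-- Frame conditions of a program that contains a variable `mm` cannot be evaluated. Relocated, `mm`
assigns only to arrays from `100` on, so below that it may be replaced by `skip`, and the resulting
closed term can be evaluated. -/
theorem mulProgram_natFree_congr (mm : Program) {o Kr Ks a : ℕ} (ha : a < 100) :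
    (mulProgram mm o Kr Ks).natFree a = (mulProgram .skip o Kr Ks).natFree a := by
  simp [mulProgram, natFree, natFree_shift ha]

theorem mulProgram_cpxFree_congr (mm : Program) {o Kr Ks a : ℕ} (ha : a < 100) :
    (mulProgram mm o Kr Ks).cpxFree a = (mulProgram .skip o Kr Ks).cpxFree a := by
  simp [mulProgram, cpxFree, cpxFree_shift ha]

theorem columnProgram_natFree_congr (mm : Program) {a : ℕ} (ha : a < 100) :
    (columnProgram mm).natFree a = (columnProgram .skip).natFree a := by
  simp only [columnProgram, natFree, mulProgram_natFree_congr mm ha]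

theorem columnProgram_cpxFree_congr (mm : Program) {a : ℕ} (ha : a < 100) :
    (columnProgram mm).cpxFree a = (columnProgram .skip).cpxFree a := by
  simp only [columnProgram, cpxFree, mulProgram_cpxFree_congr mm ha]

theorem mergeProgram_natFree_congr (mm : Program) {a : ℕ} (ha : a < 100) :
    (mergeProgram mm).natFree a = (mergeProgram .skip).natFree a := by
  simp only [mergeProgram, natFree, mulProgram_natFree_congr mm ha]

theorem mergeProgram_cpxFree_congr (mm : Program) {a : ℕ} (ha : a < 100) :
    (mergeProgram mm).cpxFree a = (mergeProgram .skip).cpxFree a := by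
  simp only [mergeProgram, cpxFree, mulProgram_cpxFree_congr mm ha]

theorem Program.KeepsSetup.congr {P P' : Program} (h : P'.KeepsSetup)
    (hn : ∀ a < 100, P.natFree a = P'.natFree a) (hc : ∀ a < 100, P.cpxFree a = P'.cpxFree a) :
    P.KeepsSetup :=
  ⟨fun a ha => (hn a (by omega)).trans (h.1 a ha), (hc 0 (by norm_num)).trans h.2⟩

/-- Processes the columns that are contained in the bag of the current node. -/
def columnsProgram (mm : Program) : Program :=
  .forN 56 0 3 (.branch (.natEq (.cell 29 (.reg 56)) (.const 0))
    (.seq flagsProgram (.branch (.natEq (.reg 44) (.const 1)) (columnProgram mm) .skip)) .skip)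

theorem columnsProgram_natFree_congr (mm : Program) {a : ℕ} (ha : a < 100) :
    (columnsProgram mm).natFree a = (columnsProgram .skip).natFree a := by
  simp only [columnsProgram, Program.forN, natFree, columnProgram_natFree_congr mm ha]

theorem columnsProgram_cpxFree_congr (mm : Program) {a : ℕ} (ha : a < 100) :
    (columnsProgram mm).cpxFree a = (columnsProgram .skip).cpxFree a := by
  simp only [columnsProgram, Program.forN, cpxFree, columnProgram_cpxFree_congr mm ha]

theorem columnsProgram_keepsNode (mm : Program) : (columnsProgram mm).KeepsNode := by
  refine ⟨Program.KeepsSetup.congr (P' := columnsProgram .skip) ⟨by decide, rfl⟩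
    (fun a ha => columnsProgram_natFree_congr mm ha)
    (fun a ha => columnsProgram_cpxFree_congr mm ha), fun a ha => ?_⟩
  have h1 : a < 100 := by
    revert a
    decide
  rw [columnsProgram_natFree_congr mm h1]
  revert a
  decide

theorem columnProgram_keepsSetup (mm : Program) : (columnProgram mm).KeepsSetup :=
  Program.KeepsSetup.congr (P' := columnProgram .skip) ⟨by decide, rfl⟩
    (fun a ha => columnProgram_natFree_congr mm ha)
    (fun a ha => columnProgram_cpxFree_congr mm ha)

theorem mergeProgram_keepsSetup (mm : Program) : (mergeProgram mm).KeepsSetup :=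
  Program.KeepsSetup.congr (P' := mergeProgram .skip) ⟨by decide, rfl⟩
    (fun a ha => mergeProgram_natFree_congr mm ha)
    (fun a ha => mergeProgram_cpxFree_congr mm ha)

section search

variable {n d m : ℕ} {T : RectTableau n d m} {A : NcABP d m} {D : TreeDecomposition T.columnGraph}

theorem HoldsSegment.congr {B : Finset (Fin n)} {pre L : List (Fin (T.shape.rowLen 0))} {o o' : ℕ}
    {s s' : Memory} (h : HoldsSegment T A B pre L o s) (ho : o' = o)
    (hs : ∀ p < o + bagDim A B * bagDim A B, s'.cpx 2 p = s.cpx 2 p) :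
    HoldsSegment T A B pre L o' s' := by
  subst ho
  intro i hi j hj
  have := (pair_lt_iff (i := i) (i' := bagDim A B) hj (bagDim_pos A B)).2 (Or.inl hi)
  rw [hs _ (by omega)]
  exact h i hi j hj

/-- The arrays `31` and `32` hold the nodes of the stack and the offsets of their matrices in
array `2`. -/
def HoldsFrames (A : NcABP d m) (s : Memory) :
    List (Fin D.size × List (Fin (T.shape.rowLen 0))) → Prop
  | [] => True
  | (y, L) :: fr => s.nat 31 fr.length = y ∧
      s.nat 32 (fr.length + 1) = s.nat 32 fr.length + bagDim A (D.bag y) * bagDim A (D.bag y) ∧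
      -- The columns in the frames below come first in the global order, and they determine the
      -- layers in which this block starts.
      HoldsSegment T A (D.bag y) (allCols fr) L (s.nat 32 fr.length) s ∧ HoldsFrames A s fr

theorem HoldsFrames.congr {s s' : Memory} {fr : List (Fin D.size × List (Fin (T.shape.rowLen 0)))}
    (h : HoldsFrames A s fr) (h31 : ∀ i < fr.length, s'.nat 31 i = s.nat 31 i)
    (h32 : ∀ i ≤ fr.length, s'.nat 32 i = s.nat 32 i)
    (h2 : ∀ p < s.nat 32 fr.length, s'.cpx 2 p = s.cpx 2 p) : HoldsFrames A s' fr := by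
  induction fr with
  | nil => trivial
  | cons f fr ih =>
    obtain ⟨y, L⟩ := f
    obtain ⟨g1, g2, g3, g4⟩ := h
    simp only [List.length_cons] at h31 h32 h2
    rw [g2] at h2
    refine ⟨?_, ?_, ?_, ih g4 (fun i hi => h31 i (by omega)) (fun i hi => h32 i (by omega))
      fun p hp => h2 p (by omega)⟩
    · rw [h31 _ (by omega), g1]
    · rw [h32 _ le_rfl, h32 _ (by omega), g2]
    · exact g3.congr (h32 _ (by omega)) h2

/-- The memory holds the state of the depth first search. -/
structure HoldsSearch (A : NcABP d m) (s : Memory)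
    (fr : List (Fin D.size × List (Fin (T.shape.rowLen 0)))) (V : Finset (Fin D.size)) : Prop where
  setup : Setup T A D s
  frames : HoldsFrames A s fr
  depth : s.nat 33 0 = fr.length
  visited : ∀ x : Fin D.size, s.nat 28 x = if x ∈ V then 1 else 0
  done : ∀ c : Fin (T.shape.rowLen 0), s.nat 29 c = if c ∈ allCols fr then 1 else 0
  count : ∀ v : Fin n, s.nat 30 v = T.count (allCols fr) v

theorem HoldsSearch.frame {s s' : Memory} {fr : List (Fin D.size × List (Fin (T.shape.rowLen 0)))}
    {V : Finset (Fin D.size)} {P : Program} (h : HoldsSearch A s fr V) (hf : P.Frame s s')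
    (hP : P.KeepsSetup) (hP' : ∀ a ∈ [28, 29, 30, 31, 32, 33], P.natFree a = true)
    (hc : P.cpxFree 2 = true) : HoldsSearch A s' fr V := by
  obtain ⟨h1, h2, h3, h4, h5, h6⟩ := h
  have e : ∀ a ∈ [28, 29, 30, 31, 32, 33], s'.nat a = s.nat a := fun a ha => hf.nat a (hP' a ha)
  refine ⟨h1.frame hf hP, h2.congr (fun i _ => by rw [e 31 (by decide)])
    (fun i _ => by rw [e 32 (by decide)]) (fun p _ => by rw [hf.cpx 2 hc]), ?_, ?_, ?_, ?_⟩
  · rw [e 33 (by decide), h3]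
  · rw [e 28 (by decide)]; exact h4
  · rw [e 29 (by decide)]; exact h5
  · rw [e 30 (by decide)]; exact h6

/-- Writes an entry of the identity matrix. -/
def identityEntry : Program :=
  .branch (.natEq (.reg 57) (.reg 58))
    (.setCpx 2 (.add (.reg 48) (.add (.cell 36 (.reg 57)) (.reg 58))) (.const 1))
    (.setCpx 2 (.add (.reg 48) (.add (.cell 36 (.reg 57)) (.reg 58))) (.const 0))

/-- Pushes the node in register `50`. -/
def openProgram : Program :=
  .seq (.setNat 28 (.reg 50) (.const 1))
    (.seq (.setNat 31 (.reg 33) (.reg 50))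
      (.seq (loadNode 50 46 34 47 36 49)
        (.seq (.setNat 48 (.const 0) (.cell 32 (.reg 33)))
          (.seq (.setNat 32 (.add (.reg 33) (.const 1)) (.add (.reg 48) (.reg 49)))
            (.seq (pairLoop 47 identityEntry)
              (.setNat 33 (.const 0) (.add (.reg 33) (.const 1))))))))

theorem openProgram_run {R K : ℕ} (hb : SizeBound T A D R K) {s : Memory} {y : Fin D.size}
    {fr : List (Fin D.size × List (Fin (T.shape.rowLen 0)))} {V : Finset (Fin D.size)}
    (hs : HoldsSearch A s fr V) (hy : s.nat 50 0 = y) :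
    Run openProgram s (10000000 * (R ^ 3 * (K * K)))
      fun s' => HoldsSearch A s' ((y, []) :: fr) (insert y V) := by
  have hR1 := hb.one_le
  have hK1 := hb.one_le_K
  set N := bagDim A (D.bag y) with hN
  have key : Run openProgram s (30 + (30 + (3000000 * (R * K) + (30 + (30 +
      (40000 * (K * (K * (30 + 30))) + 30))))))
      fun s' => HoldsSearch A s' ((y, []) :: fr) (insert y V) := by
    refine Run.setNat_seq' fun s1 hf1 h1 h1' => ?_
    simp only [NatExpr.val, NatExpr.val_reg, hy] at h1 h1'
    have hs1 := hs.setup.frame hf1 ⟨by decide, rfl⟩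
    refine Run.setNat_seq' fun s2 hf2 h2 h2' => ?_
    simp only [NatExpr.val_reg, hf1.nat 50 rfl, hy, hf1.nat 33 rfl, hs.depth] at h2 h2'
    have hs2 := hs1.frame hf2 ⟨by decide, rfl⟩
    have h50 : s2.nat 50 0 = y := by rw [hf2.nat 50 rfl, hf1.nat 50 rfl, hy]
    refine (loadNode_run hb hs2 y h50).seq fun s3 hf3 h3 => ?_
    have hs3 : AtNode T A D y s3 := ⟨hs2.frame hf3 ⟨by decide, rfl⟩, h3⟩
    have h33 : s3.nat 33 0 = fr.length := by
      rw [hf3.nat 33 rfl, hf2.nat 33 rfl, hf1.nat 33 rfl, hs.depth]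
    have h32 : s3.nat 32 = s.nat 32 := by rw [hf3.nat 32 rfl, hf2.nat 32 rfl, hf1.nat 32 rfl]
    refine Run.setNat_seq' fun s4 hf4 h4 _ => ?_
    simp only [NatExpr.val, NatExpr.val_reg, h33, h32] at h4
    have hs4 := hs3.frame hf4 ⟨⟨by decide, rfl⟩, by decide⟩
    refine Run.setNat_seq' fun s5 hf5 h5 h5' => ?_
    simp only [NatExpr.val, NatExpr.val_reg, hf4.nat 33 rfl, h33, hs4.node.sq, h4,
      hf4.nat 32 rfl, h32] at h5 h5'
    have hs5 := hs4.frame hf5 ⟨⟨by decide, rfl⟩, by decide⟩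
    have h48 : s5.nat 48 0 = s.nat 32 fr.length := by rw [hf5.nat 48 rfl, h4]
    have e5 : s5.cpx 2 = s.cpx 2 := by
      rw [hf5.cpx 2 rfl, hf4.cpx 2 rfl, hf3.cpx 2 rfl, hf2.cpx 2 rfl, hf1.cpx 2 rfl]
    refine (pairLoop_run (s := s5) (o := s.nat 32 fr.length) (arr := 2) (K := N)
      (val := fun i j => T.segment A (allCols fr) [] (bagState A (D.bag y) i)
        (bagState A (D.bag y) j)) hs5.node.dim (hb.dim_le y) hK1 (by omega) ?_).seq ?_
    · intro i hi j hj s6 hn6 hc6 hi6 hj6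
      have hf6 : (pairLoop 47 identityEntry).Frame s5 s6 := Frame.pairLoop hn6 hc6
      have hs6 := hs5.frame hf6 ⟨⟨by decide, rfl⟩, by decide⟩
      have hiff : (Test.natEq (.reg 57) (.reg 58)).Holds s6 ↔ i = j := by
        simp [Test.Holds, hi6, hj6]
      -- A new frame has no columns and starts with the identity; distinct indices stand for
      -- distinct states.
      have hone : T.segment A (allCols fr) [] (bagState A (D.bag y) i) (bagState A (D.bag y) j) =
          if i = j then 1 else 0 := by
        rw [RectTableau.segment]
        split_ifs with h
        · rw [h, Matrix.one_apply_eq]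
        · exact Matrix.one_apply_ne fun h' => h (bagState_injOn A hi hj h')
      refine Run.branch ?_ ?_
      · intro h
        rw [hiff] at h
        refine Run.setCpx ?_
        simp only [NatExpr.val, NatExpr.val_reg, CpxExpr.val, hi6, hj6, hs6.node.row i hi,
          hf6.nat 48 rfl, h48, Memory.setCpx_cpx_apply, true_and]
        refine ⟨?_, fun p hp => if_neg hp⟩
        rw [← hN, if_pos rfl, hone, if_pos h]
      · intro h
        rw [hiff] at h
        refine Run.setCpx ?_
        simp only [NatExpr.val, NatExpr.val_reg, CpxExpr.val, hi6, hj6, hs6.node.row i hi,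
          hf6.nat 48 rfl, h48, Memory.setCpx_cpx_apply, true_and]
        refine ⟨?_, fun p hp => if_neg hp⟩
        rw [← hN, if_pos rfl, hone, if_neg h]
    · rintro s6 hf6 ⟨h6, h6'⟩
      refine Run.setNat ?_
      have h33' : s6.nat 33 0 = fr.length := by
        rw [hf6.nat 33 rfl, hf5.nat 33 rfl, hf4.nat 33 rfl, h33]
      simp only [NatExpr.val, NatExpr.val_reg, h33']
      obtain ⟨s7, hs7⟩ : ∃ s7, s7 = s6.setNat 33 0 (fr.length + 1) := ⟨_, rfl⟩
      rw [← hs7]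
      have e7 : ∀ a ≠ 33, s7.nat a = s6.nat a := fun a ha => by
        rw [hs7, Memory.setNat_nat_ne _ _ _ ha]
      have c7 : s7.cpx = s6.cpx := by rw [hs7]; rfl
      have e31 : s7.nat 31 = s2.nat 31 := by
        rw [e7 31 (by decide), hf6.nat 31 rfl, hf5.nat 31 rfl, hf4.nat 31 rfl, hf3.nat 31 rfl]
      have e32 : s7.nat 32 = s5.nat 32 := by rw [e7 32 (by decide), hf6.nat 32 rfl]
      have e28 : s7.nat 28 = s1.nat 28 := by
        rw [e7 28 (by decide), hf6.nat 28 rfl, hf5.nat 28 rfl, hf4.nat 28 rfl, hf3.nat 28 rfl,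
          hf2.nat 28 rfl]
      have e29 : s7.nat 29 = s.nat 29 := by
        rw [e7 29 (by decide), hf6.nat 29 rfl, hf5.nat 29 rfl, hf4.nat 29 rfl, hf3.nat 29 rfl,
          hf2.nat 29 rfl, hf1.nat 29 rfl]
      have e30 : s7.nat 30 = s.nat 30 := by
        rw [e7 30 (by decide), hf6.nat 30 rfl, hf5.nat 30 rfl, hf4.nat 30 rfl, hf3.nat 30 rfl,
          hf2.nat 30 rfl, hf1.nat 30 rfl]
      have h32' : s7.nat 32 fr.length = s.nat 32 fr.length := by
        rw [e32, h5' _ (by omega)]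
      refine ⟨?_, ⟨?_, ?_, ?_, ?_⟩, ?_, ?_, ?_, ?_⟩
      · exact (hs5.setup.frame hf6 ⟨by decide, rfl⟩).congr (fun a ha => e7 a (by omega))
          (by rw [c7])
      · rw [e31, h2]
      · rw [h32', e32, h5]
      · rw [h32']
        intro i hi j hj
        rw [c7, h6 i hi j hj]
      · refine hs.frames.congr (fun i hi => ?_) (fun i hi => ?_) (fun p hp => ?_)
        · rw [e31, h2' i (by omega), hf1.nat 31 rfl]
        · rw [e32, h5' i (by omega)]
        · rw [c7, h6' p hp, e5]
      · rw [hs7]; simp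
      · intro x
        rw [e28]
        by_cases hxy : x = y
        · subst hxy; simp [h1]
        · rw [h1' x fun h => hxy (Fin.ext h), hs.visited x]
          simp [hxy]
      · rw [e29]; exact hs.done
      · rw [e30]; exact hs.count
  refine key.mono_time ?_
  obtain ⟨h1, h2, h3, h4, h5, h6, h7, h8⟩ := size_bounds hR1 hK1
  have h9 : K * (K * (30 + 30)) = 60 * (K * K) := by ring
  omega

/-- A column may fit into several bags; the flags in array `29` ensure that it is taken only once.
Each column costs at most one multiplication, whence the summand `TM` under the factor `R`. -/
theorem columnsProgram_run {R K TM : ℕ} {mm : Program} (hmm : MatMulBound mm K TM)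
    (hb : SizeBound T A D R K) {r : Fin D.size} {ρ : Rooting D.tree r} {s : Memory}
    {y : Fin D.size} {L : List (Fin (T.shape.rowLen 0))}
    {fr : List (Fin D.size × List (Fin (T.shape.rowLen 0)))} {V : Finset (Fin D.size)}
    (hI : SearchInv ρ ((y, L) :: fr) V) (hs : HoldsSearch A s ((y, L) :: fr) V)
    (hy : AtNode T A D y s) (h48 : s.nat 48 0 = s.nat 32 fr.length) :
    Run (columnsProgram mm) s (200 * (R * (50000000000000 * (R ^ 3 * (K * K)) + TM)))
      fun s' => ∃ L', SearchInv ρ ((y, L') :: fr) V ∧ HoldsSearch A s' ((y, L') :: fr) V ∧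
        ∀ c, T.colSet c ⊆ D.bag y → c ∈ allCols ((y, L') :: fr) := by
  have hR1 := hb.one_le
  have hK1 := hb.one_le_K
  have hcols := hy.setup.input.columns_eq
  obtain ⟨b1, b2, b3, b4, b5, b6, b7, b8⟩ := size_bounds hR1 hK1
  have key : Run (columnsProgram mm) s (200 * (R * (30 + (40000 * R + (30 +
      (40000000000000 * (R ^ 3 * (K * K)) + TM))))))
      fun s' => ∃ L', SearchInv ρ ((y, L') :: fr) V ∧ HoldsSearch A s' ((y, L') :: fr) V ∧
        ∀ c, T.colSet c ⊆ D.bag y → c ∈ allCols ((y, L') :: fr) := by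
    refine Run.forN (fun k s' => ∃ L', SearchInv ρ ((y, L') :: fr) V ∧
      HoldsSearch A s' ((y, L') :: fr) V ∧ ∀ c : Fin (T.shape.rowLen 0), (c : ℕ) < k →
        T.colSet c ⊆ D.bag y → c ∈ allCols ((y, L') :: fr))
      (by rw [hcols]; exact hb.cols_le) hR1 (by omega) ?_ ?_ ?_ ?_ ?_
    · refine ⟨L, hI, hs.frame (P := .setNat 56 (.const 0) (.const 0))
        ⟨fun a ha => ?_, fun _ _ => rfl⟩ ⟨by decide, rfl⟩ (by decide) rfl, by simp⟩
      rw [Memory.setNat_nat_ne]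
      simpa [natFree] using ha
    · rintro k hk s1 hf1 hk1 ⟨L', hI', hs', hall⟩
      rw [hcols] at hk
      set c : Fin (T.shape.rowLen 0) := ⟨k, hk⟩ with hc
      have hy1 := hy.frame hf1 (columnsProgram_keepsNode mm)
      have h481 : s1.nat 48 0 = s1.nat 32 fr.length := by
        have e : ∀ a < 100, (columnsProgram .skip).natFree a = true → s1.nat a = s.nat a :=
          fun a ha ha' => hf1.nat a (by rw [← ha', ← columnsProgram_natFree_congr mm ha]; rfl)
        rw [e 48 (by norm_num) rfl, e 32 (by norm_num) rfl, h48]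
      have hset : ∀ (s2 : Memory) (L' : List (Fin (T.shape.rowLen 0))),
          HoldsSearch A s2 ((y, L') :: fr) V →
          HoldsSearch A (s2.setNat 56 0 (k + 1)) ((y, L') :: fr) V := by
        intro s2 L' h
        refine h.frame (P := .setNat 56 (.const 0) (.const 0)) ⟨fun a ha => ?_, fun _ _ => rfl⟩
          ⟨by decide, rfl⟩ (by decide) rfl
        rw [Memory.setNat_nat_ne]
        simpa [natFree] using ha
      have hstep : ∀ L', (T.colSet c ⊆ D.bag y → c ∈ allCols ((y, L') :: fr)) →
          (∀ c : Fin (T.shape.rowLen 0), (c : ℕ) < k →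
            T.colSet c ⊆ D.bag y → c ∈ allCols ((y, L') :: fr)) →
          ∀ c : Fin (T.shape.rowLen 0), (c : ℕ) < k + 1 →
            T.colSet c ⊆ D.bag y → c ∈ allCols ((y, L') :: fr) := by
        intro L' h1 h2 c' hc'
        by_cases hck : (c' : ℕ) = k
        · have : c' = c := Fin.ext hck
          rw [this]
          exact h1
        · exact h2 c' (by omega)
      have hdone := hs'.done c
      refine Run.branch ?_ ?_
      · intro h
        have h : s1.nat 29 c = 0 := by simpa [Test.Holds, NatExpr.val, hk1] using h
        have hcn : c ∉ allCols ((y, L') :: fr) := by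
          intro h'
          rw [hdone, if_pos h'] at h
          exact one_ne_zero h
        refine (flagsProgram_run hb hy1 (c := c) hk1).seq ?_
        rintro s2 hf2 ⟨h2, h2', h2''⟩
        have hy2 := hy1.frame hf2 ⟨⟨by decide, rfl⟩, by decide⟩
        have hs2 := hs'.frame hf2 ⟨by decide, rfl⟩ (by decide) rfl
        have hk2 : s2.nat 56 0 = k := by rw [hf2.nat 56 rfl, hk1]
        refine Run.branch ?_ ?_
        · intro h
          have hsub : T.colSet c ⊆ D.bag y := h2''.1 (by simpa [Test.Holds, NatExpr.val] using h)
          have h482 : s2.nat 48 0 = s2.nat 32 fr.length := by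
            rw [hf2.nat 48 rfl, hf2.nat 32 rfl, h481]
          have hI2 := hI'.add_col hcn hsub
          refine (columnProgram_run hmm hb hy2 (c := c) hk2 h2' h2 hI2.nodup hsub hs2.count h482
            hs2.frames.2.2.1).mono le_rfl ?_
          rintro s3 hf3 ⟨h3, h3a, h3b, h3c, h3d⟩
          have e3 : ∀ a < 100, (columnProgram .skip).natFree a = true → s3.nat a = s2.nat a :=
            fun a ha ha' => hf3.nat a (by rw [columnProgram_natFree_congr mm ha, ha'])
          have e32 : s3.nat 32 = s2.nat 32 := e3 32 (by norm_num) rfl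
          have e31 : s3.nat 31 = s2.nat 31 := e3 31 (by norm_num) rfl
          refine ⟨c :: L', hI2, hset _ _ ⟨hs2.setup.frame hf3 (columnProgram_keepsSetup mm),
            ⟨?_, ?_, ?_, ?_⟩, ?_, ?_, ?_, ?_⟩, hstep _ (fun _ => ?_) fun c' hc' hc'' => ?_⟩
          · rw [e31, hs2.frames.1]
          · rw [e32, hs2.frames.2.1]
          · rw [e32]; exact h3
          · exact hs2.frames.2.2.2.congr (fun i _ => by rw [e31]) (fun i _ => by rw [e32]) h3a
          · rw [e3 33 (by norm_num) rfl, hs2.depth]; rfl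
          · rw [e3 28 (by norm_num) rfl]; exact hs2.visited
          · intro c'
            have hall' : allCols ((y, c :: L') :: fr) = c :: allCols ((y, L') :: fr) := rfl
            rw [hall']
            by_cases hcc : c' = c
            · subst hcc; simp [h3c]
            · rw [h3d c' fun h => hcc (Fin.ext h), hs2.done c']
              simp [hcc]
          · exact h3b
          · exact List.mem_cons_self
          · exact List.mem_cons_of_mem _ (hall c' hc' hc'')
        · intro h
          have hsub : ¬ T.colSet c ⊆ D.bag y := fun h' => h (by
            have := h2''.2 h'
            simpa [Test.Holds, NatExpr.val] using this)
          refine (Run.skip ?_).mono_time (by omega)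
          exact ⟨L', hI', hset _ _ hs2, hstep _ (fun h => absurd h hsub) hall⟩
      · intro h
        have h : s1.nat 29 c ≠ 0 := by simpa [Test.Holds, NatExpr.val, hk1] using h
        have hcn : c ∈ allCols ((y, L') :: fr) := by
          by_contra h'
          rw [hdone, if_neg h'] at h
          exact h rfl
        refine (Run.skip ?_).mono_time (by omega)
        exact ⟨L', hI', hset _ _ hs', hstep _ (fun _ => hcn) hall⟩
    · rintro s1 _ ⟨L', hI', hs', hall⟩
      rw [hcols] at hall
      exact ⟨L', hI', hs', fun c => hall c c.2⟩
    · have := columnProgram_natFree_congr mm (show 56 < 100 by norm_num)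
      simp only [natFree, this]
      rfl
    · rw [← columnsProgram, columnsProgram_natFree_congr mm (by norm_num)]
      rfl
  refine key.mono_time (Nat.mul_le_mul_left _ (Nat.mul_le_mul_left _ (by omega)))

/-- Completes and pops the node in register `45`. -/
def closeProgram (mm : Program) : Program :=
  .seq (loadNode 45 46 34 47 36 49)
    (.seq (.setNat 48 (.const 0) (.cell 32 (.sub (.reg 33) (.const 1))))
      (.seq (columnsProgram mm)
        (.seq (.branch (.natLt (.const 1) (.reg 33)) (mergeProgram mm) .skip)
          (.setNat 33 (.const 0) (.sub (.reg 33) (.const 1))))))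

/-- A node takes its own columns only now, after the blocks of its children have been merged into
its frame. If it is the last frame, its block contains all columns by `mem_of_singleton`; otherwise
the block is handed to the parent. -/
theorem closeProgram_run {R K TM : ℕ} {mm : Program} (hmm : MatMulBound mm K TM)
    (hb : SizeBound T A D R K) {r : Fin D.size} {ρ : Rooting D.tree r} {s : Memory}
    {y : Fin D.size} {L : List (Fin (T.shape.rowLen 0))}
    {fr : List (Fin D.size × List (Fin (T.shape.rowLen 0)))} {V : Finset (Fin D.size)}
    (hI : SearchInv ρ ((y, L) :: fr) V) (hs : HoldsSearch A s ((y, L) :: fr) V)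
    (h45 : s.nat 45 0 = y) (hadj : ∀ z, D.tree.Adj y z → z ∈ V) :
    Run (closeProgram mm) s (300 * (R * (50000000000000 * (R ^ 3 * (K * K)) + TM))) fun s' =>
      (s'.nat 33 0 = 0 ∧ ∃ L', L'.Nodup ∧ (∀ c, c ∈ L') ∧
        HoldsSegment T A (D.bag y) [] L' (s'.nat 32 0) s') ∨
      ∃ x L' fr', fr.length = fr'.length + 1 ∧ SearchInv ρ ((x, L') :: fr') V ∧
        HoldsSearch A s' ((x, L') :: fr') V := by
  have hR1 := hb.one_le
  have hK1 := hb.one_le_K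
  obtain ⟨b1, b2, b3, b4, b5, b6, b7, b8⟩ := size_bounds hR1 hK1
  have key : Run (closeProgram mm) s (3000000 * (R * K) + (30 +
      (200 * (R * (50000000000000 * (R ^ 3 * (K * K)) + TM)) +
      ((30 + (40000000000000 * (R ^ 3 * (K * K)) + TM)) + 30)))) fun s' =>
      (s'.nat 33 0 = 0 ∧ ∃ L', L'.Nodup ∧ (∀ c, c ∈ L') ∧
        HoldsSegment T A (D.bag y) [] L' (s'.nat 32 0) s') ∨
      ∃ x L' fr', fr.length = fr'.length + 1 ∧ SearchInv ρ ((x, L') :: fr') V ∧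
        HoldsSearch A s' ((x, L') :: fr') V := by
    refine (loadNode_run hb hs.setup y h45).seq fun s1 hf1 h1 => ?_
    have hs1 := hs.frame hf1 ⟨by decide, rfl⟩ (by decide) rfl
    have hy1 : AtNode T A D y s1 := ⟨hs1.setup, h1⟩
    refine Run.setNat_seq' fun s2 hf2 h2 _ => ?_
    have hs2 := hs1.frame hf2 ⟨by decide, rfl⟩ (by decide) rfl
    have hy2 := hy1.frame hf2 ⟨⟨by decide, rfl⟩, by decide⟩
    simp only [NatExpr.val, NatExpr.val_reg, hs1.depth, List.length_cons,
      Nat.add_sub_cancel] at h2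
    have h48 : s2.nat 48 0 = s2.nat 32 fr.length := by rw [hf2.nat 32 rfl, h2]
    refine (columnsProgram_run hmm hb hI hs2 hy2 h48).seq ?_
    rintro s3 hf3 ⟨L', hI3, hs3, hall⟩
    have hy3 := hy2.frame hf3 (columnsProgram_keepsNode mm)
    have e3 : ∀ a < 100, (columnsProgram .skip).natFree a = true → s3.nat a = s2.nat a :=
      fun a ha ha' => hf3.nat a (by rw [columnsProgram_natFree_congr mm ha, ha'])
    have h48' : s3.nat 48 0 = s3.nat 32 fr.length := by
      rw [e3 48 (by norm_num) rfl, e3 32 (by norm_num) rfl, h48]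
    have h33 := hs3.depth
    rw [List.length_cons] at h33
    have hset : ∀ (s' : Memory) (k : ℕ), (Program.setNat 33 (.const 0) (.const 0)).Frame s'
        (s'.setNat 33 0 k) := by
      refine fun s' k => ⟨fun a ha => ?_, fun _ _ => rfl⟩
      rw [Memory.setNat_nat_ne]
      simpa [natFree] using ha
    match fr, hs3, hI3, hall, h33, h48' with
    | [], hs3, hI3, hall, h33, h48' =>
      refine Run.seq (R := fun s4 => s4 = s3) (Run.branch (fun h => ?_) fun _ => ?_) ?_
      · simp [Test.Holds, NatExpr.val, h33] at h
      · exact (Run.skip (Q := fun s4 => s4 = s3) rfl).mono_time (by omega)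
      · rintro s4 - rfl
        refine Run.setNat (Or.inl ⟨by simp [NatExpr.val, h33], L', ?_⟩)
        obtain ⟨g1, g2⟩ := hI3.mem_of_singleton hadj fun c hc => by
          simpa [allCols] using hall c hc
        refine ⟨g1, g2, hs3.frames.2.2.1.congr ?_ fun _ _ => rfl⟩
        rw [Memory.setNat_nat_ne _ _ _ (by decide)]
        rfl
    | (x, Lx) :: fr', hs3, hI3, hall, h33, h48' =>
      have hmerge := mergeProgram_run hmm hb hy3 (x := x) (pre := allCols fr') (L := Lx) (L' := L')
        (o := s3.nat 32 fr'.length) (o' := s3.nat 32 (fr'.length + 1))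
        (by rw [h33]; exact hs3.frames.2.2.2.1) (by rw [h33]; rfl) h48' hs3.frames.2.2.2.2.2.1
        hs3.frames.2.2.1 hI3.mem_bag_of_mem hI3.not_mem_or
      refine Run.seq (Run.branch (fun _ => hmerge) fun h => ?_) ?_
      · exact absurd (show 1 < s3.nat 33 0 by rw [h33]; simp) h
      · rintro s4 hf4 ⟨h4, h4'⟩
        have e4 : ∀ a < 100, (mergeProgram .skip).natFree a = true → s4.nat a = s3.nat a :=
          fun a ha ha' => hf4.nat a (by
            simp only [natFree, mergeProgram_natFree_congr mm ha, ha', Bool.and_true])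
        have hk4 : (Program.branch (.natLt (.const 1) (.reg 33)) (mergeProgram mm)
            .skip).KeepsSetup := by
          refine ⟨fun a ha => ?_, ?_⟩
          · simp only [natFree, (mergeProgram_keepsSetup mm).1 a ha, Bool.and_true]
          · simp only [cpxFree, (mergeProgram_keepsSetup mm).2, Bool.and_true]
        have e31 : s4.nat 31 = s3.nat 31 := e4 31 (by norm_num) rfl
        have e32 : s4.nat 32 = s3.nat 32 := e4 32 (by norm_num) rfl
        have hall' : allCols ((x, L' ++ Lx) :: fr') = allCols ((y, L') :: (x, Lx) :: fr') := by
          simp [allCols]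
        refine Run.setNat (Or.inr ⟨x, L' ++ Lx, fr', rfl, hI3.pop hadj hall, ?_⟩)
        simp only [NatExpr.val, NatExpr.val_reg, e4 33 (by norm_num) rfl, h33, List.length_cons,
          Nat.add_sub_cancel]
        have hne : ∀ a, a ≠ 33 → (s4.setNat 33 0 (fr'.length + 1)).nat a = s4.nat a :=
          fun a ha => Memory.setNat_nat_ne _ _ _ ha
        refine ⟨(hs3.setup.frame hf4 hk4).frame (hset s4 _) ⟨by decide, rfl⟩,
          ⟨?_, ?_, ?_, ?_⟩, by simp, ?_, ?_, ?_⟩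
        · rw [hne 31 (by decide), e31, hs3.frames.2.2.2.1]
        · rw [hne 32 (by decide), e32, hs3.frames.2.2.2.2.1]
        · rw [hne 32 (by decide), e32]
          exact h4
        · refine hs3.frames.2.2.2.2.2.2.congr (fun i _ => ?_) (fun i _ => ?_) fun p hp => ?_
          · rw [hne 31 (by decide), e31]
          · rw [hne 32 (by decide), e32]
          · rw [Memory.setNat_cpx, h4' p hp]
        · rw [hne 28 (by decide), e4 28 (by norm_num) rfl]; exact hs3.visited
        · rw [hne 29 (by decide), e4 29 (by norm_num) rfl, hall']; exact hs3.done
        · rw [hne 30 (by decide), e4 30 (by norm_num) rfl, hall']; exact hs3.count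
  refine key.mono_time ?_
  have h1 : 50000000000000 * (R ^ 3 * (K * K)) + TM ≤
      R * (50000000000000 * (R ^ 3 * (K * K)) + TM) := Nat.le_mul_of_pos_left _ hR1
  omega

/-- Writes to register `50` a neighbour of the node in register `45` that has not been visited, or
the number of nodes if there is none. -/
def findProgram : Program :=
  .seq (.setNat 50 (.const 0) (.cell 0 (.const 4)))
    (.forN 62 0 4 (.branch (.natEq (.cell 28 (.reg 62)) (.const 0))
      (.branch (.natEq (.cell 4 (.add (.cell 11 (.reg 45)) (.reg 62))) (.const 1))
        (.setNat 50 (.const 0) (.reg 62)) .skip) .skip))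

theorem findProgram_run {R K : ℕ} (hb : SizeBound T A D R K) {s : Memory} {y : Fin D.size}
    {V : Finset (Fin D.size)} (hs : Setup T A D s) (h45 : s.nat 45 0 = y)
    (hV : ∀ x : Fin D.size, s.nat 28 x = if x ∈ V then 1 else 0) :
    Run findProgram s (30000 * R) fun s' =>
      (∃ z : Fin D.size, s'.nat 50 0 = z ∧ D.tree.Adj y z ∧ z ∉ V) ∨
      (s'.nat 50 0 = D.size ∧ ∀ z, D.tree.Adj y z → z ∈ V) := by
  classical
  have hR1 := hb.one_le
  have hN := hs.input.size_eq
  have key : Run findProgram s (30 + 200 * (R * (30 + (30 + 30)))) fun s' =>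
      (∃ z : Fin D.size, s'.nat 50 0 = z ∧ D.tree.Adj y z ∧ z ∉ V) ∨
      (s'.nat 50 0 = D.size ∧ ∀ z, D.tree.Adj y z → z ∈ V) := by
    refine Run.setNat_seq' fun s1 hf1 h1 _ => ?_
    simp only [NatExpr.val, hN] at h1
    have hs1 := hs.frame hf1 ⟨by decide, rfl⟩
    refine Run.forN (fun k s' => (∃ z : Fin D.size, s'.nat 50 0 = z ∧ D.tree.Adj y z ∧ z ∉ V) ∨
      (s'.nat 50 0 = D.size ∧ ∀ z : Fin D.size, (z : ℕ) < k → D.tree.Adj y z → z ∈ V))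
      (by rw [hs1.input.size_eq]; exact hb.size_le) hR1 (by norm_num) ?_ ?_ ?_
    · refine Or.inr ⟨?_, by simp⟩
      rw [Memory.setNat_nat_ne _ _ _ (by decide), h1]
    · intro k hk s2 hf2 hk2 hinv
      rw [hs1.input.size_eq] at hk
      have hs2 := hs1.frame hf2 ⟨by decide, rfl⟩
      set z : Fin D.size := ⟨k, hk⟩ with hz
      have h28 : s2.nat 28 k = if z ∈ V then 1 else 0 := by
        rw [hf2.nat 28 rfl, hf1.nat 28 rfl]
        exact hV z
      have h4 : s2.nat 4 (y * D.size + k) = if D.tree.Adj y z then 1 else 0 := by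
        rw [hs2.input.tree_eq y z]
      have h45' : s2.nat 45 0 = y := by rw [hf2.nat 45 rfl, hf1.nat 45 rfl, h45]
      have hcont : (D.tree.Adj y z → z ∈ V) → (fun s'' : Memory =>
          (∃ z : Fin D.size, (s''.setNat 62 0 (k + 1)).nat 50 0 = z ∧ D.tree.Adj y z ∧ z ∉ V) ∨
          ((s''.setNat 62 0 (k + 1)).nat 50 0 = D.size ∧
            ∀ z : Fin D.size, (z : ℕ) < k + 1 → D.tree.Adj y z → z ∈ V)) s2 := by
        intro h
        simp only [Memory.setNat_nat_ne _ _ _ (show 50 ≠ 62 by decide)]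
        refine hinv.imp id fun h' => ⟨h'.1, fun z' hz' => ?_⟩
        by_cases hzk : (z' : ℕ) = k
        · have : z' = z := Fin.ext hzk
          rw [this]
          exact h
        · exact h'.2 z' (by omega)
      refine Run.branch (fun h => Run.branch (fun h' => ?_) fun h' => ?_) fun h => ?_
      · have h : z ∉ V := by simpa [Test.Holds, NatExpr.val, hk2, h28] using h
        have h' : D.tree.Adj y z := by
          simpa [Test.Holds, NatExpr.val, hk2, h45', hs2.treeRow y y.2, h4] using h'
        refine Run.setNat (Or.inl ⟨z, ?_, h', h⟩)
        rw [Memory.setNat_nat_ne _ _ _ (by decide)]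
        simp [NatExpr.val, hk2, hz]
      · have h' : ¬ D.tree.Adj y z := by
          simpa [Test.Holds, NatExpr.val, hk2, h45', hs2.treeRow y y.2, h4] using h'
        exact (Run.skip (hcont fun h'' => absurd h'' h')).mono_time (by norm_num)
      · have h : z ∈ V := by simpa [Test.Holds, NatExpr.val, hk2, h28] using h
        exact (Run.skip (hcont fun _ => h)).mono_time (by norm_num)
    · intro s' _ h
      rw [hs1.input.size_eq] at h
      exact h.imp id fun h => ⟨h.1, fun z => h.2 z z.2⟩
  exact key.mono_time (by omega)

/-- The depth first search. -/
def searchProgram (mm : Program) : Program :=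
  .loop (.natLt (.const 0) (.reg 33))
    (.seq (.setNat 45 (.const 0) (.cell 31 (.sub (.reg 33) (.const 1))))
      (.seq findProgram
        (.branch (.natLt (.reg 50) (.cell 0 (.const 4))) openProgram (closeProgram mm))))

theorem searchProgram_run {R K TM : ℕ} {mm : Program} (hmm : MatMulBound mm K TM)
    (hb : SizeBound T A D R K) {r : Fin D.size} (ρ : Rooting D.tree r) {s : Memory}
    (hs : HoldsSearch A s [(r, [])] {r}) :
    Run (searchProgram mm) s (800 * (R * (R * (50000000000000 * (R ^ 3 * (K * K)) + TM))))
      fun s' => ∃ L, L.Nodup ∧ (∀ c, c ∈ L) ∧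
        s'.cpx 2 (s'.nat 32 0) = T.segment A [] L (A.zeroState n) (A.zeroState n) := by
  have hR1 := hb.one_le
  have hK1 := hb.one_le_K
  obtain ⟨b1, b2, b3, b4, b5, b6, b7, b8⟩ := size_bounds hR1 hK1
  have h1 : 50000000000000 * (R ^ 3 * (K * K)) + TM ≤
      R * (50000000000000 * (R ^ 3 * (K * K)) + TM) := Nat.le_mul_of_pos_left _ hR1
  have hcard : ∀ V : Finset (Fin D.size), V.card ≤ D.size := fun V =>
    (Finset.card_le_univ V).trans_eq (Fintype.card_fin _)
  have key : Run (searchProgram mm) s ((2 * (D.size - 1) + 1 + 1) * ((30 + (30000 * R +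
      (30 + 300 * (R * (50000000000000 * (R ^ 3 * (K * K)) + TM))))) + 60))
      fun s' => ∃ L, L.Nodup ∧ (∀ c, c ∈ L) ∧
        s'.cpx 2 (s'.nat 32 0) = T.segment A [] L (A.zeroState n) (A.zeroState n) := by
    -- Twice the number of unvisited nodes plus the height of the stack drops by one in every step:
    -- opening a node trades 2 for 1, closing one removes a frame.
    refine Run.loop (fun k s' => ∃ y L fr V, SearchInv ρ ((y, L) :: fr) V ∧
      HoldsSearch A s' ((y, L) :: fr) V ∧ 2 * (D.size - V.card) + fr.length + 1 ≤ k) _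
      ⟨r, [], [], {r}, SearchInv.init, hs, by simp⟩ ?_
    rintro k s0 ⟨y, L, fr, V, hI, hs0, hk⟩
    have h33 := hs0.depth
    rw [List.length_cons] at h33
    refine ⟨by simp [Test.Holds, NatExpr.val, h33], ?_⟩
    refine Run.setNat_seq' fun s1 hf1 h45 _ => ?_
    simp only [NatExpr.val, NatExpr.val_reg, h33, Nat.add_sub_cancel, hs0.frames.1] at h45
    have hs1 := hs0.frame hf1 ⟨by decide, rfl⟩ (by decide) rfl
    refine (findProgram_run hb hs1.setup h45 hs1.visited).seq fun s2 hf2 h2 => ?_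
    have hs2 := hs1.frame hf2 ⟨by decide, rfl⟩ (by decide) rfl
    have h45' : s2.nat 45 0 = y := by rw [hf2.nat 45 rfl, h45]
    have hN := hs2.setup.input.size_eq
    refine Run.branch (fun h => ?_) fun h => ?_
    · have h : s2.nat 50 0 < D.size := by simpa [Test.Holds, NatExpr.val, hN] using h
      rcases h2 with ⟨z, hz, hyz, hzV⟩ | ⟨h2, -⟩
      · refine (openProgram_run hb hs2 hz).mono (by omega) fun s3 _ h3 => Or.inl ⟨k - 1, by omega,
          z, [], _, _, hI.push hyz hzV, h3, ?_⟩
        have := hcard (insert z V)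
        rw [Finset.card_insert_of_notMem hzV] at this ⊢
        simp only [List.length_cons]
        omega
      · omega
    · have h : ¬ s2.nat 50 0 < D.size := by simpa [Test.Holds, NatExpr.val, hN] using h
      rcases h2 with ⟨z, hz, -, -⟩ | ⟨-, h2⟩
      · exact absurd (hz ▸ z.2) h
      · refine (closeProgram_run hmm hb hI hs2 h45' h2).mono le_rfl fun s3 _ h3 => ?_
        rcases h3 with ⟨h3, L', hL', hL'', hseg⟩ | ⟨x, L', fr', hlen, hI3, hs3⟩
        · refine Or.inr ⟨by simp [Test.Holds, NatExpr.val, h3], L', hL', hL'', ?_⟩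
          -- The state with number 0 is the zero state, so the value is in the first cell of the
          -- block.
          have := hseg 0 (bagDim_pos A _) 0 (bagDim_pos A _)
          simpa [bagState_zero] using this
        · exact Or.inl ⟨k - 1, by omega, x, L', fr', V, hI3, hs3, by omega⟩
  refine key.mono_time ?_
  have hN := hb.size_le
  have hN1 : 1 ≤ D.size := r.pos
  have h2 : (2 * (D.size - 1) + 1 + 1) * ((30 + (30000 * R +
      (30 + 300 * (R * (50000000000000 * (R ^ 3 * (K * K)) + TM))))) + 60) ≤
      (2 * R) * (400 * (R * (50000000000000 * (R ^ 3 * (K * K)) + TM))) :=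
    Nat.mul_le_mul (by omega) (by omega)
  refine h2.trans (le_of_eq (by ring))

end search

/-! ### The program -/

/-- Computes the tables of multiples and prepares the search. -/
def initProgram : Program :=
  .seq (mulTable 6 27 0 2 0 2)
    (.seq (mulTable 7 24 0 5 0 2)
      (.seq (mulTable 8 25 0 5 24 0)
        (.seq (mulTable 9 26 0 1 25 0)
          (.seq (mulTable 10 26 0 4 0 0)
            (.seq (mulTable 11 26 0 4 0 4)
              (.seq (mulTable 12 26 0 3 0 2)
                (.seq (fillNat 28 0 4 0)
                  (.seq (fillNat 29 0 3 0)
                    (.seq (fillNat 30 0 0 0)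
                      (.seq (.setNat 33 (.const 0) (.const 0))
                        (.setNat 50 (.const 0) (.const 0))))))))))))

section main

variable {n d m : ℕ} {T : RectTableau n d m} {A : NcABP d m} {D : TreeDecomposition T.columnGraph}

/-- The tables `7`, `8`, `9` are chained: the multiple left over by one, first `w * m` and then `w *
(w * m)`, is the step of the next. -/
theorem initProgram_run {R K : ℕ} (hb : SizeBound T A D R K) {s : Memory}
    (hs : HoldsInput T A D s) :
    Run initProgram s (200000 * (R * K)) fun s' => HoldsSearch A s' ([] : List (Fin D.size × _)) ∅ ∧
      s'.nat 50 0 = 0 := by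
  have hR1 := hb.one_le
  have hK1 := hb.one_le_K
  have hM1 : 1 ≤ R * K := Nat.mul_pos hR1 hK1
  have hR : ∀ {x}, x ≤ R → x ≤ R * K := fun h => h.trans (Nat.le_mul_of_pos_right _ hK1)
  have hK : A.width ≤ R * K := hb.width_le.trans (Nat.le_mul_of_pos_left _ hR1)
  have key : Run initProgram s (13000 * (R * K) + (13000 * (R * K) + (13000 * (R * K) +
      (13000 * (R * K) + (13000 * (R * K) + (13000 * (R * K) + (13000 * (R * K) + (6000 * (R * K) +
      (6000 * (R * K) + (6000 * (R * K) + (30 + 30)))))))))))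
      fun s' => HoldsSearch A s' ([] : List (Fin D.size × _)) ∅ ∧ s'.nat 50 0 = 0 := by
    refine (mulTable_run (s := s) (M := R * K) (by rw [hs.m_eq]; exact hR hb.m_le) hM1).seq ?_
    rintro s1 hf1 ⟨h1, -⟩
    have e1 : s1.nat 0 = s.nat 0 := hf1.nat 0 rfl
    refine (mulTable_run (s := s1) (M := R * K) (by rw [e1, hs.width_eq]; exact hK) hM1).seq ?_
    rintro s2 hf2 ⟨h2, h2'⟩
    have e2 : s2.nat 0 = s.nat 0 := by rw [hf2.nat 0 rfl, e1]
    refine (mulTable_run (s := s2) (M := R * K) (by rw [e2, hs.width_eq]; exact hK) hM1).seq ?_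
    rintro s3 hf3 ⟨h3, h3'⟩
    have e3 : s3.nat 0 = s.nat 0 := by rw [hf3.nat 0 rfl, e2]
    refine (mulTable_run (s := s3) (M := R * K) (by rw [e3, hs.d_eq]; exact hR hb.d_le) hM1).seq ?_
    rintro s4 hf4 ⟨h4, -⟩
    have e4 : s4.nat 0 = s.nat 0 := by rw [hf4.nat 0 rfl, e3]
    refine (mulTable_run (s := s4) (M := R * K) (by rw [e4, hs.size_eq]; exact hR hb.size_le)
      hM1).seq ?_
    rintro s5 hf5 ⟨h5, -⟩
    have e5 : s5.nat 0 = s.nat 0 := by rw [hf5.nat 0 rfl, e4]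
    refine (mulTable_run (s := s5) (M := R * K) (by rw [e5, hs.size_eq]; exact hR hb.size_le)
      hM1).seq ?_
    rintro s6 hf6 ⟨h6, -⟩
    have e6 : s6.nat 0 = s.nat 0 := by rw [hf6.nat 0 rfl, e5]
    refine (mulTable_run (s := s6) (M := R * K) (by rw [e6, hs.columns_eq]; exact hR hb.cols_le)
      hM1).seq ?_
    rintro s7 hf7 ⟨h7, -⟩
    have e7 : s7.nat 0 = s.nat 0 := by rw [hf7.nat 0 rfl, e6]
    refine (fillNat_run (s := s7) (M := R * K) (by rw [e7, hs.size_eq]; exact hR hb.size_le)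
      hM1).seq ?_
    intro s8 hf8 h8
    have e8 : s8.nat 0 = s.nat 0 := by rw [hf8.nat 0 rfl, e7]
    refine (fillNat_run (s := s8) (M := R * K) (by rw [e8, hs.columns_eq]; exact hR hb.cols_le)
      hM1).seq ?_
    intro s9 hf9 h9
    have e9 : s9.nat 0 = s.nat 0 := by rw [hf9.nat 0 rfl, e8]
    refine (fillNat_run (s := s9) (M := R * K) (by rw [e9, hs.n_eq]; exact hR hb.n_le) hM1).seq ?_
    intro s10 hf10 h10
    refine Run.setNat_seq' fun s11 hf11 h11 _ => ?_
    refine Run.setNat ?_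
    obtain ⟨s12, hs12⟩ : ∃ s12, s12 = s11.setNat 50 0 0 := ⟨_, rfl⟩
    have hf12 : ∀ a, a ≠ 50 → s12.nat a = s11.nat a := fun a ha => by
      rw [hs12, Memory.setNat_nat_ne _ _ _ ha]
    simp only [NatExpr.val]
    rw [← hs12]
    have hin : ∀ a < 6, s12.nat a = s.nat a := fun a ha => by
      have hfree : ∀ P ∈ [mulTable 6 27 0 2 0 2, mulTable 7 24 0 5 0 2, mulTable 8 25 0 5 24 0,
          mulTable 9 26 0 1 25 0, mulTable 10 26 0 4 0 0, mulTable 11 26 0 4 0 4,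
          mulTable 12 26 0 3 0 2, fillNat 28 0 4 0, fillNat 29 0 3 0, fillNat 30 0 0 0,
          .setNat 33 (.const 0) (.const 0)], P.natFree a = true := by
        revert a
        decide
      rw [hf12 a (by omega), hf11.nat a (hfree _ (by simp)), hf10.nat a (hfree _ (by simp)),
        hf9.nat a (hfree _ (by simp)), hf8.nat a (hfree _ (by simp)),
        hf7.nat a (hfree _ (by simp)), hf6.nat a (hfree _ (by simp)),
        hf5.nat a (hfree _ (by simp)), hf4.nat a (hfree _ (by simp)),
        hf3.nat a (hfree _ (by simp)), hf2.nat a (hfree _ (by simp)),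
        hf1.nat a (hfree _ (by simp))]
    have hcpx : s12.cpx 0 = s.cpx 0 := by
      rw [hs12, Memory.setNat_cpx, hf11.cpx 0 rfl, hf10.cpx 0 rfl, hf9.cpx 0 rfl, hf8.cpx 0 rfl,
        hf7.cpx 0 rfl, hf6.cpx 0 rfl, hf5.cpx 0 rfl, hf4.cpx 0 rfl, hf3.cpx 0 rfl, hf2.cpx 0 rfl,
        hf1.cpx 0 rfl]
    rw [hs.m_eq] at h1
    rw [e1, hs.width_eq, hs.m_eq] at h2 h2'
    rw [e2, hs.width_eq, h2'] at h3 h3'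
    rw [e3, hs.d_eq, h3'] at h4
    rw [e4, hs.size_eq, hs.n_eq] at h5
    rw [e5, hs.size_eq] at h6
    rw [e6, hs.columns_eq, hs.m_eq] at h7
    rw [e7, hs.size_eq] at h8
    rw [e8, hs.columns_eq] at h9
    rw [e9, hs.n_eq] at h10
    refine ⟨⟨⟨hs.congr hin hcpx, ?_, ?_, ?_, ?_, ?_, ?_, ?_⟩, trivial, ?_, ?_, ?_, ?_⟩, ?_⟩
    · rw [hf12 _ (by decide), hf11.nat 6 rfl, hf10.nat 6 rfl, hf9.nat 6 rfl, hf8.nat 6 rfl,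
        hf7.nat 6 rfl, hf6.nat 6 rfl, hf5.nat 6 rfl, hf4.nat 6 rfl, hf3.nat 6 rfl, hf2.nat 6 rfl]
      exact h1
    · rw [hf12 _ (by decide), hf11.nat 7 rfl, hf10.nat 7 rfl, hf9.nat 7 rfl, hf8.nat 7 rfl,
        hf7.nat 7 rfl, hf6.nat 7 rfl, hf5.nat 7 rfl, hf4.nat 7 rfl, hf3.nat 7 rfl]
      exact h2
    · rw [hf12 _ (by decide), hf11.nat 8 rfl, hf10.nat 8 rfl, hf9.nat 8 rfl, hf8.nat 8 rfl,
        hf7.nat 8 rfl, hf6.nat 8 rfl, hf5.nat 8 rfl, hf4.nat 8 rfl]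
      exact h3
    · rw [hf12 _ (by decide), hf11.nat 9 rfl, hf10.nat 9 rfl, hf9.nat 9 rfl, hf8.nat 9 rfl,
        hf7.nat 9 rfl, hf6.nat 9 rfl, hf5.nat 9 rfl]
      exact h4
    · rw [hf12 _ (by decide), hf11.nat 10 rfl, hf10.nat 10 rfl, hf9.nat 10 rfl, hf8.nat 10 rfl,
        hf7.nat 10 rfl, hf6.nat 10 rfl]
      exact h5
    · rw [hf12 _ (by decide), hf11.nat 11 rfl, hf10.nat 11 rfl, hf9.nat 11 rfl, hf8.nat 11 rfl,
        hf7.nat 11 rfl]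
      exact h6
    · rw [hf12 _ (by decide), hf11.nat 12 rfl, hf10.nat 12 rfl, hf9.nat 12 rfl, hf8.nat 12 rfl]
      exact h7
    · rw [hf12 _ (by decide)]
      exact h11
    · intro x
      rw [hf12 _ (by decide), hf11.nat 28 rfl, hf10.nat 28 rfl, hf9.nat 28 rfl, h8 x x.2]
      simp
    · intro c
      rw [hf12 _ (by decide), hf11.nat 29 rfl, hf10.nat 29 rfl, h9 c c.2]
      simp [allCols]
    · intro v
      rw [hf12 _ (by decide), hf11.nat 30 rfl, h10 v v.2]
      simp [allCols, RectTableau.count]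
    · rw [hs12]; simp
  exact key.mono_time (by omega)

/-- The program that evaluates `f_T`, for a program `mm` that multiplies matrices. -/
def mainProgram (mm : Program) : Program :=
  .branch (.natEq (.cell 0 (.const 0)) (.const 0)) (.setCpx 1 (.const 0) (.const 1))
    (.seq initProgram
      (.seq openProgram
        (.seq (searchProgram mm) (.setCpx 1 (.const 0) (.cell 2 (.cell 32 (.const 0)))))))

/-- Without numbers there are no boxes and no columns, and the empty product of matrices is the
identity. -/
theorem RectTableau.eval_of_isEmpty [IsEmpty (Fin n)] (T : RectTableau n d m) (p : Tensor d m)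
    (A : NcABP d m) (hp : p.IsSymmetric) (hA : A.Computes p) : T.eval p = 1 := by
  rw [T.eval_eq_segment A p hp hA (L := []) List.nodup_nil]
  · rw [RectTableau.segment, Matrix.one_apply_eq]
  · intro c
    have hc : (0, (c : ℕ)) ∈ T.shape.cells :=
      (YoungDiagram.mem_cells _).2 (YoungDiagram.mem_iff_lt_rowLen.2 c.2)
    exact isEmptyElim (T.entry ⟨_, hc⟩)

theorem RectTableau.rowLen_le (T : RectTableau n d m) : T.shape.rowLen 0 ≤ n * d := by
  obtain ⟨S⟩ := T.nonempty_lift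
  have h := Fintype.card_congr S.1
  rw [Fintype.card_prod, Fintype.card_fin, Fintype.card_fin, Fintype.card_coe] at h
  rw [← h, YoungDiagram.rowLen_eq_card]
  exact Finset.card_le_card (Finset.filter_subset _ _)

/-- A number forces a nonempty bag, so the exponent is at least 1 and `K` bounds the width. For `n =
0` all bags are empty and `K = 1`, too little time even to build tables of length `w`; this is why
`mainProgram` treats that case apart. -/
theorem sizeBound [Nonempty (Fin n)] (T : RectTableau n d m) (A : NcABP d m)
    (D : TreeDecomposition T.columnGraph) :
    SizeBound T A D ((n + 1) * (d + 1) * (m + 1) * (D.size + 1))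
      (A.width ^ Finset.univ.sup fun x => (D.bag x).card) := by
  have h1 : 1 ≤ Finset.univ.sup fun x => (D.bag x).card := by
    obtain ⟨v⟩ := ‹Nonempty (Fin n)›
    obtain ⟨x, hx⟩ := D.vertex_covered v
    exact (Finset.card_pos.2 ⟨v, hx⟩).trans_le
      (Finset.le_sup (f := fun x => (D.bag x).card) (Finset.mem_univ x))
  have hnd : (n + 1) * (d + 1) ≤ (n + 1) * (d + 1) * (m + 1) * (D.size + 1) := by
    rw [mul_assoc ((n + 1) * (d + 1))]
    exact Nat.le_mul_of_pos_right _ (by positivity)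
  have hm : (m + 1) * (D.size + 1) ≤ (n + 1) * (d + 1) * (m + 1) * (D.size + 1) := by
    rw [mul_assoc ((n + 1) * (d + 1))]
    exact Nat.le_mul_of_pos_left _ (by positivity)
  refine ⟨?_, ?_, ?_, ?_, ?_, Nat.succ_le_of_lt (by positivity), ?_, fun x => ?_⟩
  · exact le_trans (by nlinarith) hnd
  · exact le_trans (by nlinarith) hnd
  · exact le_trans (by nlinarith) hm
  · exact le_trans (by nlinarith) hm
  · exact T.rowLen_le.trans (le_trans (by nlinarith) hnd)
  · exact Nat.le_self_pow (by omega) _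
  · rw [bagDim_eq_pow]
    exact Nat.pow_le_pow_right A.width_pos
      (Finset.le_sup (f := fun x => (D.bag x).card) (Finset.mem_univ x))

theorem mainProgram_run {R K TM : ℕ} {mm : Program} (hmm : MatMulBound mm K TM)
    (hb : SizeBound T A D R K) (hn : n ≠ 0) {p : Tensor d m} (hp : p.IsSymmetric)
    (hA : A.Computes p) {s : Memory} (hs : HoldsInput T A D s) :
    Run (mainProgram mm) s (100000000000000000 * (R ^ 5 * (K * K)) + 800 * (R ^ 5 * TM))
      fun s' => s'.cpx 1 0 = T.eval p := by
  have hR1 := hb.one_le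
  have hK1 := hb.one_le_K
  obtain ⟨b1, b2, b3, b4, b5, b6, b7, b8⟩ := size_bounds hR1 hK1
  have key : Run (mainProgram mm) s (30 + (200000 * (R * K) + (10000000 * (R ^ 3 * (K * K)) +
      (800 * (R * (R * (50000000000000 * (R ^ 3 * (K * K)) + TM))) + 30))))
      fun s' => s'.cpx 1 0 = T.eval p := by
    refine Run.branch (fun h => absurd (hs.n_eq.symm.trans h) hn) fun _ => ?_
    refine (initProgram_run hb hs).seq ?_
    rintro s1 - ⟨hs1, h1⟩
    obtain ⟨x⟩ := D.isTree.connected.nonempty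
    -- The root is node 0, since `initProgram` leaves 0 in the register that `openProgram` reads.
    set r : Fin D.size := ⟨0, x.pos⟩ with hr
    obtain ⟨ρ⟩ := D.isTree.nonempty_rooting r
    refine (openProgram_run hb hs1 (y := r) h1).seq fun s2 _ hs2 => ?_
    refine (searchProgram_run hmm hb ρ hs2).seq ?_
    rintro s3 - ⟨L, hL, hL', h3⟩
    refine Run.setCpx ?_
    simp only [NatExpr.val, CpxExpr.val, Memory.setCpx_cpx_self]
    rw [h3, T.eval_eq_segment A p hp hA hL hL']
  refine key.mono_time ?_
  -- Of the five factors `R`, three pay for a determinant, one for the columns examined at a node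
  -- and one for the steps of the search.
  have h1 : R * (R * (50000000000000 * (R ^ 3 * (K * K)) + TM)) =
      50000000000000 * (R ^ 5 * (K * K)) + R * R * TM := by ring
  have h2 : R ^ 3 * (K * K) ≤ R ^ 5 * (K * K) :=
    Nat.mul_le_mul_right _ (Nat.pow_le_pow_right hR1 (by norm_num))
  have h3 : R * R * TM ≤ R ^ 5 * TM := by
    refine Nat.mul_le_mul_right _ ?_
    rw [← sq]
    exact Nat.pow_le_pow_right hR1 (by norm_num)
  omega

end main

/-! ### Passage to the exponent and the final time bound. -/

theorem matMulBound_of_inTime {ω : ℝ} {mm : Program} {C : ℝ} (hω : 0 ≤ ω)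
    (h : ∀ (k : ℕ), 1 ≤ k → ∀ (X Y : Matrix (Fin k) (Fin k) ℂ) (s : Memory),
      s.nat 0 0 = k →
      (∀ i j : Fin k, s.cpx 0 (i * k + j) = X i j) →
      (∀ i j : Fin k, s.cpx 1 (i * k + j) = Y i j) →
      ∃ (s' : Memory) (t : ℕ), Runs mm s s' t ∧ (t : ℝ) ≤ C * (k : ℝ) ^ ω ∧
        ∀ i j : Fin k, s'.cpx 2 (i * k + j) = (X * Y) i j) (K : ℕ) :
    MatMulBound mm K ⌊(⌈|C|⌉₊ : ℝ) * (K : ℝ) ^ ω⌋₊ := by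
  -- The time for `K` rows covers fewer rows because `ω ≥ 0`. The constant is replaced by the
  -- natural number `⌈|C|⌉₊`, so that it can enter a polynomial with natural coefficients.
  intro k hk hkK X Y s h0 hX hY
  obtain ⟨s', t, hr, ht, hs'⟩ := h k hk X Y s h0 hX hY
  refine ⟨s', t, hr, Nat.le_floor (ht.trans ?_), hs'⟩
  refine mul_le_mul ((le_abs_self C).trans (Nat.le_ceil _)) ?_ (by positivity) (by positivity)
  exact Real.rpow_le_rpow (by positivity) (by exact_mod_cast hkK) hω

theorem mainTheorem3 (ω : ℝ) (hω : MatMulInTime ω) :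
    ∃ (P : Program) (q : MvPolynomial (Fin 4) ℕ),
      ∀ (n d m : ℕ) (T : RectTableau n d m) (p : Tensor d m) (A : NcABP d m)
        (D : TreeDecomposition T.columnGraph) (s : Memory),
        p.IsSymmetric → A.Computes p → HoldsInput T A D s →
        ∃ (s' : Memory) (t : ℕ), Runs P s s' t ∧
          (t : ℝ) ≤ (A.width : ℝ) ^ (ω * ((D.width : ℝ) + 1)) *
            (MvPolynomial.eval ![n, d, m, D.size] q : ℕ) ∧
          s'.cpx 1 0 = T.eval p := by
  have hω2 := hω.two_le
  obtain ⟨mm, C, hmm⟩ := hω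
  set c := ⌈|C|⌉₊ with hc
  refine ⟨mainProgram mm, MvPolynomial.C (100000000000000000 + 800 * c) *
    ((MvPolynomial.X 0 + 1) * (MvPolynomial.X 1 + 1) * (MvPolynomial.X 2 + 1) *
      (MvPolynomial.X 3 + 1)) ^ 5, ?_⟩
  intro n d m T p A D s hp hA hs
  set b := Finset.univ.sup fun x => (D.bag x).card with hbd
  set K := A.width ^ b with hK
  set R := (n + 1) * (d + 1) * (m + 1) * (D.size + 1) with hR
  -- The width of the decomposition plus one is the size `b` of the largest bag.
  have hKω : (A.width : ℝ) ^ (ω * ((D.width : ℝ) + 1)) = (K : ℝ) ^ ω := by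
    have : ((D.width : ℝ) + 1) = (b : ℝ) := by
      rw [TreeDecomposition.width, ← hbd]
      push_cast
      ring
    rw [this, mul_comm ω, Real.rpow_mul (by positivity), Real.rpow_natCast, hK]
    push_cast
    rfl
  have hq : MvPolynomial.eval ![n, d, m, D.size] (MvPolynomial.C (100000000000000000 + 800 * c) *
      ((MvPolynomial.X 0 + 1) * (MvPolynomial.X 1 + 1) * (MvPolynomial.X 2 + 1) *
        (MvPolynomial.X 3 + 1)) ^ 5) = (100000000000000000 + 800 * c) * R ^ 5 := by
    simp [hR]
  rw [hKω, hq]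
  have hK1 : 1 ≤ K := Nat.one_le_pow _ _ A.width_pos
  have hR1 : 1 ≤ R := Nat.one_le_iff_ne_zero.2 (by positivity)
  have hR5 : (1 : ℝ) ≤ (R : ℝ) ^ 5 := one_le_pow₀ (by exact_mod_cast hR1)
  have hKω1 : (1 : ℝ) ≤ (K : ℝ) ^ ω :=
    Real.one_le_rpow (by exact_mod_cast hK1) (by linarith)
  rcases Nat.eq_zero_or_pos n with hn | hn
  · subst hn
    refine ⟨_, _, .branch_true (show s.nat 0 0 = 0 from hs.n_eq)
      (.setCpx 1 (.const 0) (.const 1) s),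
      ?_, ?_⟩
    · have h1 : (1 : ℝ) ≤ (K : ℝ) ^ ω * (R : ℝ) ^ 5 := one_le_mul_of_one_le_of_one_le hKω1 hR5
      have h2 : (0 : ℝ) ≤ c * ((K : ℝ) ^ ω * (R : ℝ) ^ 5) := by positivity
      simp only [Test.cost, NatExpr.cost, CpxExpr.cost]
      push_cast
      nlinarith
    · rw [T.eval_of_isEmpty p A hp hA]
      simp [NatExpr.val, CpxExpr.val]
  · have : Nonempty (Fin n) := ⟨⟨0, hn⟩⟩
    obtain ⟨s', t, hr, ht, hs'⟩ := mainProgram_run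
      (matMulBound_of_inTime (by linarith) hmm K) (sizeBound T A D) hn.ne' hp hA hs
    refine ⟨s', t, hr, ?_, hs'⟩
    have h1 : ((⌊(c : ℝ) * (K : ℝ) ^ ω⌋₊ : ℕ) : ℝ) ≤ c * (K : ℝ) ^ ω :=
      Nat.floor_le (by positivity)
    -- Here `ω ≥ 2` absorbs the work on single matrix entries into the cost of a multiplication.
    have h2 : (K : ℝ) * K ≤ (K : ℝ) ^ ω := by
      rw [← sq, ← Real.rpow_two]
      exact Real.rpow_le_rpow_of_exponent_le (by exact_mod_cast hK1) hω2
    have h3 : (t : ℝ) ≤ 100000000000000000 * ((R : ℝ) ^ 5 * (K * K)) +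
        800 * ((R : ℝ) ^ 5 * (⌊(c : ℝ) * (K : ℝ) ^ ω⌋₊ : ℕ)) := by exact_mod_cast ht
    refine h3.trans ?_
    calc _ ≤ 100000000000000000 * ((R : ℝ) ^ 5 * (K : ℝ) ^ ω) +
          800 * ((R : ℝ) ^ 5 * (c * (K : ℝ) ^ ω)) := by gcongr
      _ = _ := by push_cast; ring
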